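/- Let $d\ge 1$ and $0<\lambda\le\Lambda$. There is a constant $C>0$, depending only on $d,\lambda,\Lambda$, such that the following holds. Let $a=a(t,x,v)$ be a measurable field of symmetric $d\times d$ matrices on $(0,\infty)\times\mathbb R^d\times\mathbb R^d$ (no further regularity is required) with $$\lambda|\xi|^2\le \xi\cdot a(t,x,v)\,\xi\le\Lambda|\xi|^2\qquad\text{for all } t>0,\ x,v,\xi\in\mathbb R^d .$$ Let $f_{\rm in}\in L^1(\mathbb R^{2d})$, and let $f\ge 0$ be a weak solution of $$(\partial_t+v\cdot\nabla_x)f=\nabla_v\cdot(a\nabla_v f)\ \text{ in }(0,\infty)\times\mathbb R^{2d},\qquad f(0,\cdot,\cdot)=f_{\rm in},$$ that is, $f\in C([0,\infty);L^1(\mathbb R^{2d}))$ with $f(0)=f_{\rm in}$; $f$ and its distributional gradient $\nabla_v f$ belong to $L^2_{\rm loc}((0,\infty)\times\mathbb R^{2d})$; and $$\int f\,(\partial_t\varphi+v\cdot\nabla_x\varphi)\,dt\,dx\,dv=\int a\nabla_v f\cdot\nabla_v\varphi\,dt\,dx\,dv\qquad\text{for all }\varphi\in C_c^\infty((0,\infty)\times\mathbb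 R^{2d}).$$ Then, for every $t>0$ and almost every $(x,v)\in\mathbb R^{2d}$, $$f(t,x,v)\le \frac{C}{t^{2d}}\int_{\mathbb R^{2d}} f_{\rm in}\,dx\,dv .$$ -/

import Mathlib

open MeasureTheory Filter Topology
open scoped ContDiff

namespace KineticFP

/-- The velocity (and position) space `ℝ^d` with its Euclidean norm. -/
abbrev E (d : ℕ) : Type := EuclideanSpace ℝ (Fin d)

/-- Points `(t, x, v)` of `ℝ × ℝ^d × ℝ^d`; `volume` is Lebesgue measure. -/
abbrev Z (d : ℕ) : Type := ℝ × E d × E d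

/-- The open region `(0, ∞) × ℝ^d × ℝ^d`. -/
def posTime (d : ℕ) : Set (Z d) := {z | 0 < z.1}

/-- Smooth test functions with compact support in `(0, ∞) × ℝ^d × ℝ^d`. -/
structure IsTest {d : ℕ} (φ : Z d → ℝ) : Prop where
  smooth : ContDiff ℝ ∞ φ
  compact : HasCompactSupport φ
  supp : tsupport φ ⊆ posTime d

/-- The transport derivative `(∂_t + v · ∇_x) φ` at `z = (t, x, v)`. -/
noncomputable def transport {d : ℕ} (φ : Z d → ℝ) (z : Z d) : ℝ :=
  fderiv ℝ φ z (1, z.2.2, 0)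

/-- The directional derivative `e · ∇_v φ` at `z = (t, x, v)`. -/
noncomputable def velDeriv {d : ℕ} (φ : Z d → ℝ) (z : Z d) (e : E d) : ℝ :=
  fderiv ℝ φ z (0, 0, e)

/-- Membership in `L²_loc((0, ∞) × ℝ^d × ℝ^d)`. -/
def IsL2Loc {d : ℕ} {F : Type*} [NormedAddCommGroup F] (g : Z d → F) : Prop :=
  ∀ K : Set (Z d), IsCompact K → K ⊆ posTime d → MemLp g 2 (volume.restrict K)

/-- `g` is the gradient `∇_v f`, in the sense of distributions on `(0, ∞) × ℝ^d × ℝ^d`. -/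
def IsWeakVelGrad {d : ℕ} (f : Z d → ℝ) (g : Z d → E d) : Prop :=
  ∀ φ : Z d → ℝ, IsTest φ → ∀ e : E d,
    ∫ z, f z * velDeriv φ z e = - ∫ z, inner ℝ (g z) e * φ z

/-- A measurable, symmetric, uniformly elliptic matrix field on `(0, ∞) × ℝ^d × ℝ^d`
with ellipticity constants `lam ≤ Lam`; no regularity in `(t, x, v)` is required. -/
structure IsElliptic {d : ℕ} (lam Lam : ℝ) (a : Z d → Matrix (Fin d) (Fin d) ℝ) : Prop where
  meas : ∀ i j, AEMeasurable (fun z => a z i j) (volume.restrict (posTime d))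
  symm : ∀ z ∈ posTime d, (a z).IsSymm
  lower : ∀ z ∈ posTime d, ∀ ξ : E d,
    lam * ‖ξ‖ ^ 2 ≤ inner ℝ ξ (Matrix.toEuclideanLin (a z) ξ)
  upper : ∀ z ∈ posTime d, ∀ ξ : E d,
    inner ℝ ξ (Matrix.toEuclideanLin (a z) ξ) ≤ Lam * ‖ξ‖ ^ 2

/-- `f` is a weak solution of `(∂_t + v · ∇_x) f = ∇_v · (a ∇_v f)` on
`(0, ∞) × ℝ^d × ℝ^d` with initial datum `fin ∈ L¹`: it belongs to `C([0, ∞); L¹(ℝ^{2d}))`,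
equals `fin` at time `0`, and for positive times `f` and its distributional gradient
`∇_v f` are locally square integrable and satisfy the equation against every test function. -/
structure IsSolution {d : ℕ} (a : Z d → Matrix (Fin d) (Fin d) ℝ)
    (fin : E d × E d → ℝ) (f : Z d → ℝ) : Prop where
  integrable : ∀ t : ℝ, 0 ≤ t → Integrable (fun p : E d × E d => f (t, p))
  continuous : ∀ t : ℝ, 0 ≤ t →
    Tendsto (fun s : ℝ => ∫ p : E d × E d, |f (s, p) - f (t, p)|) (𝓝[Set.Ici 0] t) (𝓝 0)
  initial : ∀ᵐ p : E d × E d, f (0, p) = fin p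
  locL2 : IsL2Loc f
  weak : ∃ g : Z d → E d, IsL2Loc g ∧ IsWeakVelGrad f g ∧
    ∀ φ : Z d → ℝ, IsTest φ →
      ∫ z, f z * transport φ z =
        ∫ z, velDeriv φ z (Matrix.toEuclideanLin (a z) (g z))

end KineticFP

/-! The estimate combines a local L¹ → L∞ bound for subsolutions on kinetic cylinders with the fact
that mass does not increase. On a cylinder of time length comparable to T a subsolution is at most C
T^{-(2d+1)} times its integral over a slightly larger cylinder (`exists_local_bound`,
`exists_isScale_cyl`). The velocity radius R and the position radius P of the cylinder may be
arbitrarily large, as long as R ≥ √T and P ≥ R T, so the cylinders exhaust a time slab. There the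
integral is at most (5/2) T ∫ fin, one power of T cancels, and T^{-2d} remains.

Diffusion acts only in v, so the gain of integrability has to come from the interplay of ∇_v with
∂_t + v·∇_x. It is captured by a kinetic Poincaré inequality of Nash type (`exists_poincare`): ∫ w²
is bounded by r^{-(4d+2)} (∫ w)² plus r-weighted squares of the gradient, the flux and the source.
To prove it, z is joined to earlier points by explicit curves tangent to the two admissible fields,
with two velocity controls p = (p₁, p₂). Averaging over p and over the curve parameter spreads the
end point over an open set, so the mean of w is controlled by its integral. The divergence of the
flux is integrated by parts in p; time runs like σ³ along the curve, which exactly compensates the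
degeneration of the endpoint map at σ = 0.

Weak subsolutions are reached by averaging over left translations of the Galilean group, which
commute with both fields. The same approximation justifies the chain rule (`IsSub.chain`), hence the
Caccioppoli inequality (`IsSub.energy`) and the stability of subsolutions under smooth truncation
(`IsSub.hinge`). Poincaré at a small radius, with its error terms absorbed through Caccioppoli,
gives a reverse Hölder inequality from L² to L¹ (`exists_reverse_holder`). Since `hinge κ s ≤ s² /
(2κ)`, the masses of successive truncations obey a quadratic recursion and tend to zero when the
level exceeds a multiple of the initial mass.

For the mass (`IsSolution.mass_le`), the equation is tested with cutoffs tending to one. The flux is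
integrable on time slabs because the local estimates can be integrated over all Galilean translates
of a cylinder. Continuity in L¹ then reaches the initial time, and it also turns the almost
everywhere bound into a bound at every time (`IsSolution.slice_bound`). -/

namespace KineticFP

open scoped ENNReal

/-! ### Differentiation under the integral sign. -/

section Parametric

variable {X Y V : Type*} [NormedAddCommGroup X] [NormedSpace ℝ X] [FiniteDimensional ℝ X]
  [NormedAddCommGroup Y] [NormedSpace ℝ Y] [MeasurableSpace Y] [BorelSpace Y]
  [FiniteDimensional ℝ Y]
  [NormedAddCommGroup V] [NormedSpace ℝ V] [FiniteDimensional ℝ V]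

/-- Integrals against a `C¹` kernel are differentiable under the integral sign. -/
theorem hasFDerivAt_integral_kernel {μ : Measure Y} {K : X → Y → ℝ}
    (hK : ContDiff ℝ 1 (Function.uncurry K)) {f : Y → V} (hf : Integrable f μ)
    {S : Set Y} (hS : IsCompact S) (hfS : ∀ y, y ∉ S → f y = 0) :
    (∀ x, HasFDerivAt (fun x => ∫ y, K x y • f y ∂μ)
      (∫ y, (fderiv ℝ (fun x => K x y) x).smulRight (f y) ∂μ) x) ∧
    (Continuous fun x => ∫ y, (fderiv ℝ (fun x => K x y) x).smulRight (f y) ∂μ) ∧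
    ∀ x, Integrable (fun y => (fderiv ℝ (fun x => K x y) x).smulRight (f y)) μ := by
  have hKx : ∀ x y, HasFDerivAt (fun x => K x y)
      ((fderiv ℝ (Function.uncurry K) (x, y)).comp (ContinuousLinearMap.inl ℝ X Y)) x := by
    intro x y
    have h1 := (hK.differentiable one_ne_zero (x, y)).hasFDerivAt
    exact HasFDerivAt.comp (g := Function.uncurry K) (f := fun e => (e, y)) x h1
      (hasFDerivAt_prodMk_left x y)
  have hD : ∀ x y, fderiv ℝ (fun x => K x y) x =
      (fderiv ℝ (Function.uncurry K) (x, y)).comp (ContinuousLinearMap.inl ℝ X Y) :=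
    fun x y => (hKx x y).fderiv
  have hcont : Continuous (fun p : X × Y => fderiv ℝ (fun x => K x p.2) p.1) := by
    simp_rw [hD]
    exact (hK.continuous_fderiv one_ne_zero).clm_comp continuous_const
  -- Only y in the compact set S matters, so near a given point the derivative of the kernel has a
  -- bound uniform in y, which serves as the majorant.
  have hbd : ∀ x₀ : X, ∃ C, 0 ≤ C ∧ ∀ x ∈ Metric.closedBall x₀ 1, ∀ y ∈ S,
      ‖fderiv ℝ (fun x => K x y) x‖ ≤ C := by
    intro x₀
    obtain ⟨C, hC⟩ := ((isCompact_closedBall x₀ 1).prod hS).exists_bound_of_continuousOn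
      hcont.continuousOn
    exact ⟨max C 0, le_max_right _ _, fun x hx y hy =>
      (hC (x, y) ⟨hx, hy⟩).trans (le_max_left _ _)⟩
  have hmeas' : ∀ x, AEStronglyMeasurable
      (fun y => (fderiv ℝ (fun x => K x y) x).smulRight (f y)) μ := by
    intro x
    have h1 : Continuous fun y => fderiv ℝ (fun x => K x y) x :=
      hcont.comp (continuous_const.prodMk continuous_id)
    have h2 : Continuous fun p : (X →L[ℝ] ℝ) × V => p.1.smulRight p.2 :=
      (ContinuousLinearMap.smulRightL ℝ X V).continuous₂
    exact h2.comp_aestronglyMeasurable (h1.aestronglyMeasurable.prodMk hf.aestronglyMeasurable)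
  have hnorm : ∀ x y (C : ℝ), (y ∈ S → ‖fderiv ℝ (fun x => K x y) x‖ ≤ C) →
      ‖(fderiv ℝ (fun x => K x y) x).smulRight (f y)‖ ≤ C * ‖f y‖ := by
    intro x y C h
    rw [ContinuousLinearMap.norm_smulRight_apply]
    by_cases hy : y ∈ S
    · gcongr; exact h hy
    · simp [hfS y hy]
  refine ⟨?_, ?_, fun x => ?_⟩
  · intro x₀
    obtain ⟨C, hC0, hC⟩ := hbd x₀
    have hKc : ∀ x, Continuous (K x) := fun x =>
      hK.continuous.comp (continuous_const.prodMk continuous_id)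
    refine hasFDerivAt_integral_of_dominated_of_fderiv_le (bound := fun y => C * ‖f y‖)
      (F' := fun x y => (fderiv ℝ (fun x => K x y) x).smulRight (f y))
      (Metric.closedBall_mem_nhds x₀ one_pos)
      (Eventually.of_forall fun x => (hKc x).aestronglyMeasurable.smul hf.aestronglyMeasurable)
      ?_ (hmeas' x₀) ?_ (hf.norm.const_mul C) ?_
    · obtain ⟨B, hB⟩ := hS.exists_bound_of_continuousOn (hKc x₀).continuousOn
      refine (hf.norm.const_mul B).mono'
        ((hKc x₀).aestronglyMeasurable.smul hf.aestronglyMeasurable)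
        (Eventually.of_forall fun y => ?_)
      by_cases hy : y ∈ S
      · rw [norm_smul]; gcongr; exact hB y hy
      · simp [hfS y hy]
    · exact Eventually.of_forall fun y x hx => hnorm x y C fun hy => hC x hx y hy
    · refine Eventually.of_forall fun y x _ => ?_
      have := (hKx x y).smul_const (f y)
      rwa [← hD] at this
  · refine continuous_iff_continuousAt.2 fun x₀ => ?_
    obtain ⟨C, hC0, hC⟩ := hbd x₀
    refine continuousAt_of_dominated (bound := fun y => C * ‖f y‖)
      (Eventually.of_forall hmeas') ?_ (hf.norm.const_mul C) ?_
    · filter_upwards [Metric.closedBall_mem_nhds x₀ one_pos] with x hx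
      exact Eventually.of_forall fun y => hnorm x y C fun hy => hC x hx y hy
    · refine Eventually.of_forall fun y => ?_
      have h1 : Continuous fun x => fderiv ℝ (fun x => K x y) x :=
        hcont.comp (continuous_id.prodMk continuous_const)
      have h2 : Continuous fun p : (X →L[ℝ] ℝ) × V => p.1.smulRight p.2 :=
        (ContinuousLinearMap.smulRightL ℝ X V).continuous₂
      exact (h2.comp (h1.prodMk continuous_const)).continuousAt
  · obtain ⟨C, hC0, hC⟩ := hbd x
    exact (hf.norm.const_mul C).mono' (hmeas' x) (Eventually.of_forall fun y =>
      hnorm x y C fun hy => hC x (Metric.mem_closedBall_self zero_le_one) y hy)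

end Parametric

/-! ### Averages over measure preserving maps. -/

section Averaging

/-- The Cauchy–Schwarz inequality for lower integrals against a finite measure. -/
theorem lintegral_sq_le {A : Type*} [MeasurableSpace A] {κ : Measure A} {φ : A → ℝ≥0∞}
    (hφ : AEMeasurable φ κ) :
    (∫⁻ a, φ a ∂κ) ^ 2 ≤ κ Set.univ * ∫⁻ a, φ a ^ 2 ∂κ := by
  have h := ENNReal.lintegral_mul_le_Lp_mul_Lq κ Real.HolderConjugate.two_two
    (f := fun _ => 1) (g := φ) aemeasurable_const hφ
  have h2 : (∫⁻ a, φ a ∂κ) ≤ (κ Set.univ) ^ (1 / 2 : ℝ) * (∫⁻ a, φ a ^ 2 ∂κ) ^ (1 / 2 : ℝ) := by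
    simpa using h
  calc (∫⁻ a, φ a ∂κ) ^ 2
      ≤ ((κ Set.univ) ^ (1 / 2 : ℝ) * (∫⁻ a, φ a ^ 2 ∂κ) ^ (1 / 2 : ℝ)) ^ 2 := by gcongr
    _ = _ := by
      rw [mul_pow, ← ENNReal.rpow_natCast, ← ENNReal.rpow_natCast, ← ENNReal.rpow_mul,
        ← ENNReal.rpow_mul]
      norm_num

variable {A B : Type*} [MeasurableSpace A] [MeasurableSpace B]

/-- Averaging over measure preserving maps contracts the `L²` norm. -/
theorem lintegral_average_sq_le {κ : Measure A} [SFinite κ] {μ : Measure B} [SFinite μ]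
    {m : A → B → B} (hm : Measurable (Function.uncurry m))
    (hmp : ∀ a, MeasurePreserving (m a) μ μ)
    {ψ : B → ℝ≥0∞} (hψ : Measurable ψ) :
    ∫⁻ z, (∫⁻ a, ψ (m a z) ∂κ) ^ 2 ∂μ ≤ κ Set.univ ^ 2 * ∫⁻ z, ψ z ^ 2 ∂μ := by
  have hmeas : Measurable fun p : A × B => ψ (m p.1 p.2) := hψ.comp hm
  calc ∫⁻ z, (∫⁻ a, ψ (m a z) ∂κ) ^ 2 ∂μ
      ≤ ∫⁻ z, κ Set.univ * ∫⁻ a, ψ (m a z) ^ 2 ∂κ ∂μ := by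
        refine lintegral_mono fun z => lintegral_sq_le ?_
        exact (hmeas.comp measurable_prodMk_right).aemeasurable
    _ = κ Set.univ * ∫⁻ z, ∫⁻ a, ψ (m a z) ^ 2 ∂κ ∂μ := by
        refine lintegral_const_mul _ ?_
        exact Measurable.lintegral_prod_right' (f := fun p : B × A => ψ (m p.2 p.1) ^ 2)
          ((hmeas.comp measurable_swap).pow_const 2)
    _ = κ Set.univ * ∫⁻ a, ∫⁻ z, ψ (m a z) ^ 2 ∂μ ∂κ := by
        rw [lintegral_lintegral_swap]
        exact ((hmeas.comp measurable_swap).pow_const 2).aemeasurable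
    _ = κ Set.univ * ∫⁻ a, ∫⁻ z, ψ z ^ 2 ∂μ ∂κ := by
        congr 1
        refine lintegral_congr fun a => ?_
        exact (hmp a).lintegral_comp (hψ.pow_const 2)
    _ = _ := by rw [lintegral_const]; ring

end Averaging

/-! ### Galilean translations and their invariant measure. -/

section Translation

variable {d : ℕ}

/-- Left translation `y ∘ z` in the Galilean group. -/
def lt (y z : Z d) : Z d := (y.1 + z.1, y.2.1 + z.2.1 + z.1 • y.2.2, y.2.2 + z.2.2)

/-- The element `y ∘ z⁻¹` of the Galilean group. -/
def rdiv (z y : Z d) : Z d :=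
  (y.1 - z.1, y.2.1 - z.2.1 - z.1 • (y.2.2 - z.2.2), y.2.2 - z.2.2)

theorem rdiv_lt (y z : Z d) : rdiv z (lt y z) = y := by
  ext <;> simp [rdiv, lt] <;> ring

theorem lt_rdiv (y z : Z d) : lt (rdiv z y) z = y := by
  ext <;> simp [rdiv, lt] <;> ring

theorem contDiff_rdiv {n : WithTop ℕ∞} : ContDiff ℝ n (fun p : Z d × Z d => rdiv p.1 p.2) := by
  unfold rdiv
  fun_prop

theorem contDiff_lt {n : WithTop ℕ∞} : ContDiff ℝ n (fun p : Z d × Z d => lt p.1 p.2) := by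
  unfold lt
  fun_prop

/-- Maps `(t, x, v) ↦ (α + t, β(t, v) + x, γ + v)` preserve Lebesgue measure. -/
theorem measurePreserving_shear (α : ℝ) {β : ℝ → E d → E d}
    (hβ : Measurable (Function.uncurry β)) (γ : E d) :
    MeasurePreserving (fun z : Z d => ((α + z.1, β z.1 z.2.2 + z.2.1, γ + z.2.2) : Z d)) := by
  refine MeasurePreserving.skew_product (g := fun (t : ℝ) (p : E d × E d) =>
    ((β t p.2 + p.1, γ + p.2) : E d × E d)) (measurePreserving_add_left volume α) ?_ ?_
  · refine Measurable.prodMk (Measurable.add ?_ (by fun_prop)) (by fun_prop)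
    exact hβ.comp (f := fun p : ℝ × E d × E d => (p.1, p.2.2)) (by fun_prop)
  · refine Eventually.of_forall fun t => ?_
    have h1 : MeasurePreserving (fun q : E d × E d => ((γ + q.1, β t q.1 + q.2) : E d × E d))
        (volume.prod volume) (volume.prod volume) := by
      refine MeasurePreserving.skew_product (g := fun (v x : E d) => β t v + x)
        (measurePreserving_add_left volume γ) ?_ ?_
      · refine Measurable.add ?_ (by fun_prop)
        exact hβ.comp (f := fun p : E d × E d => (t, p.1)) (by fun_prop)
      · exact Eventually.of_forall fun v => (measurePreserving_add_left volume (β t v)).map_eq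
    -- The position shift depends on the velocity, so the velocity must be the base of the skew
    -- product; swapping the factors arranges this.
    have h2 : MeasurePreserving (Prod.swap : E d × E d → E d × E d)
        (volume.prod volume) (volume.prod volume) := Measure.measurePreserving_swap
    exact ((h2.comp h1).comp h2).map_eq

theorem measurePreserving_lt (y : Z d) : MeasurePreserving (lt y) := by
  have := measurePreserving_shear (d := d) y.1 (β := fun t _ => y.2.1 + t • y.2.2)
    (by unfold Function.uncurry; fun_prop) y.2.2
  convert this using 2 with z
  ext <;> simp [lt]; ring

theorem measurePreserving_lt_left (z : Z d) : MeasurePreserving (fun y : Z d => lt y z) := by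
  have := measurePreserving_shear (d := d) z.1 (β := fun _ v => z.2.1 + z.1 • v)
    (by unfold Function.uncurry; fun_prop) z.2.2
  convert this using 2 with y
  ext <;> simp [lt] <;> ring

/-- `lt · z` as a homeomorphism. -/
def ltHomeo (z : Z d) : Z d ≃ₜ Z d where
  toFun y := lt y z
  invFun y := rdiv z y
  left_inv y := rdiv_lt y z
  right_inv y := lt_rdiv y z
  continuous_toFun := (contDiff_lt (n := 0)).continuous.comp (by fun_prop : Continuous fun y : Z d => (y, z))
  continuous_invFun := (contDiff_rdiv (n := 0)).continuous.comp (by fun_prop : Continuous fun y : Z d => (z, y))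

/-- The left translation average of `f` with weight `ρ`. -/
noncomputable def mol {V : Type*} [NormedAddCommGroup V] [NormedSpace ℝ V]
    (ρ : Z d → ℝ) (f : Z d → V) (z : Z d) : V :=
  ∫ y, ρ (rdiv z y) • f y

theorem mol_eq {V : Type*} [NormedAddCommGroup V] [NormedSpace ℝ V]
    (ρ : Z d → ℝ) (f : Z d → V) (z : Z d) :
    mol ρ f z = ∫ y, ρ y • f (lt y z) := by
  have h := (measurePreserving_lt_left z).integral_comp (ltHomeo z).measurableEmbedding
    (fun y => ρ (rdiv z y) • f y)
  simp only [mol, ← h, rdiv_lt]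

end Translation

instance (d : ℕ) : (volume : Measure (E d × E d)).IsAddHaarMeasure :=
  Measure.prod.instIsAddHaarMeasure (volume : Measure (E d)) (volume : Measure (E d))

instance (d : ℕ) : (volume : Measure (Z d)).IsAddHaarMeasure :=
  Measure.prod.instIsAddHaarMeasure (volume : Measure ℝ) (volume : Measure (E d × E d))

/-! ### Approximation by left translation averages. -/

section Mollification

variable {d : ℕ} {V : Type*} [NormedAddCommGroup V] [NormedSpace ℝ V]

theorem continuous_rdiv_right (z : Z d) : Continuous (rdiv z) :=
  (contDiff_rdiv (n := 0)).continuous.comp (by fun_prop : Continuous fun y : Z d => (z, y))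

theorem integrable_kernel_smul {f : Z d → V} (hf : Integrable f) {ρ : Z d → ℝ}
    (hρ : Continuous ρ) (hρc : HasCompactSupport ρ) (z : Z d) :
    Integrable (fun y => ρ (rdiv z y) • f y) := by
  obtain ⟨C, hC⟩ := hρc.exists_bound_of_continuous hρ
  exact hf.bdd_smul C (hρ.comp (continuous_rdiv_right z)).aestronglyMeasurable
    (Eventually.of_forall fun y => hC _)

theorem mol_sub {f g : Z d → V} (hf : Integrable f) (hg : Integrable g) {ρ : Z d → ℝ}
    (hρ : Continuous ρ) (hρc : HasCompactSupport ρ) (z : Z d) :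
    mol ρ (fun y => f y - g y) z = mol ρ f z - mol ρ g z := by
  unfold mol
  rw [← integral_sub (integrable_kernel_smul hf hρ hρc z) (integrable_kernel_smul hg hρ hρc z)]
  simp_rw [smul_sub]

theorem map_mol {W : Type*} [NormedAddCommGroup W] [NormedSpace ℝ W] [CompleteSpace V]
    [CompleteSpace W] (L : V →L[ℝ] W)
    {f : Z d → V} (hf : Integrable f) {ρ : Z d → ℝ}
    (hρ : Continuous ρ) (hρc : HasCompactSupport ρ) (z : Z d) :
    L (mol ρ f z) = mol ρ (fun y => L (f y)) z := by
  unfold mol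
  rw [← L.integral_comp_comm (integrable_kernel_smul hf hρ hρc z)]
  simp

theorem mol_congr {f g : Z d → V} (h : f =ᵐ[volume] g) (ρ : Z d → ℝ) (z : Z d) :
    mol ρ f z = mol ρ g z := by
  unfold mol
  refine integral_congr_ae ?_
  filter_upwards [h] with y hy
  rw [hy]

/-- Left translation averages contract the `L²` norm. -/
theorem lintegral_mol_sq_le {f : Z d → V} (hf : AEStronglyMeasurable f) {ρ : Z d → ℝ}
    (hρ : Continuous ρ) (hρ0 : ∀ y, 0 ≤ ρ y) (hρi : Integrable ρ) (hρ1 : ∫ y, ρ y = 1) :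
    ∫⁻ z, ‖mol ρ f z‖ₑ ^ 2 ≤ ∫⁻ z, ‖f z‖ₑ ^ 2 := by
  have hmk : ∀ z, mol ρ f z = mol ρ (hf.mk f) z := fun z => mol_congr hf.ae_eq_mk ρ z
  have hk : ∫⁻ z, ‖f z‖ₑ ^ 2 = ∫⁻ z, ‖hf.mk f z‖ₑ ^ 2 := by
    refine lintegral_congr_ae ?_
    filter_upwards [hf.ae_eq_mk] with z hz
    rw [hz]
  rw [hk]
  simp_rw [hmk]
  set g := hf.mk f
  have hg : StronglyMeasurable g := hf.stronglyMeasurable_mk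
  have hmρ : Measurable fun y => ENNReal.ofReal (ρ y) := hρ.measurable.ennreal_ofReal
  -- The weight is a probability density, so `mol ρ` averages over left translations, each of which
  -- preserves volume.
  set κ : Measure (Z d) := volume.withDensity fun y => ENNReal.ofReal (ρ y)
  have hκ : κ Set.univ = 1 := by
    rw [withDensity_apply _ MeasurableSet.univ, Measure.restrict_univ,
      ← ofReal_integral_eq_lintegral_ofReal hρi (Eventually.of_forall hρ0), hρ1,
      ENNReal.ofReal_one]
  have hlt : Measurable (Function.uncurry (lt (d := d))) :=
    (contDiff_lt (n := 0)).continuous.measurable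
  have h := lintegral_average_sq_le (κ := κ) (μ := volume) hlt measurePreserving_lt
    hg.enorm
  rw [hκ, one_pow, one_mul] at h
  refine (lintegral_mono fun z => ?_).trans h
  have h1 : ‖mol ρ g z‖ₑ ≤ ∫⁻ y, ‖g (lt y z)‖ₑ ∂κ := by
    have h2 : Measurable fun y => ‖g (lt y z)‖ₑ :=
      hg.enorm.comp (hlt.comp (measurable_prodMk_right (y := z)))
    rw [mol_eq, lintegral_withDensity_eq_lintegral_mul _ hmρ h2]
    refine (enorm_integral_le_lintegral_enorm _).trans (lintegral_mono fun y => ?_)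
    simp only [Pi.mul_apply, enorm_smul]
    rw [Real.enorm_of_nonneg (hρ0 y)]
  gcongr

theorem lintegral_sub_sq_le {B : Type*} [MeasurableSpace B] {μ : Measure B} (f g h k : B → V)
    (hfg : AEStronglyMeasurable (fun z => f z - g z) μ)
    (hgh : AEStronglyMeasurable (fun z => g z - h z) μ) :
    ∫⁻ z, ‖f z - k z‖ₑ ^ 2 ∂μ ≤ 3 * (∫⁻ z, ‖f z - g z‖ₑ ^ 2 ∂μ + ∫⁻ z, ‖g z - h z‖ₑ ^ 2 ∂μ
      + ∫⁻ z, ‖h z - k z‖ₑ ^ 2 ∂μ) := by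
  rw [← lintegral_add_left' (hfg.enorm.pow_const 2),
    ← lintegral_add_left' (f := fun z => ‖f z - g z‖ₑ ^ 2 + ‖g z - h z‖ₑ ^ 2)
      ((hfg.enorm.pow_const 2).add (hgh.enorm.pow_const 2)),
    ← lintegral_const_mul' _ _ (by norm_num)]
  refine lintegral_mono fun z => ?_
  have h1 : ‖f z - k z‖ ^ 2 ≤ 3 * (‖f z - g z‖ ^ 2 + ‖g z - h z‖ ^ 2 + ‖h z - k z‖ ^ 2) := by
    have : ‖f z - k z‖ ≤ ‖f z - g z‖ + ‖g z - h z‖ + ‖h z - k z‖ := by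
      calc ‖f z - k z‖ = ‖(f z - g z) + (g z - h z) + (h z - k z)‖ := by congr 1; abel
        _ ≤ _ := norm_add₃_le
    nlinarith [norm_nonneg (f z - k z), norm_nonneg (f z - g z), norm_nonneg (g z - h z),
      norm_nonneg (h z - k z), sq_nonneg (‖f z - g z‖ - ‖g z - h z‖),
      sq_nonneg (‖f z - g z‖ - ‖h z - k z‖), sq_nonneg (‖g z - h z‖ - ‖h z - k z‖)]
  have h2 := ENNReal.ofReal_le_ofReal h1
  rw [ENNReal.ofReal_mul (by norm_num), ENNReal.ofReal_add (by positivity) (by positivity),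
    ENNReal.ofReal_add (by positivity) (by positivity)] at h2
  simpa only [ENNReal.ofReal_pow (norm_nonneg _), ofReal_norm, ENNReal.ofReal_ofNat]
    using h2

/-- Translates of a compactly supported continuous function are uniformly close to it. -/
theorem exists_compact_lt_sub {g : Z d → V} (hg : Continuous g) (hgc : HasCompactSupport g) :
    ∃ K : Set (Z d), IsCompact K ∧
      (∀ y ∈ Metric.closedBall (0 : Z d) 1, ∀ z, z ∉ K → g (lt y z) = 0 ∧ g z = 0) ∧
      ∀ ε > 0, ∃ δ > 0, δ ≤ 1 ∧ ∀ y ∈ Metric.closedBall (0 : Z d) δ, ∀ z ∈ K,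
        ‖g (lt y z) - g z‖ ≤ ε := by
  have hinv : ∀ y z : Z d, lt (rdiv y 0) (lt y z) = z := by
    intro y z
    ext <;> simp [rdiv, lt]; ring
  have hl0 : ∀ z : Z d, lt 0 z = z := by
    intro z
    ext <;> simp [lt]
  have hltc : Continuous fun p : Z d × Z d => lt p.1 p.2 := (contDiff_lt (n := 0)).continuous
  have hrc : Continuous fun p : Z d × Z d => rdiv p.1 p.2 := (contDiff_rdiv (n := 0)).continuous
  have hmap : Continuous fun p : Z d × Z d => lt (rdiv p.1 0) p.2 :=
    hltc.comp ((hrc.comp (continuous_fst.prodMk continuous_const)).prodMk continuous_snd)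
  set K := (fun p : Z d × Z d => lt (rdiv p.1 0) p.2) ''
    (Metric.closedBall (0 : Z d) 1 ×ˢ tsupport g) with hKdef
  have hK : IsCompact K := ((isCompact_closedBall _ _).prod hgc).image hmap
  have hout : ∀ y ∈ Metric.closedBall (0 : Z d) 1, ∀ z, z ∉ K → g (lt y z) = 0 := by
    intro y hy z hz
    by_contra hne
    exact hz ⟨(y, lt y z), ⟨hy, subset_tsupport _ hne⟩, hinv y z⟩
  refine ⟨K, hK, fun y hy z hz => ⟨hout y hy z hz, ?_⟩, fun ε hε => ?_⟩
  · simpa [hl0] using hout 0 (by simp) z hz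
  · have hev : ∀ᶠ y in 𝓝 (0 : Z d), ∀ z ∈ K, ‖g (lt y z) - g z‖ < ε := by
      refine hK.eventually_forall_of_forall_eventually fun z _ => ?_
      have hc : Continuous fun p : Z d × Z d => ‖g (lt p.1 p.2) - g p.2‖ :=
        ((hg.comp hltc).sub (hg.comp continuous_snd)).norm
      refine (hc.tendsto (0, z)).eventually_lt_const ?_
      simpa [hl0] using hε
    obtain ⟨δ, hδ, hδ'⟩ := Metric.eventually_nhds_iff_ball.1 hev
    refine ⟨min (δ / 2) 1, by positivity, min_le_right _ _, fun y hy z hz => ?_⟩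
    refine (hδ' y ?_ z hz).le
    rw [Metric.mem_closedBall] at hy
    rw [Metric.mem_ball]
    linarith [min_le_left (δ / 2) 1]

theorem norm_mol_sub_le [CompleteSpace V] {g : Z d → V} (hg : Continuous g)
    {ρ : Z d → ℝ} (hρ : Continuous ρ) (hρ0 : ∀ y, 0 ≤ ρ y) (hρc : HasCompactSupport ρ)
    (hρ1 : ∫ y, ρ y = 1) (z : Z d) {ε : ℝ}
    (h : ∀ y ∈ tsupport ρ, ‖g (lt y z) - g z‖ ≤ ε) : ‖mol ρ g z - g z‖ ≤ ε := by
  have hρi : Integrable ρ := hρ.integrable_of_hasCompactSupport hρc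
  have hc : Continuous fun y => g (lt y z) :=
    hg.comp ((contDiff_lt (n := 0)).continuous.comp
      (by fun_prop : Continuous fun y : Z d => (y, z)))
  have h1 : Integrable fun y => ρ y • g (lt y z) :=
    (hρ.smul hc).integrable_of_hasCompactSupport hρc.smul_right
  have h2 : mol ρ g z - g z = ∫ y, ρ y • (g (lt y z) - g z) := by
    rw [mol_eq]
    simp_rw [smul_sub]
    rw [integral_sub h1 (hρi.smul_const _), integral_smul_const, hρ1, one_smul]
  rw [h2]
  calc ‖∫ y, ρ y • (g (lt y z) - g z)‖ ≤ ∫ y, ρ y * ε := by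
        refine norm_integral_le_of_norm_le (hρi.mul_const ε) (Eventually.of_forall fun y => ?_)
        rw [norm_smul, Real.norm_of_nonneg (hρ0 y)]
        by_cases hy : y ∈ tsupport ρ
        · exact mul_le_mul_of_nonneg_left (h y hy) (hρ0 y)
        · simp [image_eq_zero_of_notMem_tsupport hy]
    _ = ε := by rw [integral_mul_const, hρ1, one_mul]

theorem eLpNorm_two_sq {B : Type*} [MeasurableSpace B] {μ : Measure B} (f : B → V) :
    eLpNorm f 2 μ ^ 2 = ∫⁻ z, ‖f z‖ₑ ^ 2 ∂μ := by
  rw [eLpNorm_eq_lintegral_rpow_enorm_toReal (by norm_num) (by norm_num),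
    ← ENNReal.rpow_natCast, ← ENNReal.rpow_mul]
  norm_num

theorem continuous_mol [FiniteDimensional ℝ V] {f : Z d → V} (hf : Integrable f)
    {S : Set (Z d)} (hS : IsCompact S) (hfS : ∀ y, y ∉ S → f y = 0)
    {ρ : Z d → ℝ} (hρ : ContDiff ℝ 1 ρ) : ContDiff ℝ 1 (mol ρ f) := by
  have hK : ContDiff ℝ 1 (Function.uncurry fun z y : Z d => ρ (rdiv z y)) :=
    hρ.comp contDiff_rdiv
  obtain ⟨h1, h2, -⟩ := hasFDerivAt_integral_kernel hK hf hS hfS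
  refine contDiff_one_iff_fderiv.2 ⟨fun z => (h1 z).differentiableAt, ?_⟩
  have : fderiv ℝ (mol ρ f) = fun z => _ := funext fun z => (h1 z).fderiv
  rw [this]
  exact h2

/-- Approximation in `L²` by left translation averages. -/
theorem exists_delta_mol [FiniteDimensional ℝ V] {f : Z d → V} (hf : MemLp f 2)
    (hfi : Integrable f) {ε : ℝ≥0∞} (hε : ε ≠ 0) :
    ∃ δ > 0, δ ≤ 1 ∧ ∀ ρ : Z d → ℝ, ContDiff ℝ 1 ρ → (∀ y, 0 ≤ ρ y) →
      tsupport ρ ⊆ Metric.closedBall 0 δ → ∫ y, ρ y = 1 →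
      ∫⁻ z, ‖mol ρ f z - f z‖ₑ ^ 2 ≤ ε := by
  have : CompleteSpace V := FiniteDimensional.complete ℝ V
  -- There are three error terms and the square of their sum costs a factor three, hence ε / 9.
  obtain ⟨η, hη0, hη⟩ : ∃ η : ℝ≥0∞, η ≠ 0 ∧ η ^ 2 ≤ ε / 9 := by
    have h9 : ε / 9 ≠ 0 := by simp [hε]
    refine ⟨min 1 (ε / 9), by simp [h9], ?_⟩
    calc min 1 (ε / 9) ^ 2 = min 1 (ε / 9) * min 1 (ε / 9) := sq _
      _ ≤ 1 * (ε / 9) := by gcongr <;> simp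
      _ = _ := one_mul _
  obtain ⟨g, hgc, hfg, hg, hgL⟩ := hf.exists_hasCompactSupport_eLpNorm_sub_le (by norm_num) hη0
  have hgi : Integrable g := hg.integrable_of_hasCompactSupport hgc
  have hN : ∫⁻ z, ‖f z - g z‖ₑ ^ 2 ≤ ε / 9 := by
    have := eLpNorm_two_sq (μ := volume) (f - g)
    simp only [Pi.sub_apply] at this
    rw [← this]
    exact le_trans (by gcongr) hη
  obtain ⟨K, hK, hKout, hKin⟩ := exists_compact_lt_sub hg hgc
  obtain ⟨s, hs, hsε⟩ : ∃ s : ℝ, 0 < s ∧ ENNReal.ofReal s ^ 2 * volume K ≤ ε / 9 := by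
    have hlim : Tendsto (fun s : ℝ => ENNReal.ofReal s ^ 2 * volume K) (𝓝 0) (𝓝 0) := by
      have h1 : Tendsto (fun s : ℝ => ENNReal.ofReal s ^ 2) (𝓝 0) (𝓝 0) := by
        have := (ENNReal.continuous_pow 2).comp ENNReal.continuous_ofReal
        simpa [Function.comp_def] using this.tendsto 0
      simpa using ENNReal.Tendsto.mul_const h1 (Or.inr hK.measure_lt_top.ne)
    have h9 : (0 : ℝ≥0∞) < ε / 9 := by
      rw [pos_iff_ne_zero]; simp [hε]
    have hev := hlim.eventually_lt_const h9
    obtain ⟨r, hr, hr'⟩ := Metric.eventually_nhds_iff.1 hev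
    exact ⟨r / 2, by positivity, (hr' (by rw [Real.dist_eq, sub_zero, abs_of_pos] <;> linarith)).le⟩
  obtain ⟨δ, hδ, hδ1, hδs⟩ := hKin s hs
  refine ⟨δ, hδ, hδ1, fun ρ hρ hρ0 hρs hρ1 => ?_⟩
  have hρc : HasCompactSupport ρ :=
    (isCompact_closedBall (0 : Z d) δ).of_isClosed_subset (isClosed_tsupport ρ) hρs
  have hρi : Integrable ρ := hρ.continuous.integrable_of_hasCompactSupport hρc
  have hmg : AEStronglyMeasurable (mol ρ g) :=
    (continuous_mol hgi hgc (fun y hy => image_eq_zero_of_notMem_tsupport hy) hρ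
      ).continuous.aestronglyMeasurable
  have hfgm : AEStronglyMeasurable (fun y => f y - g y) :=
    hf.aestronglyMeasurable.sub hg.aestronglyMeasurable
  have hA : ∫⁻ z, ‖mol ρ f z - mol ρ g z‖ₑ ^ 2 ≤ ε / 9 := by
    simp_rw [← mol_sub hfi hgi hρ.continuous hρc]
    exact (lintegral_mol_sq_le hfgm hρ.continuous hρ0 hρi hρ1).trans hN
  have hB : ∫⁻ z, ‖mol ρ g z - g z‖ₑ ^ 2 ≤ ε / 9 := by
    refine le_trans ?_ hsε
    rw [← setLIntegral_const, ← lintegral_indicator hK.measurableSet]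
    refine lintegral_mono fun z => ?_
    by_cases hz : z ∈ K
    · rw [Set.indicator_of_mem hz, ← ofReal_norm]
      gcongr
      exact norm_mol_sub_le hg hρ.continuous hρ0 hρc hρ1 z fun y hy => hδs y (hρs hy) z hz
    · rw [Set.indicator_of_notMem hz]
      have : ‖mol ρ g z - g z‖ ≤ 0 := by
        refine norm_mol_sub_le hg hρ.continuous hρ0 hρc hρ1 z fun y hy => ?_
        obtain ⟨h1, h2⟩ := hKout y (Metric.closedBall_subset_closedBall hδ1 (hρs hy)) z hz
        simp [h1, h2]
      rw [norm_le_zero_iff.1 this]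
      simp
  have hC : ∫⁻ z, ‖g z - f z‖ₑ ^ 2 ≤ ε / 9 := by
    simp_rw [← enorm_neg (g _ - f _), neg_sub]
    exact hN
  have hmfg : AEStronglyMeasurable (fun z => mol ρ f z - mol ρ g z) := by
    have hint : Integrable fun y => f y - g y := hfi.sub hgi
    simp_rw [← mol_sub hfi hgi hρ.continuous hρc]
    have hK' : Continuous (Function.uncurry fun z y : Z d => ρ (rdiv z y)) :=
      hρ.continuous.comp (contDiff_rdiv (n := 0)).continuous
    unfold mol
    refine AEStronglyMeasurable.integral_prod_right' (μ := volume) (ν := volume)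
      (f := fun p : Z d × Z d => ρ (rdiv p.1 p.2) • (f p.2 - g p.2)) ?_
    exact hK'.aestronglyMeasurable.smul (hfgm.comp_snd)
  calc ∫⁻ z, ‖mol ρ f z - f z‖ₑ ^ 2
      ≤ 3 * ((∫⁻ z, ‖mol ρ f z - mol ρ g z‖ₑ ^ 2) + (∫⁻ z, ‖mol ρ g z - g z‖ₑ ^ 2)
        + ∫⁻ z, ‖g z - f z‖ₑ ^ 2) :=
        lintegral_sub_sq_le _ _ _ _ hmfg (hmg.sub hg.aestronglyMeasurable)
    _ ≤ 3 * (ε / 9 + ε / 9 + ε / 9) := by gcongr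
    _ = 9 * (ε / 9) := by ring
    _ = ε := ENNReal.mul_div_cancel (by norm_num) (by norm_num)

/-- A compactly supported `L²` function has a sequence of left translation averages that
converges almost everywhere and is dominated in `L²`. -/
theorem exists_mol_seq [FiniteDimensional ℝ V] {f : Z d → V} (hf : MemLp f 2)
    {S : Set (Z d)} (hS : IsCompact S) (hfS : ∀ y, y ∉ S → f y = 0) :
    ∃ ρ : ℕ → Z d → ℝ, (∀ n, ContDiff ℝ ∞ (ρ n) ∧ HasCompactSupport (ρ n) ∧ ∀ y, 0 ≤ ρ n y) ∧
      (∃ K : Set (Z d), IsCompact K ∧ ∀ n z, z ∉ K → mol (ρ n) f z = 0) ∧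
      ∃ D : Z d → ℝ, Integrable D ∧ ∀ᵐ z, (∀ n, ‖mol (ρ n) f z‖ ^ 2 ≤ D z) ∧
        Tendsto (fun n => mol (ρ n) f z) atTop (𝓝 (f z)) := by
  have hfi : Integrable f := by
    have h1 : IntegrableOn f S := by
      have : IsFiniteMeasure (volume.restrict S) := ⟨by simpa using hS.measure_lt_top⟩
      exact (hf.restrict S).integrable (by norm_num)
    exact (integrableOn_iff_integrable_of_support_subset fun y hy => by
      by_contra h; exact hy (hfS y h)).1 h1
  -- Summable errors: the series of squared differences is then integrable, which yields almost
  -- everywhere convergence and a majorant at once, with no passage to a subsequence.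
  choose δ hδ hδ1 hmol using fun n : ℕ => exists_delta_mol hf hfi
    (ε := (2⁻¹ : ℝ≥0∞) ^ n) (by simp)
  let b : ∀ n, ContDiffBump (0 : Z d) := fun n => ⟨δ n / 2, δ n, half_pos (hδ n),
    half_lt_self (hδ n)⟩
  let ρ : ℕ → Z d → ℝ := fun n => (b n).normed volume
  have hρs : ∀ n, ContDiff ℝ ∞ (ρ n) := fun n => (b n).contDiff_normed
  have hρ1 : ∀ n, ContDiff ℝ 1 (ρ n) := fun n => (b n).contDiff_normed
  have hρ0 : ∀ n y, 0 ≤ ρ n y := fun n y => (b n).nonneg_normed y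
  have hρt : ∀ n, tsupport (ρ n) = Metric.closedBall 0 (δ n) := fun n =>
    (b n).tsupport_normed_eq
  have hρc : ∀ n, HasCompactSupport (ρ n) := fun n => (b n).hasCompactSupport_normed
  have hm : ∀ n, Continuous (mol (ρ n) f) := fun n =>
    (continuous_mol hfi hS hfS (hρ1 n)).continuous
  have hN : ∀ n, ∫⁻ z, ‖mol (ρ n) f z - f z‖ₑ ^ 2 ≤ (2⁻¹ : ℝ≥0∞) ^ n := fun n =>
    hmol n (ρ n) (hρ1 n) (hρ0 n) (hρt n).subset (b n).integral_normed
  have hmeas : ∀ n, AEMeasurable (fun z => ‖mol (ρ n) f z - f z‖ₑ ^ 2) := fun n =>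
    (((hm n).aestronglyMeasurable.sub hf.aestronglyMeasurable).enorm).pow_const 2
  set D₀ : Z d → ℝ≥0∞ := fun z => ∑' n, ‖mol (ρ n) f z - f z‖ₑ ^ 2
  have hD₀m : AEMeasurable D₀ := AEMeasurable.tsum hmeas
  have hD₀ : ∫⁻ z, D₀ z ≠ ⊤ := by
    rw [lintegral_tsum hmeas]
    refine ((ENNReal.tsum_le_tsum hN).trans_lt ?_).ne
    rw [ENNReal.tsum_geometric]
    simp
  refine ⟨ρ, fun n => ⟨hρs n, hρc n, hρ0 n⟩, ?_, fun z => 2 * ‖f z‖ ^ 2 + 2 * (D₀ z).toReal, ?_, ?_⟩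
  · have hmap : Continuous fun p : Z d × Z d => lt (rdiv p.1 0) p.2 :=
      (contDiff_lt (n := 0)).continuous.comp (((contDiff_rdiv (n := 0)).continuous.comp
        (continuous_fst.prodMk continuous_const)).prodMk continuous_snd)
    have hinv : ∀ y z : Z d, lt (rdiv y 0) (lt y z) = z := by
      intro y z
      ext <;> simp [rdiv, lt]; ring
    refine ⟨(fun p : Z d × Z d => lt (rdiv p.1 0) p.2) '' (Metric.closedBall (0 : Z d) 1 ×ˢ S),
      ((isCompact_closedBall _ _).prod hS).image hmap, fun n z hz => ?_⟩
    rw [mol_eq]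
    refine integral_eq_zero_of_ae (Eventually.of_forall fun y => ?_)
    by_cases hy : y ∈ tsupport (ρ n)
    · have : lt y z ∉ S := fun h => hz ⟨(y, lt y z), ⟨?_, h⟩, hinv y z⟩
      · simp [hfS _ this]
      · rw [hρt] at hy
        exact Metric.closedBall_subset_closedBall (hδ1 n) hy
    · simp [image_eq_zero_of_notMem_tsupport hy]
  · refine (hf.norm.integrable_sq.const_mul 2).add ?_
    exact (integrable_toReal_of_lintegral_ne_top hD₀m hD₀).const_mul 2
  · filter_upwards [ae_lt_top' hD₀m hD₀] with z hz
    have hterm : ∀ n, ‖mol (ρ n) f z - f z‖ ^ 2 ≤ (D₀ z).toReal := by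
      intro n
      have h1 : ‖mol (ρ n) f z - f z‖ₑ ^ 2 ≤ D₀ z := ENNReal.le_tsum n
      have h2 := ENNReal.toReal_mono hz.ne h1
      simpa using h2
    refine ⟨fun n => ?_, ?_⟩
    · have h1 := norm_add_le (mol (ρ n) f z - f z) (f z)
      rw [sub_add_cancel] at h1
      nlinarith [hterm n, norm_nonneg (mol (ρ n) f z), norm_nonneg (f z),
        sq_nonneg (‖mol (ρ n) f z - f z‖ - ‖f z‖), norm_nonneg (mol (ρ n) f z - f z)]
    · have h1 := ENNReal.tendsto_atTop_zero_of_tsum_ne_top hz.ne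
      rw [tendsto_iff_norm_sub_tendsto_zero]
      have h2 := (ENNReal.tendsto_toReal ENNReal.zero_ne_top).comp h1
      have h3 : Tendsto (fun n => ‖mol (ρ n) f z - f z‖ ^ 2) atTop (𝓝 0) := by
        simpa [Function.comp_def] using h2
      have h4 := (Real.continuous_sqrt.tendsto 0).comp h3
      simpa [Function.comp_def, Real.sqrt_sq] using h4

end Mollification

/-! ### Curves along the kinetic vector fields. -/

section Poincare

variable {d : ℕ}

/-- The velocity divergence of a vector field. -/
noncomputable def divV (H : Z d → E d) (z : Z d) : ℝ :=
  ∑ i, fderiv ℝ H z (0, 0, EuclideanSpace.single i 1) i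

theorem continuous_divV {H : Z d → E d} (hH : ContDiff ℝ 1 H) : Continuous (divV H) := by
  have hHf : Continuous (fderiv ℝ H) := hH.continuous_fderiv one_ne_zero
  unfold divV
  refine continuous_finsetSum _ fun i _ => ?_
  exact (EuclideanSpace.proj (𝕜 := ℝ) i).continuous.comp (hHf.clm_apply continuous_const)

/-- A curve issued from `z` that is controlled by the kinetic vector fields. -/
noncomputable def path (r σ : ℝ) (z : Z d) (p : E d × E d) : Z d :=
  (z.1 - r ^ 2 * σ ^ 3,
    z.2.1 - (r ^ 2 * σ ^ 3) • z.2.2 - (3 / 4 * r ^ 3 * σ ^ 4) • p.1 - (3 / 5 * r ^ 3 * σ ^ 5) • p.2,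
    z.2.2 + (r * σ) • p.1 + (r * σ ^ 2) • p.2)

theorem contDiff_path {n : WithTop ℕ∞} (r : ℝ) :
    ContDiff ℝ n (fun q : ℝ × Z d × E d × E d => path r q.1 q.2.1 q.2.2) := by
  unfold path
  fun_prop

theorem continuous_path (r : ℝ) :
    Continuous (fun q : ℝ × Z d × E d × E d => path r q.1 q.2.1 q.2.2) :=
  (contDiff_path (n := 0) r).continuous

theorem path_zero (r : ℝ) (z : Z d) (p : E d × E d) : path r 0 z p = z := by
  ext <;> simp [path]

theorem hasDerivAt_path (r σ : ℝ) (z : Z d) (p : E d × E d) :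
    HasDerivAt (fun σ => path r σ z p)
      (-(3 * r ^ 2 * σ ^ 2),
        -(3 * r ^ 2 * σ ^ 2) • z.2.2 - (3 * r ^ 3 * σ ^ 3) • p.1 - (3 * r ^ 3 * σ ^ 4) • p.2,
        r • p.1 + (2 * r * σ) • p.2) σ := by
  unfold path
  have h3 : ∀ c : ℝ, ∀ n : ℕ, HasDerivAt (fun σ : ℝ => c * σ ^ n) (c * (n * σ ^ (n - 1))) σ :=
    fun c n => (hasDerivAt_pow n σ).const_mul c
  have h1 : HasDerivAt (fun σ : ℝ => r * σ) r σ := by simpa using (hasDerivAt_id σ).const_mul r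
  refine HasDerivAt.prodMk ?_ (HasDerivAt.prodMk ?_ ?_)
  · refine ((h3 (r ^ 2) 3).const_sub z.1).congr_deriv ?_
    push_cast; ring
  · refine (((((h3 (r ^ 2) 3).smul_const z.2.2).const_sub z.2.1).sub
      ((h3 (3 / 4 * r ^ 3) 4).smul_const p.1)).sub
      ((h3 (3 / 5 * r ^ 3) 5).smul_const p.2)).congr_deriv ?_
    rw [← neg_smul]
    congr 2 <;> push_cast <;> ring_nf
  · refine (((h1.smul_const p.1).const_add z.2.2).add ((h3 r 2).smul_const p.2)).congr_deriv ?_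
    congr 2 <;> push_cast <;> ring

/-- The position component moves at the current velocity times the time speed, so the tangent is a
combination of (1, v, 0) and (0, 0, e). No bare derivative in x appears, and none could be
controlled. -/
theorem hasDerivAt_comp_path {w : Z d → ℝ} (hw : ContDiff ℝ 1 w) (r σ : ℝ) (z : Z d)
    (p : E d × E d) :
    HasDerivAt (fun σ => w (path r σ z p))
      (-(3 * r ^ 2 * σ ^ 2) * transport w (path r σ z p) +
        velDeriv w (path r σ z p) (r • p.1 + (2 * r * σ) • p.2)) σ := by
  have h := (hw.differentiable one_ne_zero (path r σ z p)).hasFDerivAt.comp_hasDerivAt σ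
    (hasDerivAt_path r σ z p)
  refine h.congr_deriv ?_
  have hv : ((-(3 * r ^ 2 * σ ^ 2),
        -(3 * r ^ 2 * σ ^ 2) • z.2.2 - (3 * r ^ 3 * σ ^ 3) • p.1 - (3 * r ^ 3 * σ ^ 4) • p.2,
        r • p.1 + (2 * r * σ) • p.2) : Z d) =
      (-(3 * r ^ 2 * σ ^ 2)) • ((1, (path r σ z p).2.2, 0) : Z d) +
        (0, 0, r • p.1 + (2 * r * σ) • p.2) := by
    ext i
    · simp
    · simp [path]; ring
    · simp
  rw [hv, map_add, map_smul, smul_eq_mul, transport, velDeriv]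

/-- Fundamental theorem of calculus along `path`, with a weight that vanishes at the end. -/
theorem le_integral_path {w F : Z d → ℝ} {H : Z d → E d} (hw : ContDiff ℝ 1 w)
    (hH : ContDiff ℝ 1 H) (hF : Continuous F)
    (heq : ∀ z, transport w z ≤ divV H z + F z) (r : ℝ) (m : ℕ) (z : Z d) (p : E d × E d) :
    w z ≤ ∫ σ in (0 : ℝ)..1, ((m + 1 : ℕ) * σ ^ m * w (path r σ z p) + (1 - σ ^ (m + 1)) *
      (3 * r ^ 2 * σ ^ 2 * (divV H (path r σ z p) + F (path r σ z p))
        - velDeriv w (path r σ z p) (r • p.1 + (2 * r * σ) • p.2))) := by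
  have hp : Continuous fun σ : ℝ => path r σ z p :=
    (continuous_path r).comp (by fun_prop : Continuous fun σ : ℝ => (σ, z, p))
  have hwf : Continuous (fderiv ℝ w) := hw.continuous_fderiv one_ne_zero
  have hHf : Continuous (fderiv ℝ H) := hH.continuous_fderiv one_ne_zero
  have hdiv : Continuous (divV H) := continuous_divV hH
  have hT : Continuous fun σ => transport w (path r σ z p) := by
    unfold transport
    exact (hwf.comp hp).clm_apply (by fun_prop)
  have hV : Continuous fun σ => velDeriv w (path r σ z p) (r • p.1 + (2 * r * σ) • p.2) := by
    unfold velDeriv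
    exact (hwf.comp hp).clm_apply (by fun_prop)
  have hwp : Continuous fun σ => w (path r σ z p) := hw.continuous.comp hp
  have hdp : Continuous fun σ => divV H (path r σ z p) := hdiv.comp hp
  have hFp : Continuous fun σ => F (path r σ z p) := hF.comp hp
  -- The weight is one at σ = 0, where the curve starts at z, and zero at σ = 1. The value at the
  -- end point is thereby replaced by a mean with weight (m+1)σ^m.
  have hd : ∀ σ, HasDerivAt (fun σ => (1 - σ ^ (m + 1)) * w (path r σ z p))
      (-((m + 1 : ℕ) * σ ^ m) * w (path r σ z p) + (1 - σ ^ (m + 1)) *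
        (-(3 * r ^ 2 * σ ^ 2) * transport w (path r σ z p) +
          velDeriv w (path r σ z p) (r • p.1 + (2 * r * σ) • p.2))) σ := by
    intro σ
    exact ((hasDerivAt_pow (m + 1) σ).const_sub 1).mul (hasDerivAt_comp_path hw r σ z p)
  have hftc := intervalIntegral.integral_eq_sub_of_hasDerivAt (a := 0) (b := 1)
    (fun σ _ => hd σ) (Continuous.intervalIntegrable (by fun_prop) _ _)
  rw [path_zero] at hftc
  have h0 : w z = ∫ σ in (0 : ℝ)..1, -(-((m + 1 : ℕ) * σ ^ m) * w (path r σ z p) +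
      (1 - σ ^ (m + 1)) * (-(3 * r ^ 2 * σ ^ 2) * transport w (path r σ z p) +
          velDeriv w (path r σ z p) (r • p.1 + (2 * r * σ) • p.2))) := by
    rw [intervalIntegral.integral_neg, hftc]
    simp
  rw [h0]
  refine intervalIntegral.integral_mono_on zero_le_one
    (Continuous.intervalIntegrable (by fun_prop) _ _)
    (Continuous.intervalIntegrable (by fun_prop) _ _) fun σ hσ => ?_
  have h1 : 0 ≤ 1 - σ ^ (m + 1) := sub_nonneg.2 (pow_le_one₀ hσ.1 hσ.2)
  -- The curve runs backward in time, so the transport derivative enters with this nonnegative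
  -- coefficient and the one-sided bound `heq` suffices.
  have h2 : 0 ≤ (1 - σ ^ (m + 1)) * (3 * r ^ 2 * σ ^ 2) := by positivity
  have h3 := mul_le_mul_of_nonneg_left (heq (path r σ z p)) h2
  linarith

/-- Two controls allow the end point to move in velocity alone. The position changes cancel because
(3/4)·12 = (3/5)·15, while the velocity coefficients add up to 15 − 12 = 3. The factor 3r²σ² is the
time speed of the curve that multiplies the flux divergence, and it is what keeps the parameter
direction bounded as σ → 0. -/
theorem hasFDerivAt_path_param (r σ : ℝ) (z : Z d) (p : E d × E d) :
    ∃ L : E d × E d →L[ℝ] Z d, HasFDerivAt (path r σ z) L p ∧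
      ∀ e : E d, L (-(12 * r * σ) • e, (15 * r) • e) = (3 * r ^ 2 * σ ^ 2) • (0, 0, e) := by
  let L : E d × E d →L[ℝ] Z d := (0 : E d × E d →L[ℝ] ℝ).prod
    ((-(3 / 4 * r ^ 3 * σ ^ 4) • ContinuousLinearMap.fst ℝ (E d) (E d)
      - (3 / 5 * r ^ 3 * σ ^ 5) • ContinuousLinearMap.snd ℝ (E d) (E d)).prod
    ((r * σ) • ContinuousLinearMap.fst ℝ (E d) (E d)
      + (r * σ ^ 2) • ContinuousLinearMap.snd ℝ (E d) (E d)))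
  have hpath : path r σ z = fun p => path r σ z 0 + L p := by
    funext p
    ext i
    · simp [path, L]
    · simp [path, L]; ring
    · simp [path, L]; ring
  refine ⟨L, ?_, fun e => ?_⟩
  · rw [hpath]
    exact L.hasFDerivAt.const_add _
  · ext i
    · simp [L]
    · simp [L]; ring
    · simp [L]; ring

/-- Integration by parts in the parameters of `path`. -/
theorem integral_divV_path {H : Z d → E d} (hH : ContDiff ℝ 1 H) {ρ : E d × E d → ℝ}
    (hρ : ContDiff ℝ 1 ρ) (hρc : HasCompactSupport ρ) (r σ : ℝ) (z : Z d) :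
    ∫ p, ρ p * (3 * r ^ 2 * σ ^ 2 * divV H (path r σ z p)) =
      - ∫ p, fderiv ℝ ρ p (-(12 * r * σ) • H (path r σ z p), (15 * r) • H (path r σ z p)) := by
  have hp : ContDiff ℝ 1 (path (d := d) r σ z) :=
    (contDiff_path r).comp (by fun_prop : ContDiff ℝ 1 fun p : E d × E d => (σ, z, p))
  -- The parameter direction that moves the end point along the i-th velocity axis, as provided by
  -- `hasFDerivAt_path_param`.
  let dir : Fin d → E d × E d := fun i => (-(12 * r * σ) • EuclideanSpace.single i (1 : ℝ),
    (15 * r) • EuclideanSpace.single i (1 : ℝ))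
  let h : Fin d → E d × E d → ℝ := fun i p => H (path r σ z p) i
  have hh : ∀ i, ContDiff ℝ 1 (h i) := fun i => by
    have : ContDiff ℝ 1 fun p => H (path r σ z p) := hH.comp hp
    exact (contDiff_euclidean.1 this) i
  have hhf : ∀ i p, fderiv ℝ (h i) p (dir i) =
      3 * r ^ 2 * σ ^ 2 * fderiv ℝ H (path r σ z p) (0, 0, EuclideanSpace.single i 1) i := by
    intro i p
    obtain ⟨L, hL, hLe⟩ := hasFDerivAt_path_param r σ z p
    have h1 : HasFDerivAt (h i)
        ((EuclideanSpace.proj i).comp ((fderiv ℝ H (path r σ z p)).comp L)) p :=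
      (EuclideanSpace.proj (𝕜 := ℝ) i).hasFDerivAt.comp p
        ((hH.differentiable one_ne_zero _).hasFDerivAt.comp p hL)
    rw [h1.fderiv]
    have h2 := hLe (EuclideanSpace.single i 1)
    simp only [ContinuousLinearMap.comp_apply, dir, h2, map_smul]
    simp
  have hρf : Continuous (fderiv ℝ ρ) := hρ.continuous_fderiv one_ne_zero
  have hcs : ∀ i, HasCompactSupport fun p => fderiv ℝ ρ p (dir i) := fun i =>
    hρc.fderiv_apply (𝕜 := ℝ) (dir i)
  have hhc : ∀ i, Continuous (h i) := fun i => (hh i).continuous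
  have hhfc : ∀ i, Continuous fun p => fderiv ℝ (h i) p (dir i) := fun i =>
    ((hh i).continuous_fderiv one_ne_zero).clm_apply continuous_const
  have hi1 : ∀ i, Integrable fun p => fderiv ℝ ρ p (dir i) * h i p := fun i =>
    Continuous.integrable_of_hasCompactSupport
      ((hρf.clm_apply continuous_const).mul (hhc i)) (hcs i).mul_right
  have hi2 : ∀ i, Integrable fun p => ρ p * fderiv ℝ (h i) p (dir i) := fun i =>
    Continuous.integrable_of_hasCompactSupport (hρ.continuous.mul (hhfc i)) hρc.mul_right
  have hi3 : ∀ i, Integrable fun p => ρ p * h i p := fun i =>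
    Continuous.integrable_of_hasCompactSupport (hρ.continuous.mul (hhc i)) hρc.mul_right
  have hibp : ∀ i, ∫ p, ρ p * fderiv ℝ (h i) p (dir i) = - ∫ p, fderiv ℝ ρ p (dir i) * h i p :=
    fun i => integral_mul_fderiv_eq_neg_fderiv_mul_of_integrable (hi1 i) (hi2 i) (hi3 i)
      (fun p _ => hρ.differentiable one_ne_zero p) (fun p _ => (hh i).differentiable one_ne_zero p)
  have hL : ∀ p, ρ p * (3 * r ^ 2 * σ ^ 2 * divV H (path r σ z p)) =
      ∑ i, ρ p * fderiv ℝ (h i) p (dir i) := by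
    intro p
    simp only [hhf, divV, Finset.mul_sum]
  have hR : ∀ p, fderiv ℝ ρ p (-(12 * r * σ) • H (path r σ z p), (15 * r) • H (path r σ z p)) =
      ∑ i, fderiv ℝ ρ p (dir i) * h i p := by
    intro p
    have hbasis : H (path r σ z p) = ∑ i, h i p • EuclideanSpace.single i (1 : ℝ) := by
      ext j
      simp [h, Finset.sum_apply, Pi.single_apply]
    have : ((-(12 * r * σ) • H (path r σ z p), (15 * r) • H (path r σ z p)) : E d × E d) =
        ∑ i, h i p • dir i := by
      rw [hbasis]
      refine Prod.ext ?_ ?_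
      · simp only [Prod.fst_sum, Finset.smul_sum, dir, Prod.smul_mk]
        exact Finset.sum_congr rfl fun i _ => smul_comm _ _ _
      · simp only [Prod.snd_sum, Finset.smul_sum, dir, Prod.smul_mk]
        exact Finset.sum_congr rfl fun i _ => smul_comm _ _ _
    rw [this, map_sum]
    simp [mul_comm]
  simp_rw [hL, hR]
  rw [integral_finsetSum _ fun i _ => hi2 i, integral_finsetSum _ fun i _ => hi1 i,
    ← Finset.sum_neg_distrib]
  exact Finset.sum_congr rfl fun i _ => hibp i

end Poincare

/-! ### The kernel of the average along curves. -/

section ChangeOfVariables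

variable {d : ℕ}

theorem lintegral_comp_affine {φ : E d → ℝ≥0∞} (hφ : Measurable φ) (x : E d) {a : ℝ}
    (ha : a ≠ 0) :
    ∫⁻ q, φ (x + a • q) = ENNReal.ofReal ((|a| ^ d)⁻¹) * ∫⁻ y, φ y := by
  have h1 : ∫⁻ q, φ (x + a • q) = ∫⁻ q, (fun q => φ (x + q)) q ∂(Measure.map (a • ·) volume) := by
    rw [lintegral_map (by fun_prop) (by fun_prop)]
  rw [h1, Measure.map_addHaar_smul _ ha, lintegral_smul_measure, lintegral_add_left_eq_self]
  simp [abs_inv, abs_pow]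

/-- Replacing `p.1` by `p.1 - s • p.2` removes `p.2` from the velocity slot and leaves the
coefficient `D` in the position slot. The remaining map is triangular, with determinant of size
(|a||D|)^d. -/
theorem lintegral_comp_affine_prod {ψ : E d × E d → ℝ≥0∞} (hψ : Measurable ψ) (x v : E d)
    {a D : ℝ} (A s : ℝ) (ha : a ≠ 0) (hD : D ≠ 0) :
    ∫⁻ p : E d × E d, ψ (x - A • p.1 - (D + A * s) • p.2, v + a • p.1 + (a * s) • p.2) =
      ENNReal.ofReal (((|a| * |D|) ^ d)⁻¹) * ∫⁻ y, ψ y := by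
  rw [Measure.volume_eq_prod, lintegral_prod_symm' _ (by fun_prop)]
  have h1 : ∀ q : E d, ∫⁻ p : E d, ψ (x - A • p - (D + A * s) • q, v + a • p + (a * s) • q) =
      ∫⁻ p : E d, ψ (x - A • p + (-D) • q, v + a • p) := by
    intro q
    rw [← lintegral_add_right_eq_self _ (-(s • q))]
    refine lintegral_congr fun p => ?_
    congr 2
    · module
    · module
  simp only [h1]
  rw [lintegral_lintegral_swap (by unfold Function.uncurry; fun_prop)]
  have h2 : ∀ p : E d, ∫⁻ q : E d, ψ (x - A • p + (-D) • q, v + a • p) =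
      ENNReal.ofReal ((|D| ^ d)⁻¹) * ∫⁻ y, ψ (y, v + a • p) := by
    intro p
    rw [lintegral_comp_affine (φ := fun y => ψ (y, v + a • p)) (by fun_prop) _ (neg_ne_zero.2 hD),
      abs_neg]
  have h3 : Measurable fun w : E d => ∫⁻ y, ψ (y, w) := hψ.lintegral_prod_left'
  simp only [h2]
  rw [lintegral_const_mul _ (by fun_prop),
    lintegral_comp_affine (φ := fun w => ∫⁻ y, ψ (y, w)) h3 v ha, ← mul_assoc,
    lintegral_prod_symm' _ hψ, ← ENNReal.ofReal_mul (by positivity)]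
  congr 2
  rw [← mul_inv, mul_comm, mul_pow]

/-- With σ and p frozen, the end point depends on z through a shear followed by a translation. -/
theorem measurePreserving_path (r σ : ℝ) (p : E d × E d) :
    MeasurePreserving (fun z : Z d => path r σ z p) := by
  have := measurePreserving_shear (d := d) (-(r ^ 2 * σ ^ 3))
    (β := fun _ v => -((r ^ 2 * σ ^ 3) • v) - (3 / 4 * r ^ 3 * σ ^ 4) • p.1
      - (3 / 5 * r ^ 3 * σ ^ 5) • p.2)
    (by unfold Function.uncurry; fun_prop) ((r * σ) • p.1 + (r * σ ^ 2) • p.2)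
  convert this using 2 with z
  refine Prod.ext ?_ (Prod.ext ?_ ?_)
  · simp [path]; ring
  · simp only [path]; abel
  · simp only [path]; abel

/-- The substitution s = t − r²σ³ is injective on (0, 1] and the weight is its Jacobian; its image
is only part of the line, hence an inequality. -/
theorem lintegral_comp_cube_le {N : ℝ → ℝ≥0∞} (t : ℝ) {r : ℝ} (hr : 0 < r) :
    ∫⁻ σ in Set.Ioc (0 : ℝ) 1, ENNReal.ofReal (3 * r ^ 2 * σ ^ 2) * N (t - r ^ 2 * σ ^ 3) ≤
      ∫⁻ s, N s := by
  have hd : ∀ σ ∈ Set.Ioc (0 : ℝ) 1, HasDerivWithinAt (fun σ : ℝ => t - r ^ 2 * σ ^ 3)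
      (-(3 * r ^ 2 * σ ^ 2)) (Set.Ioc 0 1) σ := by
    intro σ _
    refine ((((hasDerivAt_pow 3 σ).const_mul (r ^ 2)).const_sub t).congr_deriv ?_
      ).hasDerivWithinAt
    push_cast; ring
  have hinj : Set.InjOn (fun σ : ℝ => t - r ^ 2 * σ ^ 3) (Set.Ioc 0 1) := by
    intro σ hσ σ' hσ' h
    have h2 : r ^ 2 ≠ 0 := by positivity
    have : σ ^ 3 = σ' ^ 3 := by
      have := sub_right_injective h
      exact mul_left_cancel₀ h2 this
    exact (pow_left_inj₀ hσ.1.le hσ'.1.le three_ne_zero).1 this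
  have := lintegral_image_eq_lintegral_abs_deriv_mul measurableSet_Ioc hd hinj N
  calc _ = ∫⁻ σ in Set.Ioc (0 : ℝ) 1, ENNReal.ofReal |-(3 * r ^ 2 * σ ^ 2)| *
        N (t - r ^ 2 * σ ^ 3) := by
        refine lintegral_congr fun σ => ?_
        rw [abs_neg, abs_of_nonneg (by positivity)]
    _ = _ := this.symm
    _ ≤ _ := setLIntegral_le_lintegral _ _

/-- The average of `ψ` along the curves `path`, weighted so that its kernel is bounded. -/
noncomputable def pathMean (d : ℕ) (r : ℝ) (ρ : E d × E d → ℝ) (ψ : Z d → ℝ≥0∞) (z : Z d) : ℝ≥0∞ :=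
  ∫⁻ σ in Set.Ioc (0 : ℝ) 1, ∫⁻ p, ENNReal.ofReal ((6 * d + 2 + 1 : ℕ) * σ ^ (6 * d + 2) * ρ p) *
    ψ (path r σ z p)

/-- The map from p to the end point has Jacobian ((3/20) r⁴σ⁶)^d in (x, v), and the time change has
Jacobian 3r²σ². The exponent 6d + 2 of the weight cancels both powers of σ, so the kernel of the
mean is bounded, by a multiple of r^{-(4d+2)}. -/
theorem pathMean_le {r : ℝ} (hr : 0 < r) {ρ : E d × E d → ℝ} {B : ℝ} (hB : 0 ≤ B)
    (hρB : ∀ p, ρ p ≤ B) {ψ : Z d → ℝ≥0∞} (hψ : Measurable ψ) (z : Z d) :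
    pathMean d r ρ ψ z ≤
      ENNReal.ofReal ((6 * d + 2 + 1 : ℕ) * B * (20 / 3) ^ d / (3 * r ^ (4 * d + 2))) *
        ∫⁻ z, ψ z := by
  set N : ℝ → ℝ≥0∞ := fun s => ∫⁻ y : E d × E d, ψ (s, y)
  set M : ℝ := ((6 * d + 2 + 1 : ℕ) : ℝ)
  have hM : 0 ≤ M := by positivity
  have h1 : ∀ σ ∈ Set.Ioc (0 : ℝ) 1,
      ∫⁻ p, ENNReal.ofReal (M * σ ^ (6 * d + 2) * ρ p) * ψ (path r σ z p) ≤
      ENNReal.ofReal (M * B * (20 / 3) ^ d / (3 * r ^ (4 * d + 2))) *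
        (ENNReal.ofReal (3 * r ^ 2 * σ ^ 2) * N (z.1 - r ^ 2 * σ ^ 3)) := by
    intro σ hσ
    have hσ0 : 0 < σ := hσ.1
    have hψs : Measurable fun y : E d × E d => ψ (z.1 - r ^ 2 * σ ^ 3, y) := by fun_prop
    -- Here the shear parameter is σ and 3/5 = 3/4 − 3/20, so −3/20 is the position coefficient left
    -- once `p.2` is eliminated from the velocity.
    have hcv := lintegral_comp_affine_prod hψs (z.2.1 - (r ^ 2 * σ ^ 3) • z.2.2) z.2.2
      (a := r * σ) (D := -(3 / 20) * r ^ 3 * σ ^ 5) (3 / 4 * r ^ 3 * σ ^ 4) σ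
      (by positivity) (by simp; constructor <;> positivity)
    have hpe : ∀ p : E d × E d, path r σ z p = (z.1 - r ^ 2 * σ ^ 3,
        z.2.1 - (r ^ 2 * σ ^ 3) • z.2.2 - (3 / 4 * r ^ 3 * σ ^ 4) • p.1
          - (-(3 / 20) * r ^ 3 * σ ^ 5 + 3 / 4 * r ^ 3 * σ ^ 4 * σ) • p.2,
        z.2.2 + (r * σ) • p.1 + (r * σ * σ) • p.2) := by
      intro p
      unfold path
      congr 3 <;> congr 1 <;> ring
    calc ∫⁻ p, ENNReal.ofReal (M * σ ^ (6 * d + 2) * ρ p) * ψ (path r σ z p)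
        ≤ ∫⁻ p, ENNReal.ofReal (M * σ ^ (6 * d + 2) * B) * ψ (path r σ z p) := by
          gcongr with p; exact hρB p
      _ = ENNReal.ofReal (M * σ ^ (6 * d + 2) * B) * ∫⁻ p, ψ (path r σ z p) := by
          refine lintegral_const_mul _ (hψ.comp ?_)
          exact ((continuous_path r).comp
            (by fun_prop : Continuous fun p : E d × E d => (σ, z, p))).measurable
      _ = ENNReal.ofReal (M * σ ^ (6 * d + 2) * B) * (ENNReal.ofReal
          (((|r * σ| * |-(3 / 20) * r ^ 3 * σ ^ 5|) ^ d)⁻¹) * N (z.1 - r ^ 2 * σ ^ 3)) := by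
          simp only [hpe]
          rw [hcv]
      _ = _ := by
          rw [← mul_assoc, ← mul_assoc, ← ENNReal.ofReal_mul (by positivity),
            ← ENNReal.ofReal_mul (by positivity)]
          congr 2
          rw [abs_of_pos (by positivity : 0 < r * σ), neg_mul, neg_mul, abs_neg,
            abs_of_pos (by positivity : 0 < 3 / 20 * r ^ 3 * σ ^ 5)]
          have e1 : r * σ * (3 / 20 * r ^ 3 * σ ^ 5) = (20 / 3)⁻¹ * (r ^ 4 * σ ^ 6) := by
            norm_num; ring
          have e2 : (r * σ * (3 / 20 * r ^ 3 * σ ^ 5)) ^ d =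
              ((20 / 3) ^ d)⁻¹ * (r ^ (4 * d) * σ ^ (6 * d)) := by
            rw [e1, mul_pow, mul_pow, inv_pow, pow_mul, pow_mul]
          rw [e2, pow_add σ, pow_add r]
          field_simp
  unfold pathMean
  calc _ ≤ ∫⁻ σ in Set.Ioc (0 : ℝ) 1,
      ENNReal.ofReal (M * B * (20 / 3) ^ d / (3 * r ^ (4 * d + 2))) *
        (ENNReal.ofReal (3 * r ^ 2 * σ ^ 2) * N (z.1 - r ^ 2 * σ ^ 3)) :=
        setLIntegral_mono' measurableSet_Ioc h1
    _ = ENNReal.ofReal (M * B * (20 / 3) ^ d / (3 * r ^ (4 * d + 2))) *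
        ∫⁻ σ in Set.Ioc (0 : ℝ) 1, (ENNReal.ofReal (3 * r ^ 2 * σ ^ 2) *
          N (z.1 - r ^ 2 * σ ^ 3)) := by
        have hN : Measurable N := hψ.lintegral_prod_right'
        exact lintegral_const_mul _ (by fun_prop)
    _ ≤ _ := by
        gcongr
        refine (lintegral_comp_cube_le z.1 hr).trans ?_
        rw [Measure.volume_eq_prod, lintegral_prod _ hψ.aemeasurable]

/-- Each map z ↦ `path r σ z p` preserves volume, so only the total weight counts. Estimating
σ^(6d+2) by one is wasteful but sufficient. -/
theorem lintegral_pathMean_le (r : ℝ) {ρ : E d × E d → ℝ} (hρ : Continuous ρ)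
    (hρ0 : ∀ p, 0 ≤ ρ p) (hρi : Integrable ρ) (hρ1 : ∫ p, ρ p = 1)
    {ψ : Z d → ℝ≥0∞} (hψ : Measurable ψ) :
    ∫⁻ z, pathMean d r ρ ψ z ≤ (6 * d + 2 + 1 : ℕ) * ∫⁻ z, ψ z := by
  have hm : Measurable fun q : Z d × ℝ × E d × E d => ψ (path r q.2.1 q.1 q.2.2) :=
    hψ.comp ((continuous_path r).comp (by fun_prop :
      Continuous fun q : Z d × ℝ × E d × E d => (q.2.1, q.1, q.2.2))).measurable
  have hm2 : Measurable fun q : (Z d × ℝ) × E d × E d => ψ (path r q.1.2 q.1.1 q.2) :=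
    hm.comp (by fun_prop : Measurable fun q : (Z d × ℝ) × E d × E d => (q.1.1, q.1.2, q.2))
  have hρm : Measurable ρ := hρ.measurable
  unfold pathMean
  rw [lintegral_lintegral_swap]
  · calc _ ≤ ∫⁻ σ in Set.Ioc (0 : ℝ) 1, ((6 * d + 2 + 1 : ℕ) : ℝ≥0∞) * ∫⁻ z, ψ z := by
          refine setLIntegral_mono' measurableSet_Ioc fun σ hσ => ?_
          rw [lintegral_lintegral_swap]
          · calc _ = ∫⁻ p, ENNReal.ofReal ((6 * d + 2 + 1 : ℕ) * σ ^ (6 * d + 2) * ρ p) *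
                ∫⁻ z, ψ z := by
                  refine lintegral_congr fun p => ?_
                  rw [lintegral_const_mul']
                  · rw [(measurePreserving_path r σ p).lintegral_comp hψ]
                  · exact ENNReal.ofReal_ne_top
              _ ≤ ∫⁻ p, ((6 * d + 2 + 1 : ℕ) : ℝ≥0∞) * ENNReal.ofReal (ρ p) *
                ∫⁻ z, ψ z := by
                  gcongr with p
                  rw [← ENNReal.ofReal_natCast, ← ENNReal.ofReal_mul (by positivity)]
                  apply ENNReal.ofReal_le_ofReal
                  have := hρ0 p
                  have h1 : σ ^ (6 * d + 2) ≤ 1 := pow_le_one₀ hσ.1.le hσ.2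
                  gcongr
                  exact mul_le_of_le_one_right (by positivity) h1
              _ = _ := by
                  rw [lintegral_mul_const _ (by fun_prop), lintegral_const_mul _ (by fun_prop),
                    ← ofReal_integral_eq_lintegral_ofReal hρi (Eventually.of_forall hρ0), hρ1]
                  simp
          · refine Measurable.aemeasurable (Measurable.mul (by fun_prop) ?_)
            exact hm2.comp (by fun_prop : Measurable fun q : Z d × E d × E d => ((q.1, σ), q.2))
      _ = _ := by simp
  · refine Measurable.aemeasurable ?_
    refine Measurable.lintegral_prod_right' (f := fun q : (Z d × ℝ) × E d × E d =>
      ENNReal.ofReal ((6 * d + 2 + 1 : ℕ) * q.1.2 ^ (6 * d + 2) * ρ q.2) *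
      ψ (path r q.1.2 q.1.1 q.2)) ?_
    exact Measurable.mul (by fun_prop) hm2

end ChangeOfVariables

/-! ### The kinetic Poincaré inequality for smooth functions. -/

section SmoothPoincare

variable {d : ℕ}

/-- No integrability is assumed: otherwise the left side is zero by convention. -/
theorem ofReal_integral_le_lintegral {A : Type*} [MeasurableSpace A] {μ : Measure A} (f : A → ℝ) :
    ENNReal.ofReal (∫ a, f a ∂μ) ≤ ∫⁻ a, ENNReal.ofReal (f a) ∂μ := by
  by_cases hf : Integrable f μ
  · have h1 : ∫ a, f a ∂μ ≤ ∫ a, max (f a) 0 ∂μ :=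
      integral_mono hf hf.pos_part fun a => le_max_left _ _
    refine (ENNReal.ofReal_le_ofReal h1).trans ?_
    rw [ofReal_integral_eq_lintegral_ofReal hf.pos_part
      (Eventually.of_forall fun a => le_max_right _ _)]
    refine lintegral_mono fun a => ?_
    simp [ENNReal.ofReal_max]
  · rw [integral_undef hf]
    simp

/-- For each value of the curve parameter, the averaged integrand is bounded by the mean of
`w` plus a multiple of the size of the right-hand side. -/
theorem integral_path_integrand_le {w F : Z d → ℝ} {G H : Z d → E d} (hw : ContDiff ℝ 1 w)
    (hG : Continuous G) (hH : ContDiff ℝ 1 H) (hF : Continuous F)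
    (hgrad : ∀ z e, velDeriv w z e = inner ℝ (G z) e)
    {ρ : E d × E d → ℝ} (hρ : ContDiff ℝ 1 ρ) (hρ0 : ∀ p, 0 ≤ ρ p)
    (hρs : tsupport ρ ⊆ Metric.closedBall 0 1) {B : ℝ} (hB : ∀ p, ρ p ≤ B)
    (hB' : ∀ p, ‖fderiv ℝ ρ p‖ ≤ B) {r : ℝ} (hr : 0 < r) (m : ℕ) (z : Z d) {σ : ℝ}
    (hσ : σ ∈ Set.Ioc (0 : ℝ) 1) :
    ∫ p, ρ p * ((m + 1 : ℕ) * σ ^ m * w (path r σ z p) + (1 - σ ^ (m + 1)) *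
      (3 * r ^ 2 * σ ^ 2 * (divV H (path r σ z p) + F (path r σ z p))
        - velDeriv w (path r σ z p) (r • p.1 + (2 * r * σ) • p.2))) ≤
      (∫ p, (m + 1 : ℕ) * σ ^ m * ρ p * w (path r σ z p)) +
      ∫ p in Metric.closedBall 0 1, 15 * B * (r ^ 2 * |F (path r σ z p)| +
        r * ‖G (path r σ z p)‖ + r * ‖H (path r σ z p)‖) := by
  have hρc : HasCompactSupport ρ :=
    (isCompact_closedBall (0 : E d × E d) 1).of_isClosed_subset (isClosed_tsupport ρ) hρs
  have hB0 : 0 ≤ B := (hρ0 0).trans (hB 0)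
  have hp : Continuous fun p : E d × E d => path r σ z p :=
    (continuous_path r).comp (by fun_prop : Continuous fun p : E d × E d => (σ, z, p))
  have hHf : Continuous (fderiv ℝ H) := hH.continuous_fderiv one_ne_zero
  have hdiv : Continuous (divV H) := continuous_divV hH
  have hwp : Continuous fun p => w (path r σ z p) := hw.continuous.comp hp
  have hdp : Continuous fun p => divV H (path r σ z p) := hdiv.comp hp
  have hFp : Continuous fun p => F (path r σ z p) := hF.comp hp
  have hGp : Continuous fun p => G (path r σ z p) := hG.comp hp
  have hHp : Continuous fun p => H (path r σ z p) := hH.continuous.comp hp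
  have hρC : Continuous ρ := hρ.continuous
  have hρf : Continuous (fderiv ℝ ρ) := hρ.continuous_fderiv one_ne_zero
  simp only [hgrad]
  set c : ℝ := 1 - σ ^ (m + 1)
  have hc0 : 0 ≤ c := sub_nonneg.2 (pow_le_one₀ hσ.1.le hσ.2)
  have hc1 : c ≤ 1 := sub_le_self _ (by have := hσ.1; positivity)
  have hi1 : Integrable fun p => (m + 1 : ℕ) * σ ^ m * ρ p * w (path r σ z p) :=
    Continuous.integrable_of_hasCompactSupport ((continuous_const.mul hρC).mul hwp)
      (hρc.mul_left.mul_right)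
  have hi2 : Integrable fun p => ρ p * (3 * r ^ 2 * σ ^ 2 * divV H (path r σ z p)) :=
    Continuous.integrable_of_hasCompactSupport (hρC.mul (continuous_const.mul hdp)) hρc.mul_right
  have hi3 : Integrable fun p => ρ p * (3 * r ^ 2 * σ ^ 2 * F (path r σ z p) -
      inner ℝ (G (path r σ z p)) (r • p.1 + (2 * r * σ) • p.2)) :=
    Continuous.integrable_of_hasCompactSupport (hρC.mul ((continuous_const.mul hFp).sub
      (hGp.inner (by fun_prop)))) hρc.mul_right
  have hi4 : Integrable fun p => fderiv ℝ ρ p (-(12 * r * σ) • H (path r σ z p),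
      (15 * r) • H (path r σ z p)) := by
    have hc : Continuous fun p => ((-(12 * r * σ) • H (path r σ z p),
      (15 * r) • H (path r σ z p)) : E d × E d) :=
      (hHp.fun_const_smul _).prodMk (hHp.fun_const_smul _)
    refine Continuous.integrable_of_hasCompactSupport (hρf.clm_apply hc) ?_
    exact (hρc.fderiv (𝕜 := ℝ)).mono' fun p hp' => subset_tsupport _ fun h => hp' (by simp [h])
  have hi5 : Integrable fun p => c * (-fderiv ℝ ρ p (-(12 * r * σ) • H (path r σ z p),
      (15 * r) • H (path r σ z p)) + ρ p * (3 * r ^ 2 * σ ^ 2 * F (path r σ z p) -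
      inner ℝ (G (path r σ z p)) (r • p.1 + (2 * r * σ) • p.2))) :=
    (hi4.neg.add hi3).const_mul c
  -- The divergence of the flux is the one term without an a priori bound; `integral_divV_path`
  -- moves its derivative onto ρ.
  have hsplit : ∫ p, ρ p * ((m + 1 : ℕ) * σ ^ m * w (path r σ z p) + c *
      (3 * r ^ 2 * σ ^ 2 * (divV H (path r σ z p) + F (path r σ z p))
        - inner ℝ (G (path r σ z p)) (r • p.1 + (2 * r * σ) • p.2))) =
      (∫ p, (m + 1 : ℕ) * σ ^ m * ρ p * w (path r σ z p)) +
      ∫ p, c * (-fderiv ℝ ρ p (-(12 * r * σ) • H (path r σ z p),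
      (15 * r) • H (path r σ z p)) + ρ p * (3 * r ^ 2 * σ ^ 2 * F (path r σ z p) -
      inner ℝ (G (path r σ z p)) (r • p.1 + (2 * r * σ) • p.2))) := by
    have hi4' : Integrable fun p => -fderiv ℝ ρ p (-(12 * r * σ) • H (path r σ z p),
      (15 * r) • H (path r σ z p)) := hi4.neg
    have hi23 : Integrable fun p => c * (ρ p * (3 * r ^ 2 * σ ^ 2 * divV H (path r σ z p)) +
        ρ p * (3 * r ^ 2 * σ ^ 2 * F (path r σ z p) -
          inner ℝ (G (path r σ z p)) (r • p.1 + (2 * r * σ) • p.2))) := (hi2.add hi3).const_mul c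
    rw [integral_const_mul, integral_add hi4' hi3, integral_neg,
      ← integral_divV_path hH hρ hρc, ← integral_add hi2 hi3, ← integral_const_mul,
      ← integral_add hi1 hi23]
    congr 1
    funext p
    ring
  rw [hsplit]
  gcongr
  rw [← integral_indicator Metric.isClosed_closedBall.measurableSet]
  have hΨc : Continuous fun p => 15 * B * (r ^ 2 * |F (path r σ z p)| +
        r * ‖G (path r σ z p)‖ + r * ‖H (path r σ z p)‖) :=
    continuous_const.mul (((continuous_const.mul hFp.abs).add (continuous_const.mul hGp.norm)).add
      (continuous_const.mul hHp.norm))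
  refine integral_mono hi5 ?_ fun p => ?_
  · exact (hΨc.continuousOn.integrableOn_compact (isCompact_closedBall _ _)).integrable_indicator
      Metric.isClosed_closedBall.measurableSet
  · by_cases hpb : p ∈ Metric.closedBall (0 : E d × E d) 1
    · simp only [Set.indicator_of_mem hpb]
      have hpn : ‖p‖ ≤ 1 := by simpa using hpb
      have hp1 : ‖p.1‖ ≤ 1 := (norm_fst_le p).trans hpn
      have hp2 : ‖p.2‖ ≤ 1 := (norm_snd_le p).trans hpn
      set y := path r σ z p
      have hσ0 := hσ.1
      have hσ1 := hσ.2
      have hσ2 : σ ^ 2 ≤ 1 := pow_le_one₀ hσ0.le hσ1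
      -- The norm of a pair is the maximum of the two norms, and 12σ ≤ 15.
      have b1 : -fderiv ℝ ρ p (-(12 * r * σ) • H y, (15 * r) • H y) ≤ B * (15 * r * ‖H y‖) := by
        refine (neg_le_abs _).trans ?_
        refine ((fderiv ℝ ρ p).le_opNorm _).trans ?_
        refine mul_le_mul (hB' p) ?_ (norm_nonneg _) hB0
        rw [Prod.norm_def, norm_smul, norm_smul, norm_neg]
        refine max_le ?_ ?_
        · rw [Real.norm_of_nonneg (by positivity)]
          refine mul_le_mul_of_nonneg_right ?_ (norm_nonneg _)
          nlinarith
        · rw [Real.norm_of_nonneg (by positivity)]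
      have b2 : 3 * r ^ 2 * σ ^ 2 * F y ≤ 3 * r ^ 2 * |F y| := by
        have : 3 * r ^ 2 * σ ^ 2 * F y ≤ 3 * r ^ 2 * σ ^ 2 * |F y| := by
          gcongr; exact le_abs_self _
        refine this.trans ?_
        refine mul_le_mul_of_nonneg_right ?_ (abs_nonneg _)
        nlinarith [sq_nonneg r]
      have b3 : -inner ℝ (G y) (r • p.1 + (2 * r * σ) • p.2) ≤ 3 * r * ‖G y‖ := by
        refine (neg_le_abs _).trans ?_
        refine (abs_real_inner_le_norm _ _).trans ?_
        have : ‖r • p.1 + (2 * r * σ) • p.2‖ ≤ 3 * r := by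
          refine (norm_add_le _ _).trans ?_
          rw [norm_smul, norm_smul, Real.norm_of_nonneg hr.le, Real.norm_of_nonneg (by positivity)]
          nlinarith [mul_le_mul_of_nonneg_left hp1 hr.le,
            mul_le_mul_of_nonneg_left hp2 (by positivity : 0 ≤ 2 * r * σ),
            mul_le_mul_of_nonneg_left hσ1 hr.le]
        nlinarith [norm_nonneg (G y), mul_le_mul_of_nonneg_left this (norm_nonneg (G y))]
      have b4 : ρ p * (3 * r ^ 2 * σ ^ 2 * F y - inner ℝ (G y) (r • p.1 + (2 * r * σ) • p.2)) ≤
          B * (3 * r ^ 2 * |F y| + 3 * r * ‖G y‖) := by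
        refine (mul_le_mul_of_nonneg_left (by linarith) (hρ0 p)).trans
          (mul_le_mul_of_nonneg_right (hB p) (by positivity))
      have hR0 : 0 ≤ B * (15 * r * ‖H y‖) + B * (3 * r ^ 2 * |F y| + 3 * r * ‖G y‖) := by
        positivity
      calc c * (-fderiv ℝ ρ p (-(12 * r * σ) • H y, (15 * r) • H y) + ρ p *
            (3 * r ^ 2 * σ ^ 2 * F y - inner ℝ (G y) (r • p.1 + (2 * r * σ) • p.2)))
          ≤ c * (B * (15 * r * ‖H y‖) + B * (3 * r ^ 2 * |F y| + 3 * r * ‖G y‖)) := by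
            gcongr
        _ ≤ B * (15 * r * ‖H y‖) + B * (3 * r ^ 2 * |F y| + 3 * r * ‖G y‖) :=
            mul_le_of_le_one_left hR0 hc1
        _ ≤ _ := by
            have h1 : 0 ≤ B * (r ^ 2 * |F y|) := by positivity
            have h2 : 0 ≤ B * (r * ‖G y‖) := by positivity
            nlinarith
    · simp only [Set.indicator_of_notMem hpb]
      have h0 : p ∉ tsupport ρ := fun h => hpb (hρs h)
      have h1 : fderiv ℝ ρ p = 0 := by
        by_contra h
        exact h0 (support_fderiv_subset ℝ h)
      simp [h1, image_eq_zero_of_notMem_tsupport h0]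

-- The inequality along a single curve is averaged over p against ρ, and the integrals are exchanged
-- so that for each σ the integration by parts in p becomes available. The result bounds w pointwise
-- by a mean with bounded kernel plus an average of the data over volume preserving maps.
set_option maxHeartbeats 1000000 in
theorem ofReal_le_pathMean_add {w F : Z d → ℝ} {G H : Z d → E d} (hw : ContDiff ℝ 1 w)
    (hG : Continuous G) (hH : ContDiff ℝ 1 H) (hF : Continuous F) (hw0 : ∀ z, 0 ≤ w z)
    (hgrad : ∀ z e, velDeriv w z e = inner ℝ (G z) e)
    (heq : ∀ z, transport w z ≤ divV H z + F z)
    {ρ : E d × E d → ℝ} (hρ : ContDiff ℝ 1 ρ) (hρ0 : ∀ p, 0 ≤ ρ p)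
    (hρs : tsupport ρ ⊆ Metric.closedBall 0 1) (hρ1 : ∫ p, ρ p = 1) {B : ℝ} (hB : ∀ p, ρ p ≤ B)
    (hB' : ∀ p, ‖fderiv ℝ ρ p‖ ≤ B) {r : ℝ} (hr : 0 < r) (z : Z d) :
    ENNReal.ofReal (w z) ≤ pathMean d r ρ (fun y => ENNReal.ofReal (w y)) z +
      ENNReal.ofReal (15 * B) * ∫⁻ a in Set.Ioc (0 : ℝ) 1 ×ˢ Metric.closedBall (0 : E d × E d) 1,
        ENNReal.ofReal (r ^ 2 * |F (path r a.1 z a.2)| +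
          r * ‖G (path r a.1 z a.2)‖ + r * ‖H (path r a.1 z a.2)‖) := by
  rw [pathMean]
  -- The exponent matters only for the boundedness of the kernel in `pathMean_le`, not here.
  generalize 6 * d + 2 = m
  have hρc : HasCompactSupport ρ :=
    (isCompact_closedBall (0 : E d × E d) 1).of_isClosed_subset (isClosed_tsupport ρ) hρs
  have hB0 : 0 ≤ B := (hρ0 0).trans (hB 0)
  have hp : Continuous fun q : ℝ × E d × E d => path r q.1 z q.2 :=
    (continuous_path r).comp (by fun_prop : Continuous fun q : ℝ × E d × E d => (q.1, z, q.2))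
  have hHf : Continuous (fderiv ℝ H) := hH.continuous_fderiv one_ne_zero
  have hwf : Continuous (fderiv ℝ w) := hw.continuous_fderiv one_ne_zero
  have hdiv : Continuous (divV H) := continuous_divV hH
  have hwp : Continuous fun q : ℝ × E d × E d => w (path r q.1 z q.2) := hw.continuous.comp hp
  have hdp : Continuous fun q : ℝ × E d × E d => divV H (path r q.1 z q.2) := hdiv.comp hp
  have hFp : Continuous fun q : ℝ × E d × E d => F (path r q.1 z q.2) := hF.comp hp
  have hGp : Continuous fun q : ℝ × E d × E d => G (path r q.1 z q.2) := hG.comp hp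
  have hHp : Continuous fun q : ℝ × E d × E d => H (path r q.1 z q.2) := hH.continuous.comp hp
  have hρC : Continuous ρ := hρ.continuous
  set J : ℝ → E d × E d → ℝ := fun σ p => (m + 1 : ℕ) * σ ^ m * w (path r σ z p) +
    (1 - σ ^ (m + 1)) * (3 * r ^ 2 * σ ^ 2 * (divV H (path r σ z p) + F (path r σ z p))
        - velDeriv w (path r σ z p) (r • p.1 + (2 * r * σ) • p.2)) with hJ
  have hJc : Continuous fun q : ℝ × E d × E d => J q.1 q.2 := by
    simp only [hJ, hgrad]
    have c1 : Continuous fun q : ℝ × E d × E d => ((m + 1 : ℕ) : ℝ) * q.1 ^ m := by fun_prop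
    have c2 : Continuous fun q : ℝ × E d × E d => 1 - q.1 ^ (m + 1) := by fun_prop
    have c3 : Continuous fun q : ℝ × E d × E d => 3 * r ^ 2 * q.1 ^ 2 := by fun_prop
    have c4 : Continuous fun q : ℝ × E d × E d => r • q.2.1 + (2 * r * q.1) • q.2.2 := by fun_prop
    exact (c1.mul hwp).add (c2.mul ((c3.mul (hdp.add hFp)).sub (hGp.inner c4)))
  have hρJ : Continuous fun q : E d × E d => ∫ σ in (0 : ℝ)..1, J σ q := by
    refine intervalIntegral.continuous_parametric_intervalIntegral_of_continuous' ?_ 0 1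
    exact hJc.comp (by fun_prop : Continuous fun q : (E d × E d) × ℝ => (q.2, q.1))
  have hρi : Integrable ρ := hρC.integrable_of_hasCompactSupport hρc
  have h1 : w z ≤ ∫ p, ρ p * ∫ σ in (0 : ℝ)..1, J σ p := by
    calc w z = ∫ p, ρ p * w z := by rw [integral_mul_const, hρ1, one_mul]
      _ ≤ _ := by
        refine integral_mono (hρi.mul_const _)
          (Continuous.integrable_of_hasCompactSupport (hρC.mul hρJ) hρc.mul_right) fun p => ?_
        exact mul_le_mul_of_nonneg_left (le_integral_path hw hH hF heq r m z p) (hρ0 p)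
  have h2 : ∫ p, ρ p * ∫ σ in (0 : ℝ)..1, J σ p =
      ∫ σ in Set.Ioc (0 : ℝ) 1, ∫ p, ρ p * J σ p := by
    rw [← integral_integral_swap]
    · refine integral_congr_ae (Eventually.of_forall fun p => ?_)
      simp only
      rw [intervalIntegral.integral_of_le zero_le_one, integral_const_mul]
    · have hc : Continuous fun q : (E d × E d) × ℝ => ρ q.1 * J q.2 q.1 :=
        (hρC.comp continuous_fst).mul
          (hJc.comp (by fun_prop : Continuous fun q : (E d × E d) × ℝ => (q.2, q.1)))
      have hi := hc.continuousOn.integrableOn_compact (μ := volume.prod volume)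
        ((isCompact_closedBall (0 : E d × E d) 1).prod (isCompact_Icc (a := (0 : ℝ)) (b := 1)))
      have hi2 : IntegrableOn (fun q : (E d × E d) × ℝ => ρ q.1 * J q.2 q.1)
          (Set.univ ×ˢ Set.Ioc 0 1) (volume.prod volume) := by
        refine (hi.of_forall_sdiff_eq_zero (MeasurableSet.univ.prod measurableSet_Ioc)
          fun q hq => ?_)
        have : q.1 ∉ tsupport ρ := fun h => hq.2 ⟨hρs h, Set.Ioc_subset_Icc_self hq.1.2⟩
        simp [image_eq_zero_of_notMem_tsupport this]
      rw [IntegrableOn, ← Measure.prod_restrict, Measure.restrict_univ] at hi2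
      exact hi2
  rw [h2] at h1
  refine (ENNReal.ofReal_le_ofReal h1).trans ((ofReal_integral_le_lintegral _).trans ?_)
  set Ψ : Z d → ℝ := fun y => r ^ 2 * |F y| + r * ‖G y‖ + r * ‖H y‖
  have hΨ0 : ∀ y, 0 ≤ Ψ y := fun y => by positivity
  have hΨc : Continuous fun q : ℝ × E d × E d => Ψ (path r q.1 z q.2) := by
    exact ((continuous_const.mul hFp.abs).add (continuous_const.mul hGp.norm)).add
      (continuous_const.mul hHp.norm)
  have h3 : ∀ σ ∈ Set.Ioc (0 : ℝ) 1, ENNReal.ofReal (∫ p, ρ p * J σ p) ≤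
      (∫⁻ p, ENNReal.ofReal ((m + 1 : ℕ) * σ ^ m * ρ p) * ENNReal.ofReal (w (path r σ z p))) +
      ENNReal.ofReal (15 * B) * ∫⁻ p in Metric.closedBall 0 1,
        ENNReal.ofReal (Ψ (path r σ z p)) := by
    intro σ hσ
    have hσc : Continuous fun p : E d × E d => (σ, p) := by fun_prop
    have hFσ : Continuous fun p : E d × E d => F (path r σ z p) := hFp.comp hσc
    have hGσ : Continuous fun p : E d × E d => G (path r σ z p) := hGp.comp hσc
    have hHσ : Continuous fun p : E d × E d => H (path r σ z p) := hHp.comp hσc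
    have hΨσ : Continuous fun p : E d × E d => Ψ (path r σ z p) :=
      ((continuous_const.mul hFσ.abs).add (continuous_const.mul hGσ.norm)).add
        (continuous_const.mul hHσ.norm)
    have hwσ : Continuous fun p : E d × E d => w (path r σ z p) := hwp.comp hσc
    have key : ∫ p, ρ p * J σ p ≤ (∫ p, (m + 1 : ℕ) * σ ^ m * ρ p * w (path r σ z p)) +
        ∫ p in Metric.closedBall 0 1, 15 * B * Ψ (path r σ z p) :=
      integral_path_integrand_le hw hG hH hF hgrad hρ hρ0 hρs hB hB' hr m z hσ
    refine (ENNReal.ofReal_le_ofReal key).trans (ENNReal.ofReal_add_le.trans ?_)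
    have hnn : ∀ p, 0 ≤ (m + 1 : ℕ) * σ ^ m * ρ p := fun p => by
      have := hρ0 p
      have := hσ.1
      positivity
    refine add_le_add ?_ ?_
    · have hi : Integrable fun p => (m + 1 : ℕ) * σ ^ m * ρ p * w (path r σ z p) :=
        Continuous.integrable_of_hasCompactSupport ((continuous_const.mul hρC).mul hwσ)
          (hρc.mul_left.mul_right)
      rw [ofReal_integral_eq_lintegral_ofReal hi
        (Eventually.of_forall fun p => mul_nonneg (hnn p) (hw0 _))]
      refine lintegral_mono fun p => ?_
      rw [ENNReal.ofReal_mul (hnn p)]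
    · rw [integral_const_mul, ENNReal.ofReal_mul (by positivity),
        ofReal_integral_eq_lintegral_ofReal
          (hΨσ.continuousOn.integrableOn_compact (isCompact_closedBall _ _))
          (Eventually.of_forall fun p => hΨ0 _)]
  refine (setLIntegral_mono' measurableSet_Ioc h3).trans ?_
  have hme : Measurable fun q : ℝ × E d × E d => ENNReal.ofReal (Ψ (path r q.1 z q.2)) :=
    hΨc.measurable.ennreal_ofReal
  have hmm : Measurable fun σ : ℝ => ∫⁻ p in Metric.closedBall (0 : E d × E d) 1,
      ENNReal.ofReal (Ψ (path r σ z p)) := hme.lintegral_prod_right'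
  rw [lintegral_add_right _ (hmm.const_mul _), lintegral_const_mul _ hmm]
  refine add_le_add le_rfl (le_of_eq ?_)
  have hvol : (volume : Measure (ℝ × E d × E d)).restrict
      (Set.Ioc (0 : ℝ) 1 ×ˢ Metric.closedBall (0 : E d × E d) 1) =
      (volume.restrict (Set.Ioc (0 : ℝ) 1)).prod (volume.restrict (Metric.closedBall 0 1)) :=
    (Measure.prod_restrict _ _).symm
  rw [hvol, lintegral_prod _ hme.aemeasurable]

/-- A kinetic Poincaré inequality for smooth, compactly supported subsolutions. -/
theorem exists_smooth_poincare (d : ℕ) : ∃ C : ℝ, 0 < C ∧ ∀ r : ℝ, 0 < r →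
    ∀ (w F : Z d → ℝ) (G H : Z d → E d), ContDiff ℝ 1 w → Continuous G → ContDiff ℝ 1 H →
    Continuous F → HasCompactSupport w → HasCompactSupport G → HasCompactSupport H →
    HasCompactSupport F → (∀ z, 0 ≤ w z) → (∀ z e, velDeriv w z e = inner ℝ (G z) e) →
    (∀ z, transport w z ≤ divV H z + F z) →
    ∫ z, w z ^ 2 ≤ C / r ^ (4 * d + 2) * (∫ z, w z) ^ 2 +
      C * ∫ z, (r ^ 2 * |F z| + r * ‖G z‖ + r * ‖H z‖) ^ 2 := by
  let b : ContDiffBump (0 : E d × E d) := ⟨1 / 2, 1, by norm_num, by norm_num⟩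
  set ρ : E d × E d → ℝ := b.normed volume
  have hρ : ContDiff ℝ 1 ρ := b.contDiff_normed
  have hρ0 : ∀ p, 0 ≤ ρ p := fun p => b.nonneg_normed p
  have hρs : tsupport ρ ⊆ Metric.closedBall 0 1 := b.tsupport_normed_eq.subset
  have hρ1 : ∫ p, ρ p = 1 := b.integral_normed
  have hρc : HasCompactSupport ρ := b.hasCompactSupport_normed
  have hρi : Integrable ρ := hρ.continuous.integrable_of_hasCompactSupport hρc
  obtain ⟨B₁, hB₁⟩ := hρc.exists_bound_of_continuous hρ.continuous
  obtain ⟨B₂, hB₂⟩ := (hρc.fderiv (𝕜 := ℝ)).exists_bound_of_continuous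
    (hρ.continuous_fderiv one_ne_zero)
  set B := max B₁ B₂
  have hB : ∀ p, ρ p ≤ B := fun p => (le_abs_self _).trans ((hB₁ p).trans (le_max_left _ _))
  have hB' : ∀ p, ‖fderiv ℝ ρ p‖ ≤ B := fun p => (hB₂ p).trans (le_max_right _ _)
  have hB0 : 0 ≤ B := (hρ0 0).trans (hB 0)
  set κ : Measure (ℝ × E d × E d) :=
    volume.restrict (Set.Ioc (0 : ℝ) 1 ×ˢ Metric.closedBall (0 : E d × E d) 1)
  have hκ : κ Set.univ ≠ ⊤ := by
    rw [Measure.restrict_apply_univ]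
    refine ne_top_of_le_ne_top ?_ (measure_mono (Set.prod_mono Set.Ioc_subset_Icc_self subset_rfl))
    exact (isCompact_Icc.prod (isCompact_closedBall _ _)).measure_lt_top.ne
  set k : ℝ := (κ Set.univ).toReal
  set M : ℝ := ((6 * d + 2 + 1 : ℕ) : ℝ)
  set C₁ : ℝ := M * B * (20 / 3) ^ d / 3
  refine ⟨2 * (C₁ * M) + 2 * ((15 * B) ^ 2 * k ^ 2) + 1, by positivity, ?_⟩
  intro r hr w F G H hw hG hH hF hwc hGc hHc hFc hw0 hgrad heq
  set Ψ : Z d → ℝ := fun y => r ^ 2 * |F y| + r * ‖G y‖ + r * ‖H y‖ with hΨ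
  have hΨ0 : ∀ y, 0 ≤ Ψ y := fun y => by positivity
  have hΨc : Continuous Ψ := ((continuous_const.mul hF.abs).add
    (continuous_const.mul hG.norm)).add (continuous_const.mul hH.continuous.norm)
  have hΨs : HasCompactSupport Ψ :=
    ((hFc.norm.mul_left).add hGc.norm.mul_left).add hHc.norm.mul_left
  have hwe : Measurable fun y => ENNReal.ofReal (w y) := hw.continuous.measurable.ennreal_ofReal
  have hΨe : Measurable fun y => ENNReal.ofReal (Ψ y) := hΨc.measurable.ennreal_ofReal
  have hpm : Measurable (Function.uncurry fun (a : ℝ × E d × E d) (z : Z d) => path r a.1 z a.2) :=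
    ((continuous_path r).comp (by fun_prop :
      Continuous fun q : (ℝ × E d × E d) × Z d => (q.1.1, q.2, q.1.2))).measurable
  set S : Z d → ℝ≥0∞ := pathMean d r ρ (fun y => ENNReal.ofReal (w y))
  set I : Z d → ℝ≥0∞ := fun z => ∫⁻ a, ENNReal.ofReal (Ψ (path r a.1 z a.2)) ∂κ
  have hIm : Measurable I := by
    refine Measurable.lintegral_prod_right'
      (f := fun q : Z d × ℝ × E d × E d => ENNReal.ofReal (Ψ (path r q.2.1 q.1 q.2.2))) ?_
    exact hΨe.comp (hpm.comp measurable_swap)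
  have hpt : ∀ z, ENNReal.ofReal (w z) ≤ S z + ENNReal.ofReal (15 * B) * I z := fun z =>
    ofReal_le_pathMean_add hw hG hH hF hw0 hgrad heq hρ hρ0 hρs hρ1 hB hB' hr z
  set W : ℝ≥0∞ := ∫⁻ z, ENNReal.ofReal (w z)
  have hWfin : W ≠ ⊤ :=
    (hw.continuous.integrable_of_hasCompactSupport hwc).lintegral_lt_top.ne
  -- Interpolation: the square of the mean is at most its supremum times its integral, both of which
  -- are multiples of the mass W.
  have hS2 : ∫⁻ z, S z ^ 2 ≤ ENNReal.ofReal (C₁ * M / r ^ (4 * d + 2)) * W ^ 2 := by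
    have hsup : ∀ z, S z ≤ ENNReal.ofReal (C₁ / r ^ (4 * d + 2)) * W := by
      intro z
      refine (pathMean_le hr hB0 hB hwe z).trans (le_of_eq ?_)
      congr 2
      simp only [C₁, M]
      rw [div_div]
    calc ∫⁻ z, S z ^ 2 ≤ ∫⁻ z, (ENNReal.ofReal (C₁ / r ^ (4 * d + 2)) * W) * S z := by
          refine lintegral_mono fun z => ?_
          rw [sq]
          gcongr
          exact hsup z
      _ = (ENNReal.ofReal (C₁ / r ^ (4 * d + 2)) * W) * ∫⁻ z, S z :=
          lintegral_const_mul' _ _ (ENNReal.mul_ne_top ENNReal.ofReal_ne_top hWfin)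
      _ ≤ (ENNReal.ofReal (C₁ / r ^ (4 * d + 2)) * W) * (ENNReal.ofReal M * W) := by
          gcongr
          refine (lintegral_pathMean_le r hρ.continuous hρ0 hρi hρ1 hwe).trans (le_of_eq ?_)
          simp only [M]
          rw [ENNReal.ofReal_natCast]
      _ = _ := by
          have e : C₁ * M / r ^ (4 * d + 2) = C₁ / r ^ (4 * d + 2) * M := by ring
          rw [e, ENNReal.ofReal_mul (by positivity)]
          ring
  -- The curves are volume preserving in z, so averaging over their parameters costs only the total
  -- mass of κ in L².
  have hI2 : ∫⁻ z, I z ^ 2 ≤ ENNReal.ofReal (k ^ 2) * ∫⁻ z, ENNReal.ofReal (Ψ z) ^ 2 := by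
    have := lintegral_average_sq_le (κ := κ) (μ := volume) hpm
      (fun a => measurePreserving_path r a.1 a.2) hΨe
    refine this.trans (le_of_eq ?_)
    rw [ENNReal.ofReal_pow (by positivity), ENNReal.ofReal_toReal hκ]
  have hmain : ∫⁻ z, ENNReal.ofReal (w z) ^ 2 ≤
      ENNReal.ofReal (2 * (C₁ * M / r ^ (4 * d + 2))) * W ^ 2 +
        ENNReal.ofReal (2 * ((15 * B) ^ 2 * k ^ 2)) * ∫⁻ z, ENNReal.ofReal (Ψ z) ^ 2 := by
    have h2 : ∀ a b : ℝ≥0∞, (a + b) ^ 2 ≤ 2 * a ^ 2 + 2 * b ^ 2 := fun a b => by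
      have := ENNReal.rpow_add_le_mul_rpow_add_rpow a b (p := 2) (by norm_num)
      norm_num at this
      rw [mul_add] at this
      exact this
    calc ∫⁻ z, ENNReal.ofReal (w z) ^ 2
        ≤ ∫⁻ z, (2 * S z ^ 2 + 2 * (ENNReal.ofReal (15 * B) * I z) ^ 2) := by
          refine lintegral_mono fun z => le_trans ?_ (h2 _ _)
          gcongr
          exact hpt z
      _ = 2 * (∫⁻ z, S z ^ 2) + 2 * ENNReal.ofReal (15 * B) ^ 2 * ∫⁻ z, I z ^ 2 := by
          simp only [mul_pow]
          rw [lintegral_add_right _ (by fun_prop), lintegral_const_mul' _ _ (by norm_num),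
            lintegral_const_mul _ (by fun_prop), lintegral_const_mul _ (by fun_prop), mul_assoc]
      _ ≤ 2 * (ENNReal.ofReal (C₁ * M / r ^ (4 * d + 2)) * W ^ 2) +
          2 * ENNReal.ofReal (15 * B) ^ 2 *
            (ENNReal.ofReal (k ^ 2) * ∫⁻ z, ENNReal.ofReal (Ψ z) ^ 2) := by gcongr
      _ = _ := by
          have e1 : ENNReal.ofReal (2 * ((15 * B) ^ 2 * k ^ 2)) =
              2 * ENNReal.ofReal (15 * B) ^ 2 * ENNReal.ofReal (k ^ 2) := by
            rw [ENNReal.ofReal_mul (by norm_num), ENNReal.ofReal_mul (by positivity),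
              ENNReal.ofReal_pow (by positivity), ENNReal.ofReal_ofNat, mul_assoc]
          have e2 : ENNReal.ofReal (2 * (C₁ * M / r ^ (4 * d + 2))) =
              2 * ENNReal.ofReal (C₁ * M / r ^ (4 * d + 2)) := by
            rw [ENNReal.ofReal_mul (by norm_num), ENNReal.ofReal_ofNat]
          rw [e1, e2]
          ring
  have hc1 : ∫⁻ z, ENNReal.ofReal (w z) ^ 2 = ENNReal.ofReal (∫ z, w z ^ 2) := by
    have hwi : Integrable fun z => w z ^ 2 :=
      (hw.continuous.pow 2).integrable_of_hasCompactSupport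
        (by simpa [sq] using hwc.mul_left (f := w))
    rw [ofReal_integral_eq_lintegral_ofReal hwi (Eventually.of_forall fun z => sq_nonneg _)]
    refine lintegral_congr fun z => (ENNReal.ofReal_pow (hw0 z) 2).symm
  have hΨi : Integrable fun z => Ψ z ^ 2 := (hΨc.pow 2).integrable_of_hasCompactSupport
        (by simpa [sq] using hΨs.mul_left (f := Ψ))
  have hc2 : ∫⁻ z, ENNReal.ofReal (Ψ z) ^ 2 = ENNReal.ofReal (∫ z, Ψ z ^ 2) := by
    rw [ofReal_integral_eq_lintegral_ofReal hΨi (Eventually.of_forall fun z => sq_nonneg _)]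
    refine lintegral_congr fun z => (ENNReal.ofReal_pow (hΨ0 z) 2).symm
  have hc3 : W = ENNReal.ofReal (∫ z, w z) :=
    (ofReal_integral_eq_lintegral_ofReal (hw.continuous.integrable_of_hasCompactSupport hwc)
      (Eventually.of_forall hw0)).symm
  have hw1 : 0 ≤ ∫ z, w z := integral_nonneg hw0
  have hΨ1 : 0 ≤ ∫ z, Ψ z ^ 2 := integral_nonneg fun z => sq_nonneg _
  rw [hc1, hc2, hc3, ← ENNReal.ofReal_pow hw1, ← ENNReal.ofReal_mul (by positivity),
    ← ENNReal.ofReal_mul (by positivity), ← ENNReal.ofReal_add (by positivity) (by positivity),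
    ENNReal.ofReal_le_ofReal_iff (by positivity)] at hmain
  refine hmain.trans ?_
  have hC : 0 ≤ C₁ * M := by positivity
  have hK : 0 ≤ (15 * B) ^ 2 * k ^ 2 := by positivity
  rw [← mul_div_assoc]
  gcongr <;> linarith

end SmoothPoincare

/-! ### Mollification of compactly supported weak subsolutions. -/

section Localized

variable {d : ℕ}

/-- A compactly supported square integrable subsolution of `(∂_t + v·∇_x) w ≤ ∇_v · H + F`
on the whole space, with velocity gradient `G`. -/
structure IsLocalized (w : Z d → ℝ) (G H : Z d → E d) (F : Z d → ℝ) : Prop where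
  memLp_fst : MemLp w 2
  memLp_grad : MemLp G 2
  memLp_flux : MemLp H 2
  memLp_rhs : MemLp F 2
  compact : ∃ K : Set (Z d), IsCompact K ∧ ∀ z, z ∉ K → w z = 0 ∧ G z = 0 ∧ H z = 0 ∧ F z = 0
  nonneg : ∀ z, 0 ≤ w z
  grad : ∀ φ : Z d → ℝ, ContDiff ℝ ∞ φ → HasCompactSupport φ → ∀ e : E d,
    ∫ z, w z * velDeriv φ z e = - ∫ z, inner ℝ (G z) e * φ z
  le : ∀ φ : Z d → ℝ, ContDiff ℝ ∞ φ → HasCompactSupport φ → (∀ z, 0 ≤ φ z) →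
    - ∫ z, w z * transport φ z ≤ ∫ z, (F z * φ z - velDeriv φ z (H z))

theorem velDeriv_eq_sum (φ : Z d → ℝ) (z : Z d) (e : E d) :
    velDeriv φ z e = ∑ i, velDeriv φ z (EuclideanSpace.single i 1) * e i := by
  have he : ((0, 0, e) : Z d) = ∑ i, e i • ((0, 0, EuclideanSpace.single i 1) : Z d) := by
    refine Prod.ext ?_ (Prod.ext ?_ ?_)
    · simp [Prod.fst_sum]
    · simp [Prod.fst_sum, Prod.snd_sum]
    · simp only [Prod.snd_sum, Prod.smul_snd]
      ext j
      simp [Finset.sum_apply, Pi.single_apply]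
  simp only [velDeriv]
  rw [he, map_sum]
  simp only [map_smul, smul_eq_mul, mul_comm]

/-- The kernel depends on y ∘ z⁻¹ only, and y ∘ (z ∘ k)⁻¹ = (y ∘ k⁻¹) ∘ z⁻¹. Moving z to the right
by k = (0, 0, se) therefore amounts to moving y by k⁻¹, which lets a derivative of the average fall
on the test function. -/
theorem fderiv_kernel_velocity {ρ : Z d → ℝ} (hρ : ContDiff ℝ 1 ρ) (z y : Z d) (e : E d) :
    fderiv ℝ (fun z => ρ (rdiv z y)) z (0, 0, e) = -velDeriv (fun y => ρ (rdiv z y)) y e := by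
  have h1 : DifferentiableAt ℝ (fun z => ρ (rdiv z y)) z :=
    (hρ.comp ((contDiff_rdiv (d := d)).comp (by fun_prop : ContDiff ℝ 1 fun z : Z d => (z, y)))
      ).differentiable one_ne_zero z
  have h2 : DifferentiableAt ℝ (fun y => ρ (rdiv z y)) y :=
    (hρ.comp ((contDiff_rdiv (d := d)).comp (by fun_prop : ContDiff ℝ 1 fun y : Z d => (z, y)))
      ).differentiable one_ne_zero y
  rw [velDeriv, ← h1.lineDeriv_eq_fderiv, ← map_neg, ← h2.lineDeriv_eq_fderiv]
  unfold lineDeriv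
  congr 1
  funext s
  refine congrArg ρ ?_
  ext i
  · simp [rdiv]
  · simp [rdiv]
    left
    ring
  · simp [rdiv]; ring

/-- The same invariance with k = (s, 0, 0): right multiplication by k is free transport for time s.
This is the reason for averaging over Galilean translations, since ordinary mollification in v does
not commute with v·∇_x. -/
theorem fderiv_kernel_transport {ρ : Z d → ℝ} (hρ : ContDiff ℝ 1 ρ) (z y : Z d) :
    fderiv ℝ (fun z => ρ (rdiv z y)) z (1, z.2.2, 0) =
      -transport (fun y => ρ (rdiv z y)) y := by
  have h1 : DifferentiableAt ℝ (fun z => ρ (rdiv z y)) z :=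
    (hρ.comp ((contDiff_rdiv (d := d)).comp (by fun_prop : ContDiff ℝ 1 fun z : Z d => (z, y)))
      ).differentiable one_ne_zero z
  have h2 : DifferentiableAt ℝ (fun y => ρ (rdiv z y)) y :=
    (hρ.comp ((contDiff_rdiv (d := d)).comp (by fun_prop : ContDiff ℝ 1 fun y : Z d => (z, y)))
      ).differentiable one_ne_zero y
  rw [transport, ← h1.lineDeriv_eq_fderiv, ← map_neg, ← h2.lineDeriv_eq_fderiv]
  unfold lineDeriv
  congr 1
  funext s
  refine congrArg ρ ?_
  ext i
  · simp [rdiv]; ring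
  · simp [rdiv]; ring
  · simp [rdiv]

theorem fderiv_mol_apply {V : Type*} [NormedAddCommGroup V] [NormedSpace ℝ V]
    [FiniteDimensional ℝ V] {f : Z d → V} (hf : Integrable f)
    {S : Set (Z d)} (hS : IsCompact S) (hfS : ∀ y, y ∉ S → f y = 0)
    {ρ : Z d → ℝ} (hρ : ContDiff ℝ 1 ρ) (z e : Z d) :
    fderiv ℝ (mol ρ f) z e = ∫ y, fderiv ℝ (fun z => ρ (rdiv z y)) z e • f y ∧
      Integrable fun y => fderiv ℝ (fun z => ρ (rdiv z y)) z e • f y := by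
  have hK : ContDiff ℝ 1 (Function.uncurry fun z y : Z d => ρ (rdiv z y)) :=
    hρ.comp contDiff_rdiv
  obtain ⟨h1, -, h3⟩ := hasFDerivAt_integral_kernel hK hf hS hfS
  have h4 : fderiv ℝ (mol ρ f) z =
      ∫ y, (fderiv ℝ (fun z => ρ (rdiv z y)) z).smulRight (f y) := (h1 z).fderiv
  refine ⟨?_, ?_⟩
  · rw [h4, ContinuousLinearMap.integral_apply (h3 z)]
    rfl
  · exact (h3 z).apply_continuousLinearMap e

/-- Left translation averages of a localized subsolution satisfy the inequality pointwise. -/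
theorem IsLocalized.mol_spec {w F : Z d → ℝ} {G H : Z d → E d} (h : IsLocalized w G H F)
    (hwi : Integrable w) (hGi : Integrable G) (hHi : Integrable H) (hFi : Integrable F)
    {ρ : Z d → ℝ} (hρ : ContDiff ℝ ∞ ρ) (hρc : HasCompactSupport ρ) (hρ0 : ∀ y, 0 ≤ ρ y)
    (z : Z d) :
    (∀ e, velDeriv (mol ρ w) z e = inner ℝ (mol ρ G z) e) ∧
      transport (mol ρ w) z ≤ divV (mol ρ H) z + mol ρ F z := by
  obtain ⟨K, hK, hK0⟩ := h.compact
  have hρ1 : ContDiff ℝ 1 ρ := hρ.of_le (mod_cast le_top)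
  -- For frozen z the kernel is an admissible test function of y, and the weak formulation tested
  -- with it is the pointwise statement at z.
  set φ : Z d → ℝ := fun y => ρ (rdiv z y) with hφ
  have hφs : ContDiff ℝ ∞ φ :=
    hρ.comp ((contDiff_rdiv (d := d)).comp (by fun_prop : ContDiff ℝ ∞ fun y : Z d => (z, y)))
  have hφc : HasCompactSupport φ := hρc.comp_homeomorph (ltHomeo z).symm
  have hφ0 : ∀ y, 0 ≤ φ y := fun y => hρ0 _
  have hHint : Integrable fun y => velDeriv φ y (H y) := by
    have hs : ∀ y, velDeriv φ y (H y) =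
        ∑ i, -((fderiv ℝ (fun z => ρ (rdiv z y)) z (0, 0, EuclideanSpace.single i 1) • H y) i) := by
      intro y
      rw [velDeriv_eq_sum]
      refine Finset.sum_congr rfl fun i _ => ?_
      rw [fderiv_kernel_velocity hρ1]
      simp [hφ]
    simp_rw [hs]
    refine integrable_finsetSum _ fun i _ => Integrable.neg ?_
    exact (EuclideanSpace.proj (𝕜 := ℝ) i).integrable_comp
      (fderiv_mol_apply hHi hK (fun y hy => (hK0 y hy).2.2.1) hρ1 z _).2
  constructor
  · intro e
    rw [velDeriv, (fderiv_mol_apply hwi hK (fun y hy => (hK0 y hy).1) hρ1 z _).1]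
    have h1 : ∀ y, fderiv ℝ (fun z => ρ (rdiv z y)) z (0, 0, e) • w y =
        -(w y * velDeriv φ y e) := by
      intro y
      rw [fderiv_kernel_velocity hρ1, smul_eq_mul, neg_mul, mul_comm]
    simp_rw [h1]
    rw [integral_neg, h.grad φ hφs hφc e, neg_neg]
    have h2 := map_mol ((innerSL ℝ).flip e) hGi hρ.continuous hρc z
    simp only [ContinuousLinearMap.flip_apply, innerSL_apply_apply] at h2
    rw [h2]
    unfold mol
    refine integral_congr_ae (Eventually.of_forall fun y => ?_)
    simp [hφ, mul_comm]
  · have hT : transport (mol ρ w) z = -∫ y, w y * transport φ y := by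
      rw [transport, (fderiv_mol_apply hwi hK (fun y hy => (hK0 y hy).1) hρ1 z _).1,
        ← integral_neg]
      refine integral_congr_ae (Eventually.of_forall fun y => ?_)
      simp only [fderiv_kernel_transport hρ1, smul_eq_mul, hφ]
      ring
    have hD : divV (mol ρ H) z = -∫ y, velDeriv φ y (H y) := by
      have hi : ∀ i : Fin d, Integrable fun y =>
          (fderiv ℝ (fun z => ρ (rdiv z y)) z (0, 0, EuclideanSpace.single i 1) • H y) i :=
        fun i => (EuclideanSpace.proj (𝕜 := ℝ) i).integrable_comp
          (fderiv_mol_apply hHi hK (fun y hy => (hK0 y hy).2.2.1) hρ1 z _).2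
      have h1 : ∀ i : Fin d, fderiv ℝ (mol ρ H) z (0, 0, EuclideanSpace.single i 1) i =
          ∫ y, (fderiv ℝ (fun z => ρ (rdiv z y)) z (0, 0, EuclideanSpace.single i 1) • H y) i := by
        intro i
        obtain ⟨h2, h3⟩ := fderiv_mol_apply hHi hK (fun y hy => (hK0 y hy).2.2.1) hρ1 z
          (0, 0, EuclideanSpace.single i 1)
        rw [h2]
        exact ((EuclideanSpace.proj (𝕜 := ℝ) i).integral_comp_comm h3).symm
      simp only [divV, h1]
      rw [← integral_finsetSum _ fun i _ => hi i, ← integral_neg]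
      refine integral_congr_ae (Eventually.of_forall fun y => ?_)
      simp only
      rw [velDeriv_eq_sum, ← Finset.sum_neg_distrib]
      refine Finset.sum_congr rfl fun i _ => ?_
      rw [fderiv_kernel_velocity hρ1]
      simp [hφ]
    have hFm : mol ρ F z = ∫ y, F y * φ y := by
      unfold mol
      refine integral_congr_ae (Eventually.of_forall fun y => ?_)
      simp [hφ, mul_comm]
    have hFint : Integrable fun y => F y * φ y := by
      have := integrable_kernel_smul hFi hρ.continuous hρc z
      refine this.congr (Eventually.of_forall fun y => ?_)
      simp [hφ, mul_comm]
    have hle := h.le φ hφs hφc hφ0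
    rw [integral_sub hFint hHint] at hle
    rw [hT, hD, hFm]
    linarith

/-- Smooth approximation of localized subsolutions, converging almost everywhere with a
square integrable bound. -/
theorem IsLocalized.exists_smooth_approx {w F : Z d → ℝ} {G H : Z d → E d}
    (h : IsLocalized w G H F) :
    ∃ (w' F' : ℕ → Z d → ℝ) (G' H' : ℕ → Z d → E d),
      (∀ n, ContDiff ℝ 1 (w' n) ∧ ContDiff ℝ 1 (G' n) ∧ ContDiff ℝ 1 (H' n) ∧ ContDiff ℝ 1 (F' n)) ∧
      (∃ K : Set (Z d), IsCompact K ∧ ∀ n z, z ∉ K →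
        w' n z = 0 ∧ G' n z = 0 ∧ H' n z = 0 ∧ F' n z = 0) ∧
      (∀ n z, 0 ≤ w' n z) ∧ (∀ n z e, velDeriv (w' n) z e = inner ℝ (G' n z) e) ∧
      (∀ n z, transport (w' n) z ≤ divV (H' n) z + F' n z) ∧
      ∃ D : Z d → ℝ, Integrable D ∧ ∀ᵐ z,
        (∀ n, w' n z ^ 2 ≤ D z ∧ ‖G' n z‖ ^ 2 ≤ D z ∧ ‖H' n z‖ ^ 2 ≤ D z ∧ F' n z ^ 2 ≤ D z) ∧
        Tendsto (fun n => w' n z) atTop (𝓝 (w z)) ∧ Tendsto (fun n => G' n z) atTop (𝓝 (G z)) ∧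
        Tendsto (fun n => H' n z) atTop (𝓝 (H z)) ∧ Tendsto (fun n => F' n z) atTop (𝓝 (F z)) := by
  obtain ⟨K, hK, hK0⟩ := h.compact
  -- The four functions are mollified as a single vector, so that one sequence of kernels and one
  -- majorant serve them all.
  set Y : Z d → ℝ × E d × E d × ℝ := fun z => (w z, G z, H z, F z) with hY
  have hYL : MemLp Y 2 :=
    memLp_prod_iff.2 ⟨h.memLp_fst, memLp_prod_iff.2 ⟨h.memLp_grad, memLp_prod_iff.2
      ⟨h.memLp_flux, h.memLp_rhs⟩⟩⟩
  have hY0 : ∀ z, z ∉ K → Y z = 0 := by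
    intro z hz
    obtain ⟨h1, h2, h3, h4⟩ := hK0 z hz
    simp [hY, h1, h2, h3, h4]
  have hYi : Integrable Y := by
    have h1 : IntegrableOn Y K := by
      have : IsFiniteMeasure (volume.restrict K) := ⟨by simpa using hK.measure_lt_top⟩
      exact (hYL.restrict K).integrable (by norm_num)
    exact (integrableOn_iff_integrable_of_support_subset fun y hy => by
      by_contra h; exact hy (hY0 y h)).1 h1
  have hwi : Integrable w := hYi.fst
  have hGi : Integrable G := hYi.snd.fst
  have hHi : Integrable H := hYi.snd.snd.fst
  have hFi : Integrable F := hYi.snd.snd.snd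
  obtain ⟨ρ, hρ, ⟨K', hK', hK'0⟩, D, hD, hconv⟩ := exists_mol_seq hYL hK hY0
  have hsplit : ∀ n z, mol (ρ n) Y z =
      (mol (ρ n) w z, mol (ρ n) G z, mol (ρ n) H z, mol (ρ n) F z) := by
    intro n z
    obtain ⟨hs, hc, -⟩ := hρ n
    refine Prod.ext ?_ (Prod.ext ?_ (Prod.ext ?_ ?_))
    · exact map_mol (ContinuousLinearMap.fst ℝ ℝ (E d × E d × ℝ)) hYi hs.continuous hc z
    · exact map_mol ((ContinuousLinearMap.fst ℝ (E d) (E d × ℝ)).comp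
        (ContinuousLinearMap.snd ℝ ℝ (E d × E d × ℝ))) hYi hs.continuous hc z
    · exact map_mol ((ContinuousLinearMap.fst ℝ (E d) ℝ).comp
        ((ContinuousLinearMap.snd ℝ (E d) (E d × ℝ)).comp
        (ContinuousLinearMap.snd ℝ ℝ (E d × E d × ℝ)))) hYi hs.continuous hc z
    · exact map_mol ((ContinuousLinearMap.snd ℝ (E d) ℝ).comp
        ((ContinuousLinearMap.snd ℝ (E d) (E d × ℝ)).comp
        (ContinuousLinearMap.snd ℝ ℝ (E d × E d × ℝ)))) hYi hs.continuous hc z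
  have hρ1 : ∀ n, ContDiff ℝ 1 (ρ n) := fun n => (hρ n).1.of_le (mod_cast le_top)
  refine ⟨fun n => mol (ρ n) w, fun n => mol (ρ n) F, fun n => mol (ρ n) G,
    fun n => mol (ρ n) H, fun n => ⟨?_, ?_, ?_, ?_⟩, ⟨K', hK', fun n z hz => ?_⟩, fun n z => ?_,
    fun n z => ?_, fun n z => ?_, D, hD, ?_⟩
  · exact continuous_mol hwi hK (fun y hy => (hK0 y hy).1) (hρ1 n)
  · exact continuous_mol hGi hK (fun y hy => (hK0 y hy).2.1) (hρ1 n)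
  · exact continuous_mol hHi hK (fun y hy => (hK0 y hy).2.2.1) (hρ1 n)
  · exact continuous_mol hFi hK (fun y hy => (hK0 y hy).2.2.2) (hρ1 n)
  · have := hK'0 n z hz
    rw [hsplit] at this
    simpa [Prod.ext_iff] using this
  · exact integral_nonneg fun y => mul_nonneg ((hρ n).2.2 _) (h.nonneg y)
  · exact (h.mol_spec hwi hGi hHi hFi (hρ n).1 (hρ n).2.1 (hρ n).2.2 z).1
  · exact (h.mol_spec hwi hGi hHi hFi (hρ n).1 (hρ n).2.1 (hρ n).2.2 z).2
  · filter_upwards [hconv] with z ⟨hz1, hz2⟩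
    simp only [hsplit] at hz1 hz2
    refine ⟨fun n => ?_, hz2.fst_nhds, hz2.snd_nhds.fst_nhds, hz2.snd_nhds.snd_nhds.fst_nhds,
      hz2.snd_nhds.snd_nhds.snd_nhds⟩
    have hle : ∀ a : ℝ, 0 ≤ a → a ≤ ‖(mol (ρ n) w z, mol (ρ n) G z, mol (ρ n) H z,
        mol (ρ n) F z)‖ → a ^ 2 ≤ D z := fun a ha hb =>
      (pow_le_pow_left₀ ha hb 2).trans (hz1 n)
    have e1 : ‖mol (ρ n) w z‖ ≤ _ := norm_fst_le (mol (ρ n) w z, mol (ρ n) G z, mol (ρ n) H z,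
        mol (ρ n) F z)
    have e2 := norm_snd_le (mol (ρ n) w z, mol (ρ n) G z, mol (ρ n) H z, mol (ρ n) F z)
    have e3 := norm_snd_le (mol (ρ n) G z, mol (ρ n) H z, mol (ρ n) F z)
    have e4 := norm_snd_le (mol (ρ n) H z, mol (ρ n) F z)
    have f2 := norm_fst_le (mol (ρ n) G z, mol (ρ n) H z, mol (ρ n) F z)
    have f3 := norm_fst_le (mol (ρ n) H z, mol (ρ n) F z)
    simp only at e2 e3 e4 f2 f3
    refine ⟨?_, hle _ (norm_nonneg _) (f2.trans e2), hle _ (norm_nonneg _)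
      (f3.trans (e3.trans e2)), ?_⟩
    · have := hle _ (norm_nonneg _) e1
      rwa [Real.norm_eq_abs, sq_abs] at this
    · have := hle _ (norm_nonneg _) (e4.trans (e3.trans e2))
      rwa [Real.norm_eq_abs, sq_abs] at this

end Localized

/-! ### The Poincaré inequality for weak subsolutions, and their localization. -/

section Weak

variable {d : ℕ}

/-- The kinetic Poincaré inequality for localized weak subsolutions. -/
theorem exists_poincare (d : ℕ) : ∃ C : ℝ, 0 < C ∧ ∀ r : ℝ, 0 < r →
    ∀ (w F : Z d → ℝ) (G H : Z d → E d), IsLocalized w G H F →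
    ∫ z, w z ^ 2 ≤ C / r ^ (4 * d + 2) * (∫ z, w z) ^ 2 +
      C * ∫ z, (r ^ 2 * |F z| + r * ‖G z‖ + r * ‖H z‖) ^ 2 := by
  obtain ⟨C, hC, hmain⟩ := exists_smooth_poincare d
  refine ⟨C, hC, fun r hr w F G H h => ?_⟩
  obtain ⟨w', F', G', H', hsm, ⟨K, hK, hK0⟩, hw0, hgrad, hle, D, hD, hconv⟩ :=
    h.exists_smooth_approx
  have hcs : ∀ {V : Type} [NormedAddCommGroup V] (f : ℕ → Z d → V),
      (∀ n z, z ∉ K → f n z = 0) → ∀ n, HasCompactSupport (f n) := fun f hf n =>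
    HasCompactSupport.intro hK (hf n)
  have hn : ∀ n, ∫ z, w' n z ^ 2 ≤ C / r ^ (4 * d + 2) * (∫ z, w' n z) ^ 2 +
      C * ∫ z, (r ^ 2 * |F' n z| + r * ‖G' n z‖ + r * ‖H' n z‖) ^ 2 := fun n =>
    hmain r hr (w' n) (F' n) (G' n) (H' n) (hsm n).1 (hsm n).2.1.continuous (hsm n).2.2.1
      (hsm n).2.2.2.continuous (hcs w' (fun n z hz => (hK0 n z hz).1) n)
      (hcs G' (fun n z hz => (hK0 n z hz).2.1) n) (hcs H' (fun n z hz => (hK0 n z hz).2.2.1) n)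
      (hcs F' (fun n z hz => (hK0 n z hz).2.2.2) n) (hw0 n) (hgrad n) (hle n)
  have hwc : ∀ n, Continuous (w' n) := fun n => (hsm n).1.continuous
  have hGc : ∀ n, Continuous (G' n) := fun n => (hsm n).2.1.continuous
  have hHc : ∀ n, Continuous (H' n) := fun n => (hsm n).2.2.1.continuous
  have hFc : ∀ n, Continuous (F' n) := fun n => (hsm n).2.2.2.continuous
  have t1 : Tendsto (fun n => ∫ z, w' n z ^ 2) atTop (𝓝 (∫ z, w z ^ 2)) := by
    refine tendsto_integral_of_dominated_convergence D
      (fun n => ((hwc n).pow 2).aestronglyMeasurable) hD (fun n => ?_) ?_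
    · filter_upwards [hconv] with z hz
      rw [Real.norm_of_nonneg (sq_nonneg _)]
      exact (hz.1 n).1
    · filter_upwards [hconv] with z hz
      exact hz.2.1.pow 2
  have t2 : Tendsto (fun n => ∫ z, w' n z) atTop (𝓝 (∫ z, w z)) := by
    -- The majorant controls squares only; s ≤ 1 + s² and the common compact support give a bound
    -- for the functions themselves.
    refine tendsto_integral_of_dominated_convergence (fun z => K.indicator 1 z + D z)
      (fun n => (hwc n).aestronglyMeasurable) (Integrable.add ?_ hD) (fun n => ?_) ?_
    · exact (integrable_indicator_iff hK.measurableSet).2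
        (integrableOn_const hK.measure_lt_top.ne)
    · filter_upwards [hconv] with z hz
      have h1 := (hz.1 n).1
      have h0 := hw0 n z
      rw [Real.norm_of_nonneg h0]
      by_cases hzK : z ∈ K
      · simp only [Set.indicator_of_mem hzK, Pi.one_apply]
        nlinarith [sq_nonneg (w' n z - 1)]
      · simp only [Set.indicator_of_notMem hzK]
        rw [(hK0 n z hzK).1] at h1 ⊢
        linarith
    · filter_upwards [hconv] with z hz
      exact hz.2.1
  have t3 : Tendsto (fun n => ∫ z, (r ^ 2 * |F' n z| + r * ‖G' n z‖ + r * ‖H' n z‖) ^ 2) atTop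
      (𝓝 (∫ z, (r ^ 2 * |F z| + r * ‖G z‖ + r * ‖H z‖) ^ 2)) := by
    refine tendsto_integral_of_dominated_convergence (fun z => (3 * (r ^ 4 + 2 * r ^ 2)) * D z)
      (fun n => (((continuous_const.mul (hFc n).abs).add (continuous_const.mul (hGc n).norm)).add
        (continuous_const.mul (hHc n).norm)).pow 2 |>.aestronglyMeasurable) (hD.const_mul _)
      (fun n => ?_) ?_
    · filter_upwards [hconv] with z hz
      obtain ⟨-, h2, h3, h4⟩ := hz.1 n
      rw [Real.norm_of_nonneg (sq_nonneg _)]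
      rw [← sq_abs] at h4
      have e : ∀ a b c : ℝ, (a + b + c) ^ 2 ≤ 3 * (a ^ 2 + b ^ 2 + c ^ 2) := fun a b c => by
        nlinarith [sq_nonneg (a - b), sq_nonneg (a - c), sq_nonneg (b - c)]
      refine (e _ _ _).trans ?_
      have k2 := mul_le_mul_of_nonneg_left h2 (sq_nonneg r)
      have k3 := mul_le_mul_of_nonneg_left h3 (sq_nonneg r)
      have k4 := mul_le_mul_of_nonneg_left h4 (by positivity : 0 ≤ r ^ 4)
      simp only [mul_pow]
      nlinarith
    · filter_upwards [hconv] with z hz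
      exact (((hz.2.2.2.2.abs.const_mul _).add (hz.2.2.1.norm.const_mul _)).add
        (hz.2.2.2.1.norm.const_mul _)).pow 2
  exact le_of_tendsto_of_tendsto' t1 (((t2.pow 2).const_mul _).add (t3.const_mul _)) hn

/-- Local square integrability on the whole space. -/
def LocL2 {V : Type*} [NormedAddCommGroup V] (f : Z d → V) : Prop :=
  ∀ K : Set (Z d), IsCompact K → MemLp f 2 (volume.restrict K)

theorem memLp_of_le_compact {V W : Type*} [NormedAddCommGroup V] [NormedAddCommGroup W]
    {f : Z d → V} (hf : LocL2 f) {F : Z d → W} {K : Set (Z d)} (hK : IsCompact K)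
    (hF0 : ∀ z, z ∉ K → F z = 0) (hFm : AEStronglyMeasurable F (volume.restrict K)) {C : ℝ}
    (hC : ∀ z ∈ K, ‖F z‖ ≤ C * ‖f z‖) : MemLp F 2 ∧ Integrable F := by
  have h1 : MemLp F 2 (volume.restrict K) := by
    refine MemLp.of_le_mul (hf K hK) hFm (c := C) ?_
    exact (ae_restrict_iff' hK.measurableSet).2 (Eventually.of_forall hC)
  have hind : F = K.indicator F := by
    funext z
    by_cases hz : z ∈ K
    · rw [Set.indicator_of_mem hz]
    · rw [Set.indicator_of_notMem hz, hF0 z hz]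
  constructor
  · rw [hind]
    exact (memLp_indicator_iff_restrict hK.measurableSet).2 h1
  · have : IsFiniteMeasure (volume.restrict K) := ⟨by simpa using hK.measure_lt_top⟩
    rw [hind, integrable_indicator_iff hK.measurableSet]
    exact h1.integrable (by norm_num)

theorem LocL2.smul_compact {V : Type*} [NormedAddCommGroup V] [NormedSpace ℝ V] {f : Z d → V}
    (hf : LocL2 f) {c : Z d → ℝ} (hc : Continuous c) (hcc : HasCompactSupport c) :
    MemLp (fun z => c z • f z) 2 ∧ Integrable (fun z => c z • f z) := by
  obtain ⟨C, hC⟩ := hcc.exists_bound_of_continuous hc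
  refine memLp_of_le_compact hf (K := tsupport c) hcc (fun z hz => ?_)
    (hc.aestronglyMeasurable.smul (hf _ hcc).aestronglyMeasurable) (C := C) fun z _ => ?_
  · simp [image_eq_zero_of_notMem_tsupport hz]
  · rw [norm_smul]
    gcongr
    exact hC z

theorem fderiv_eq_zero_of_notMem {φ : Z d → ℝ} {z : Z d} (hz : z ∉ tsupport φ) :
    fderiv ℝ φ z = 0 := by
  by_contra h
  exact hz (support_fderiv_subset ℝ h)

theorem LocL2.velDeriv_compact {h : Z d → E d} (hf : LocL2 h) {φ : Z d → ℝ}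
    (hφ : ContDiff ℝ 1 φ) (hφc : HasCompactSupport φ) :
    MemLp (fun z => velDeriv φ z (h z)) 2 ∧ Integrable (fun z => velDeriv φ z (h z)) := by
  have hfc : Continuous (fderiv ℝ φ) := hφ.continuous_fderiv one_ne_zero
  obtain ⟨C, hC⟩ := (hφc.fderiv (𝕜 := ℝ)).exists_bound_of_continuous hfc
  refine memLp_of_le_compact hf (K := tsupport φ) hφc (fun z hz => ?_) ?_ (C := C) fun z _ => ?_
  · simp [velDeriv, fderiv_eq_zero_of_notMem hz]
  · have hcont : Continuous fun p : (Z d →L[ℝ] ℝ) × E d => p.1 (0, 0, p.2) :=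
      continuous_fst.clm_apply (by fun_prop)
    exact hcont.comp_aestronglyMeasurable
      (hfc.aestronglyMeasurable.prodMk (hf _ hφc).aestronglyMeasurable)
  · refine ((fderiv ℝ φ z).le_opNorm _).trans ?_
    have : ‖((0, 0, h z) : Z d)‖ = ‖h z‖ := by simp [Prod.norm_def]
    rw [this]
    gcongr
    exact hC z

/-- The velocity gradient of a function. -/
noncomputable def velGrad (φ : Z d → ℝ) (z : Z d) : E d :=
  (InnerProductSpace.toDual ℝ (E d)).symm ((fderiv ℝ φ z).comp
    ((ContinuousLinearMap.inr ℝ ℝ (E d × E d)).comp (ContinuousLinearMap.inr ℝ (E d) (E d))))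

theorem inner_velGrad (φ : Z d → ℝ) (z : Z d) (e : E d) :
    inner ℝ (velGrad φ z) e = velDeriv φ z e := by
  rw [velGrad, InnerProductSpace.toDual_symm_apply]
  simp [velDeriv]

theorem continuous_velGrad {φ : Z d → ℝ} (hφ : ContDiff ℝ 1 φ) : Continuous (velGrad φ) := by
  unfold velGrad
  exact (LinearIsometryEquiv.continuous _).comp
    ((hφ.continuous_fderiv one_ne_zero).clm_comp continuous_const)

theorem continuous_transport {φ : Z d → ℝ} (hφ : ContDiff ℝ 1 φ) : Continuous (transport φ) := by
  unfold transport
  exact (hφ.continuous_fderiv one_ne_zero).clm_apply (by fun_prop)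

theorem continuous_velDeriv {φ : Z d → ℝ} (hφ : ContDiff ℝ 1 φ) (e : E d) :
    Continuous (fun z => velDeriv φ z e) := by
  unfold velDeriv
  exact (hφ.continuous_fderiv one_ne_zero).clm_apply continuous_const

theorem hasCompactSupport_transport {φ : Z d → ℝ} (hφ : HasCompactSupport φ) :
    HasCompactSupport (transport φ) :=
  HasCompactSupport.intro hφ fun z hz => by simp [transport, fderiv_eq_zero_of_notMem hz]

theorem hasCompactSupport_velDeriv {φ : Z d → ℝ} (hφ : HasCompactSupport φ) (e : E d) :
    HasCompactSupport (fun z => velDeriv φ z e) :=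
  HasCompactSupport.intro hφ fun z hz => by simp [velDeriv, fderiv_eq_zero_of_notMem hz]

theorem transport_mul {f φ : Z d → ℝ} (hf : ContDiff ℝ 1 f) (hφ : ContDiff ℝ 1 φ) (z : Z d) :
    transport (fun z => f z * φ z) z = f z * transport φ z + φ z * transport f z := by
  simp [transport, fderiv_fun_mul (hf.differentiable one_ne_zero z)
    (hφ.differentiable one_ne_zero z)]

theorem velDeriv_mul {f φ : Z d → ℝ} (hf : ContDiff ℝ 1 f) (hφ : ContDiff ℝ 1 φ) (z : Z d)
    (e : E d) :
    velDeriv (fun z => f z * φ z) z e = f z * velDeriv φ z e + φ z * velDeriv f z e := by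
  simp [velDeriv, fderiv_fun_mul (hf.differentiable one_ne_zero z)
    (hφ.differentiable one_ne_zero z)]

theorem velDeriv_smul (φ : Z d → ℝ) (z : Z d) (c : ℝ) (e : E d) :
    velDeriv φ z (c • e) = c * velDeriv φ z e := by
  rw [← inner_velGrad, ← inner_velGrad, inner_smul_right]

/-- A nonnegative weak subsolution for times larger than `τ`, with velocity gradient `g` and
flux `h`, of an equation with ellipticity constants `lam` and `Lam`. -/
structure IsSub (lam Lam τ : ℝ) (u : Z d → ℝ) (g h : Z d → E d) : Prop where
  nonneg : ∀ z, 0 ≤ u z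
  locL2_fst : LocL2 u
  locL2_grad : LocL2 g
  locL2_flux : LocL2 h
  lower : ∀ z, lam * ‖g z‖ ^ 2 ≤ inner ℝ (h z) (g z)
  upper : ∀ z, ‖h z‖ ^ 2 ≤ Lam * inner ℝ (h z) (g z)
  grad : ∀ φ : Z d → ℝ, ContDiff ℝ ∞ φ → HasCompactSupport φ → (∀ z ∈ tsupport φ, τ < z.1) →
    ∀ e : E d, ∫ z, u z * velDeriv φ z e = - ∫ z, inner ℝ (g z) e * φ z
  le : ∀ φ : Z d → ℝ, ContDiff ℝ ∞ φ → HasCompactSupport φ → (∀ z ∈ tsupport φ, τ < z.1) →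
    (∀ z, 0 ≤ φ z) → ∫ z, velDeriv φ z (h z) ≤ ∫ z, u z * transport φ z

/-- Testing with χφ is allowed because χ lives at times after τ. Derivatives that fall on χ in the
equation are collected in the source, so the product is a subsolution on the whole space. -/
theorem IsSub.localize {lam Lam τ : ℝ} {u : Z d → ℝ} {g h : Z d → E d}
    (hu : IsSub lam Lam τ u g h) {χ : Z d → ℝ} (hχ : ContDiff ℝ ∞ χ) (hχc : HasCompactSupport χ)
    (hχτ : ∀ z ∈ tsupport χ, τ < z.1) (hχ0 : ∀ z, 0 ≤ χ z) :
    IsLocalized (fun z => χ z * u z) (fun z => χ z • g z + u z • velGrad χ z)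
      (fun z => χ z • h z) (fun z => u z * transport χ z - velDeriv χ z (h z)) := by
  have hχ1 : ContDiff ℝ 1 χ := hχ.of_le (mod_cast le_top)
  have hvg : HasCompactSupport (velGrad χ) := HasCompactSupport.intro hχc fun z hz => by
    simp [velGrad, fderiv_eq_zero_of_notMem hz]
  have hvgc := continuous_velGrad hχ1
  have hTc := continuous_transport hχ1
  have hTs := hasCompactSupport_transport hχc
  have hvd := hu.locL2_flux.velDeriv_compact hχ1 hχc
  have hts : ∀ φ : Z d → ℝ, tsupport (fun z => χ z * φ z) ⊆ tsupport χ := fun φ =>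
    tsupport_mul_subset_left
  refine ⟨?_, ?_, ?_, ?_, ?_, ?_, ?_, ?_⟩
  · exact (hu.locL2_fst.smul_compact hχ1.continuous hχc).1
  · refine (hu.locL2_grad.smul_compact hχ1.continuous hχc).1.add ?_
    obtain ⟨C, hC⟩ := hvg.exists_bound_of_continuous hvgc
    refine (memLp_of_le_compact hu.locL2_fst (K := tsupport χ) hχc (fun z hz => ?_)
      ((hu.locL2_fst _ hχc).aestronglyMeasurable.smul hvgc.aestronglyMeasurable)
      (C := C) fun z _ => ?_).1
    · simp [velGrad, fderiv_eq_zero_of_notMem hz]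
    · change ‖u z • velGrad χ z‖ ≤ _
      rw [norm_smul, mul_comm]
      gcongr
      exact hC z
  · exact (hu.locL2_flux.smul_compact hχ1.continuous hχc).1
  · refine MemLp.sub ?_ hvd.1
    simpa [mul_comm] using (hu.locL2_fst.smul_compact hTc hTs).1
  · refine ⟨tsupport χ, hχc, fun z hz => ?_⟩
    simp [velGrad, velDeriv, transport, fderiv_eq_zero_of_notMem hz,
      image_eq_zero_of_notMem_tsupport hz]
  · exact fun z => mul_nonneg (hχ0 z) (hu.nonneg z)
  · intro φ hφ hφc e
    have hφ1 : ContDiff ℝ 1 φ := hφ.of_le (mod_cast le_top)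
    have h1 := hu.grad (fun z => χ z * φ z) (hχ.mul hφ) hχc.mul_right
      (fun z hz => hχτ z (hts φ hz)) e
    have i1 : Integrable fun z => χ z * velDeriv φ z e * u z :=
      (hu.locL2_fst.smul_compact (hχ1.continuous.mul (continuous_velDeriv hφ1 e)) hχc.mul_right).2
    have i2 : Integrable fun z => φ z * velDeriv χ z e * u z :=
      (hu.locL2_fst.smul_compact (hφ1.continuous.mul (continuous_velDeriv hχ1 e)) hφc.mul_right).2
    have i3 : Integrable fun z => inner ℝ (g z) e * (χ z * φ z) := by
      have := (hu.locL2_grad.smul_compact (hχ1.continuous.mul hφ1.continuous) hχc.mul_right).2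
      refine (((innerSL ℝ).flip e).integrable_comp this).congr (Eventually.of_forall fun z => ?_)
      simp only [ContinuousLinearMap.flip_apply, innerSL_apply_apply, inner_smul_left, conj_trivial, Pi.mul_apply]
      ring
    have e1 : ∫ z, u z * velDeriv (fun z => χ z * φ z) z e =
        (∫ z, χ z * velDeriv φ z e * u z) + ∫ z, φ z * velDeriv χ z e * u z := by
      rw [← integral_add i1 i2]
      refine integral_congr_ae (Eventually.of_forall fun z => ?_)
      simp only [velDeriv_mul hχ1 hφ1]
      ring
    have e2 : ∫ z, inner ℝ (χ z • g z + u z • velGrad χ z) e * φ z =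
        (∫ z, inner ℝ (g z) e * (χ z * φ z)) + ∫ z, φ z * velDeriv χ z e * u z := by
      rw [← integral_add i3 i2]
      refine integral_congr_ae (Eventually.of_forall fun z => ?_)
      simp only [inner_add_left, inner_smul_left, inner_velGrad, conj_trivial]
      ring
    have e3 : ∫ z, χ z * u z * velDeriv φ z e = ∫ z, χ z * velDeriv φ z e * u z :=
      integral_congr_ae (Eventually.of_forall fun z => by ring)
    rw [e3, e2]
    linarith
  · intro φ hφ hφc hφ0
    have hφ1 : ContDiff ℝ 1 φ := hφ.of_le (mod_cast le_top)
    have h1 := hu.le (fun z => χ z * φ z) (hχ.mul hφ) hχc.mul_right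
      (fun z hz => hχτ z (hts φ hz)) fun z => mul_nonneg (hχ0 z) (hφ0 z)
    have i1 : Integrable fun z => χ z * transport φ z * u z :=
      (hu.locL2_fst.smul_compact (hχ1.continuous.mul (continuous_transport hφ1)) hχc.mul_right).2
    have i2 : Integrable fun z => φ z * transport χ z * u z :=
      (hu.locL2_fst.smul_compact (hφ1.continuous.mul hTc) hφc.mul_right).2
    obtain ⟨B, hB⟩ := hφc.exists_bound_of_continuous hφ1.continuous
    obtain ⟨B', hB'⟩ := hχc.exists_bound_of_continuous hχ1.continuous
    have i3 : Integrable fun z => φ z * velDeriv χ z (h z) :=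
      hvd.2.bdd_mul hφ1.continuous.aestronglyMeasurable (Eventually.of_forall hB)
    have i4 : Integrable fun z => χ z * velDeriv φ z (h z) :=
      (hu.locL2_flux.velDeriv_compact hφ1 hφc).2.bdd_mul
        hχ1.continuous.aestronglyMeasurable (Eventually.of_forall hB')
    have i23 : Integrable fun z => φ z * transport χ z * u z - φ z * velDeriv χ z (h z) :=
      i2.sub i3
    have e1 : ∫ z, u z * transport (fun z => χ z * φ z) z =
        (∫ z, χ z * transport φ z * u z) + ∫ z, φ z * transport χ z * u z := by
      rw [← integral_add i1 i2]
      refine integral_congr_ae (Eventually.of_forall fun z => ?_)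
      simp only [transport_mul hχ1 hφ1]
      ring
    have e2 : ∫ z, velDeriv (fun z => χ z * φ z) z (h z) =
        (∫ z, χ z * velDeriv φ z (h z)) + ∫ z, φ z * velDeriv χ z (h z) := by
      rw [← integral_add i4 i3]
      refine integral_congr_ae (Eventually.of_forall fun z => ?_)
      simp only [velDeriv_mul hχ1 hφ1]
    have e3 : ∫ z, ((u z * transport χ z - velDeriv χ z (h z)) * φ z -
        velDeriv φ z (χ z • h z)) = (∫ z, φ z * transport χ z * u z) -
        (∫ z, φ z * velDeriv χ z (h z)) - ∫ z, χ z * velDeriv φ z (h z) := by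
      rw [← integral_sub i2 i3, ← integral_sub i23 i4]
      refine integral_congr_ae (Eventually.of_forall fun z => ?_)
      simp only [velDeriv_smul]
      ring
    have e4 : ∫ z, χ z * u z * transport φ z = ∫ z, χ z * transport φ z * u z :=
      integral_congr_ae (Eventually.of_forall fun z => by ring)
    rw [e3, e4]
    linarith

end Weak

/-! ### The chain rule for weak subsolutions. -/

section Chain

variable {d : ℕ}

theorem integral_fderiv_eq_zero {ψ : Z d → ℝ} (hψ : ContDiff ℝ 1 ψ) (hc : HasCompactSupport ψ)
    (e : Z d) : ∫ z, fderiv ℝ ψ z e = 0 := by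
  have hcont : Continuous fun z => fderiv ℝ ψ z e :=
    (hψ.continuous_fderiv one_ne_zero).clm_apply continuous_const
  have hs : HasCompactSupport fun z => fderiv ℝ ψ z e := hc.fderiv_apply (𝕜 := ℝ) e
  have h := integral_mul_fderiv_eq_neg_fderiv_mul_of_integrable (μ := (volume : Measure (Z d)))
    (f := fun _ => (1 : ℝ)) (g := ψ) (v := e) (by simp)
    (by simpa using hcont.integrable_of_hasCompactSupport hs)
    (by simpa using hψ.continuous.integrable_of_hasCompactSupport hc)
    (fun x _ => differentiableAt_const _) (fun x _ => hψ.differentiable one_ne_zero x)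
  simpa using h

/-- The field (1, v, 0) is divergence free, since each coefficient v_i is independent of x_i. -/
theorem integral_transport_eq_zero {ψ : Z d → ℝ} (hψ : ContDiff ℝ 1 ψ)
    (hc : HasCompactSupport ψ) : ∫ z, transport ψ z = 0 := by
  have hfd : ∀ e : Z d, Continuous fun z => fderiv ℝ ψ z e := fun e =>
    (hψ.continuous_fderiv one_ne_zero).clm_apply continuous_const
  have hcf : ∀ e : Z d, HasCompactSupport fun z => fderiv ℝ ψ z e := fun e =>
    hc.fderiv_apply (𝕜 := ℝ) e
  have hv : ∀ i : Fin d, ContDiff ℝ 1 fun z : Z d => z.2.2 i := fun i => by fun_prop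
  have hs : ∀ z : Z d, transport ψ z = fderiv ℝ ψ z (1, 0, 0) +
      ∑ i, z.2.2 i * fderiv ℝ ψ z (0, EuclideanSpace.single i 1, 0) := by
    intro z
    have he : ((1, z.2.2, 0) : Z d) = (1, 0, 0) +
        ∑ i, z.2.2 i • ((0, EuclideanSpace.single i 1, 0) : Z d) := by
      refine Prod.ext ?_ (Prod.ext ?_ ?_)
      · simp [Prod.fst_sum]
      · simp only [Prod.snd_add, Prod.fst_add, Prod.snd_sum, Prod.fst_sum, Prod.smul_snd,
          Prod.smul_fst, zero_add]
        ext j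
        simp [Finset.sum_apply, Pi.single_apply]
      · simp [Prod.snd_sum]
    rw [transport, he, map_add, map_sum]
    simp only [map_smul, smul_eq_mul]
  have hi : ∀ i : Fin d, Integrable fun z : Z d =>
      z.2.2 i * fderiv ℝ ψ z (0, EuclideanSpace.single i 1, 0) := fun i =>
    ((hv i).continuous.mul (hfd _)).integrable_of_hasCompactSupport ((hcf _).mul_left)
  have hz : ∀ i : Fin d,
      ∫ z : Z d, z.2.2 i * fderiv ℝ ψ z (0, EuclideanSpace.single i 1, 0) = 0 := by
    intro i
    have h := integral_fderiv_eq_zero ((hv i).mul hψ) (hc.mul_left)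
      (0, EuclideanSpace.single i 1, 0)
    refine Eq.trans (integral_congr_ae (Eventually.of_forall fun z => ?_)) h
    have hd : fderiv ℝ (fun z : Z d => z.2.2 i) z (0, EuclideanSpace.single i 1, 0) = 0 := by
      have : (fun z : Z d => z.2.2 i) = ((EuclideanSpace.proj (𝕜 := ℝ) i).comp
        ((ContinuousLinearMap.snd ℝ (E d) (E d)).comp
          (ContinuousLinearMap.snd ℝ ℝ (E d × E d))) : Z d →L[ℝ] ℝ) := rfl
      rw [this, ContinuousLinearMap.fderiv]
      simp
    simp [fderiv_fun_mul ((hv i).differentiable one_ne_zero z)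
      (hψ.differentiable one_ne_zero z), hd]
  simp_rw [hs]
  rw [integral_add ((hfd _).integrable_of_hasCompactSupport (hcf _))
    (integrable_finsetSum _ fun i _ => hi i), integral_finsetSum _ fun i _ => hi i,
    integral_fderiv_eq_zero hψ hc]
  simp [hz]

theorem integral_divV_mul {H : Z d → E d} (hH : ContDiff ℝ 1 H) {φ : Z d → ℝ}
    (hφ : ContDiff ℝ 1 φ) (hc : HasCompactSupport φ) :
    ∫ z, (divV H z * φ z + velDeriv φ z (H z)) = 0 := by
  have hHi : ∀ i : Fin d, ContDiff ℝ 1 fun z => H z i := fun i =>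
    (EuclideanSpace.proj (𝕜 := ℝ) i).contDiff.comp hH
  have hd : ∀ (i : Fin d) (z e : Z d), fderiv ℝ (fun z => H z i) z e = fderiv ℝ H z e i := by
    intro i z e
    have h1 := ((EuclideanSpace.proj (𝕜 := ℝ) i : E d →L[ℝ] ℝ).hasFDerivAt.comp z
      (hH.differentiable one_ne_zero z).hasFDerivAt).fderiv
    have h2 : fderiv ℝ (fun z => H z i) z =
      (EuclideanSpace.proj (𝕜 := ℝ) i : E d →L[ℝ] ℝ).comp (fderiv ℝ H z) := h1
    rw [h2]
    rfl
  have hs : ∀ z, divV H z * φ z + velDeriv φ z (H z) =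
      ∑ i, fderiv ℝ (fun z => H z i * φ z) z (0, 0, EuclideanSpace.single i 1) := by
    intro z
    rw [velDeriv_eq_sum, divV, Finset.sum_mul, ← Finset.sum_add_distrib]
    refine Finset.sum_congr rfl fun i _ => ?_
    rw [fderiv_fun_mul ((hHi i).differentiable one_ne_zero z)
      (hφ.differentiable one_ne_zero z)]
    simp [hd, velDeriv]
    ring
  simp_rw [hs]
  rw [integral_finsetSum]
  · exact Finset.sum_eq_zero fun i _ => integral_fderiv_eq_zero ((hHi i).mul hφ) hc.mul_left _
  · intro i _
    exact (((hHi i).mul hφ).continuous_fderiv one_ne_zero |>.clm_apply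
      continuous_const).integrable_of_hasCompactSupport (hc.mul_left.fderiv_apply (𝕜 := ℝ) _)

theorem contDiff_one_of_hasDerivAt {b b1 : ℝ → ℝ} (hb : ∀ s, HasDerivAt b (b1 s) s)
    (h1 : Continuous b1) : ContDiff ℝ 1 b := by
  refine contDiff_one_iff_deriv.2 ⟨fun s => (hb s).differentiableAt, ?_⟩
  rwa [funext fun s => (hb s).deriv]

theorem fderiv_comp_real {b b1 : ℝ → ℝ} (hb : ∀ s, HasDerivAt b (b1 s) s) {w : Z d → ℝ}
    (hw : ContDiff ℝ 1 w) (z e : Z d) :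
    fderiv ℝ (fun z => b (w z)) z e = b1 (w z) * fderiv ℝ w z e := by
  have := ((hb (w z)).comp_hasFDerivAt z (hw.differentiable one_ne_zero z).hasFDerivAt).fderiv
  have h2 : fderiv ℝ (fun z => b (w z)) z = b1 (w z) • fderiv ℝ w z := this
  rw [h2]
  simp

theorem smooth_chain_grad {b b1 : ℝ → ℝ} (hb : ∀ s, HasDerivAt b (b1 s) s)
    (hb1 : Continuous b1) {w : Z d → ℝ} {G : Z d → E d} (hw : ContDiff ℝ 1 w)
    (hG : ∀ z e, velDeriv w z e = inner ℝ (G z) e) {φ : Z d → ℝ} (hφ : ContDiff ℝ 1 φ)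
    (hc : HasCompactSupport φ) (e : E d) :
    ∫ z, (b (w z) * velDeriv φ z e + b1 (w z) * inner ℝ (G z) e * φ z) = 0 := by
  have hbw : ContDiff ℝ 1 fun z => b (w z) := (contDiff_one_of_hasDerivAt hb hb1).comp hw
  rw [← integral_fderiv_eq_zero (hbw.mul hφ) hc.mul_left (0, 0, e)]
  refine integral_congr_ae (Eventually.of_forall fun z => ?_)
  have h := velDeriv_mul hbw hφ z e
  simp only [velDeriv] at h hG ⊢
  rw [h, fderiv_comp_real hb hw, hG]
  ring

/-- The pointwise inequality is multiplied by b'(w)φ ≥ 0 and integrated by parts. The flux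
divergence then produces the term b''(w) G·H φ. Only monotonicity of b on [0, ∞) is used; convexity
is not. -/
theorem smooth_chain_le {b b1 b2 : ℝ → ℝ} (hb : ∀ s, HasDerivAt b (b1 s) s)
    (hb1 : ∀ s, HasDerivAt b1 (b2 s) s) (hb2 : Continuous b2) (hpos : ∀ s, 0 ≤ s → 0 ≤ b1 s)
    {w F : Z d → ℝ} {G H : Z d → E d} (hw : ContDiff ℝ 1 w) (hH : ContDiff ℝ 1 H)
    (hGc : Continuous G) (hF : Continuous F) (hw0 : ∀ z, 0 ≤ w z)
    (hG : ∀ z e, velDeriv w z e = inner ℝ (G z) e)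
    (hle : ∀ z, transport w z ≤ divV H z + F z) {φ : Z d → ℝ} (hφ : ContDiff ℝ 1 φ)
    (hc : HasCompactSupport φ) (hφ0 : ∀ z, 0 ≤ φ z) :
    ∫ z, (b2 (w z) * inner ℝ (G z) (H z) * φ z + b1 (w z) * velDeriv φ z (H z) -
      b1 (w z) * F z * φ z - b (w z) * transport φ z) ≤ 0 := by
  have hb1c : Continuous b1 := continuous_iff_continuousAt.2 fun s => (hb1 s).continuousAt
  have hbw : ContDiff ℝ 1 fun z => b (w z) := (contDiff_one_of_hasDerivAt hb hb1c).comp hw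
  have hbw1 : ContDiff ℝ 1 fun z => b1 (w z) := (contDiff_one_of_hasDerivAt hb1 hb2).comp hw
  have hT := integral_transport_eq_zero (hbw.mul hφ) hc.mul_left
  have hD := integral_divV_mul hH (hbw1.mul hφ) hc.mul_left
  set ψ : Z d → ℝ := fun z => b1 (w z) * φ z with hψ
  have hψ1 : ContDiff ℝ 1 ψ := hbw1.mul hφ
  have hψc : HasCompactSupport ψ := hc.mul_left
  have hvc : Continuous fun z => velDeriv ψ z (H z) :=
    (hψ1.continuous_fderiv one_ne_zero).clm_apply
      (continuous_const.prodMk (continuous_const.prodMk hH.continuous))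
  have hvcφ : Continuous fun z => velDeriv φ z (H z) :=
    (hφ.continuous_fderiv one_ne_zero).clm_apply
      (continuous_const.prodMk (continuous_const.prodMk hH.continuous))
  have hvs : HasCompactSupport fun z => velDeriv φ z (H z) :=
    HasCompactSupport.intro hc fun z hz => by simp [velDeriv, fderiv_eq_zero_of_notMem hz]
  have i1 : Integrable fun z => divV H z * ψ z + velDeriv ψ z (H z) := by
    refine ((continuous_divV hH).mul hψ1.continuous |>.add hvc).integrable_of_hasCompactSupport
      (HasCompactSupport.intro hψc fun z hz => ?_)
    simp [velDeriv, fderiv_eq_zero_of_notMem hz, image_eq_zero_of_notMem_tsupport hz]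
  have i2 : Integrable (transport (fun z => b (w z) * φ z)) :=
    (continuous_transport (hbw.mul hφ)).integrable_of_hasCompactSupport
      (hasCompactSupport_transport hc.mul_left)
  have i3 : Integrable fun z => (divV H z * ψ z + velDeriv ψ z (H z)) -
    transport (fun z => b (w z) * φ z) z := i1.sub i2
  have hz : ∫ z, ((divV H z * ψ z + velDeriv ψ z (H z)) -
      transport (fun z => b (w z) * φ z) z) = 0 := by
    rw [integral_sub i1 i2, hD]
    have : ∫ z, transport (fun z => b (w z) * φ z) z = 0 := hT
    rw [this, sub_zero]
  rw [← hz]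
  refine integral_mono ?_ i3 fun z => ?_
  · refine Continuous.integrable_of_hasCompactSupport ?_
      (HasCompactSupport.intro hc fun z hz => ?_)
    · exact (((((hb2.comp hw.continuous).mul (hGc.inner hH.continuous)).mul hφ.continuous).add
        (hbw1.continuous.mul hvcφ)).sub ((hbw1.continuous.mul hF).mul hφ.continuous)).sub
        (hbw.continuous.mul (continuous_transport hφ))
    · simp [velDeriv, transport, fderiv_eq_zero_of_notMem hz, image_eq_zero_of_notMem_tsupport hz]
  · have e1 : velDeriv ψ z (H z) = b1 (w z) * velDeriv φ z (H z) +
        φ z * (b2 (w z) * inner ℝ (G z) (H z)) := by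
      rw [hψ, velDeriv_mul hbw1 hφ, ← hG]
      simp only [velDeriv]
      rw [fderiv_comp_real hb1 hw]
    have e2 : transport (fun z => b (w z) * φ z) z = b (w z) * transport φ z +
        φ z * (b1 (w z) * transport w z) := by
      rw [transport_mul hbw hφ]
      simp only [transport]
      rw [fderiv_comp_real hb hw]
    simp only
    rw [e1, e2]
    have := mul_le_mul_of_nonneg_left (hle z)
      (mul_nonneg (hφ0 z) (hpos _ (hw0 z)))
    simp only [hψ]
    linarith

/-- Dominated convergence for integrands supported in a fixed compact set. -/
theorem tendsto_integral_cutoff {K : Set (Z d)} (hK : IsCompact K) {D : Z d → ℝ}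
    (hD : Integrable D) {q : ℕ → Z d → ℝ} {p : Z d → ℝ}
    (hq : ∀ n, Continuous (q n)) {B : ℝ} (hB : ∀ᵐ z, ∀ n, |q n z| ≤ B * (K.indicator 1 z + D z))
    (hlim : ∀ᵐ z, Tendsto (fun n => q n z) atTop (𝓝 (p z))) :
    Integrable p ∧ Tendsto (fun n => ∫ z, q n z) atTop (𝓝 (∫ z, p z)) := by
  have hKi : Integrable (K.indicator (1 : Z d → ℝ)) :=
    (integrable_indicator_iff hK.measurableSet).2 (integrableOn_const hK.measure_lt_top.ne)
  have hdom : Integrable fun z => B * (K.indicator 1 z + D z) := (hKi.add hD).const_mul B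
  refine ⟨hdom.mono' (aestronglyMeasurable_of_tendsto_ae atTop
    (fun n => (hq n).aestronglyMeasurable) hlim) ?_, ?_⟩
  · filter_upwards [hB, hlim] with z h1 h2
    exact le_of_tendsto' h2.norm h1
  · exact tendsto_integral_of_dominated_convergence _ (fun n => (hq n).aestronglyMeasurable) hdom
      (fun n => by filter_upwards [hB] with z hz using hz n) hlim

/-- A smooth compactly supported cutoff with values in `[0, 1]` that equals one on a compact set. -/
theorem exists_cutoff {K U : Set (Z d)} (hK : IsCompact K) (hU : IsOpen U) (hKU : K ⊆ U) :
    ∃ χ : Z d → ℝ, ContDiff ℝ ∞ χ ∧ HasCompactSupport χ ∧ tsupport χ ⊆ U ∧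
      (∀ z, 0 ≤ χ z) ∧ ∀ z ∈ K, χ z = 1 ∧ fderiv ℝ χ z = 0 := by
  obtain ⟨L, hL, hKL, hLU⟩ := exists_compact_between hK hU hKU
  obtain ⟨χ, h0, h1, h2⟩ := exists_contMDiffMap_zero_one_of_isClosed (n := ⊤)
    (modelWithCornersSelf ℝ (Z d)) (s := (interior L)ᶜ) (t := K) isOpen_interior.isClosed_compl
    hK.isClosed (Set.disjoint_compl_left_iff_subset.2 hKL)
  have hts : tsupport χ ⊆ L := closure_minimal (fun z hz => by
    by_contra h
    exact hz (h0 fun h' => h (interior_subset h'))) hL.isClosed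
  refine ⟨χ, contMDiff_iff_contDiff.1 χ.contMDiff,
    hL.of_isClosed_subset isClosed_closure hts, hts.trans hLU, fun z => (h2 z).1,
    fun z hz => ⟨h1 hz, ?_⟩⟩
  -- On K the cutoff attains its maximal value one, so its derivative vanishes even at boundary
  -- points of K.
  refine IsLocalMax.fderiv_eq_zero (Eventually.of_forall fun y => ?_)
  have : χ z = 1 := h1 hz
  rw [this]
  exact (h2 y).2

/-- A subsolution has no regularity in t and x, so b'(u)φ is not an admissible test function. The
identity is proved instead for the smooth approximations of χu, with χ = 1 on the support of φ, and
passed to the limit. The growth conditions make every term at most quadratic, hence dominated. The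
source of the localized equation disappears in the limit because the derivatives of χ vanish on the
support of φ. -/
theorem IsSub.chain {lam Lam τ : ℝ} {u : Z d → ℝ} {g h : Z d → E d}
    (hu : IsSub lam Lam τ u g h) {b b1 b2 : ℝ → ℝ} (hb : ∀ s, HasDerivAt b (b1 s) s)
    (hb1 : ∀ s, HasDerivAt b1 (b2 s) s) (hb2 : Continuous b2) (hpos : ∀ s, 0 ≤ s → 0 ≤ b1 s)
    {M : ℝ} (hM : ∀ s, |b s| ≤ M * (1 + s ^ 2)) (hM1 : ∀ s, |b1 s| ≤ M * (1 + |s|))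
    (hM2 : ∀ s, |b2 s| ≤ M) {φ : Z d → ℝ} (hφ : ContDiff ℝ ∞ φ) (hc : HasCompactSupport φ)
    (hφτ : ∀ z ∈ tsupport φ, τ < z.1) :
    (∀ e, ∫ z, (b (u z) * velDeriv φ z e + b1 (u z) * inner ℝ (g z) e * φ z) = 0 ∧
      Integrable fun z => b (u z) * velDeriv φ z e + b1 (u z) * inner ℝ (g z) e * φ z) ∧
    ((∀ z, 0 ≤ φ z) →
      ∫ z, (b2 (u z) * inner ℝ (g z) (h z) * φ z + b1 (u z) * velDeriv φ z (h z) -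
        b (u z) * transport φ z) ≤ 0 ∧
      Integrable fun z => b2 (u z) * inner ℝ (g z) (h z) * φ z + b1 (u z) * velDeriv φ z (h z) -
        b (u z) * transport φ z) := by
  have hφ1 : ContDiff ℝ 1 φ := hφ.of_le (mod_cast le_top)
  have hb1c : Continuous b1 := continuous_iff_continuousAt.2 fun s => (hb1 s).continuousAt
  have hbc : Continuous b := continuous_iff_continuousAt.2 fun s => (hb s).continuousAt
  have hM0 : 0 ≤ M := (abs_nonneg _).trans (hM2 0)
  obtain ⟨χ, hχ, hχc, hχU, hχ0, hχK⟩ := exists_cutoff (U := {z : Z d | τ < z.1}) hc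
    (isOpen_lt continuous_const continuous_fst) hφτ
  obtain ⟨w, F, G, H, hsm, -, hw0, hgrad, hle, D, hD, hconv⟩ :=
    (hu.localize hχ hχc hχU hχ0).exists_smooth_approx
  have hwc : ∀ n, Continuous (w n) := fun n => (hsm n).1.continuous
  have hGc : ∀ n, Continuous (G n) := fun n => (hsm n).2.1.continuous
  have hHc : ∀ n, Continuous (H n) := fun n => (hsm n).2.2.1.continuous
  have hFc : ∀ n, Continuous (F n) := fun n => (hsm n).2.2.2.continuous
  set K := tsupport φ with hKdef
  have hzero : ∀ z, z ∉ K → φ z = 0 ∧ fderiv ℝ φ z = 0 := fun z hz =>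
    ⟨image_eq_zero_of_notMem_tsupport hz, fderiv_eq_zero_of_notMem hz⟩
  have hlimK : ∀ᵐ z, (0 ≤ D z) ∧ (z ∈ K → Tendsto (fun n => w n z) atTop (𝓝 (u z)) ∧
      Tendsto (fun n => G n z) atTop (𝓝 (g z)) ∧ Tendsto (fun n => H n z) atTop (𝓝 (h z)) ∧
      Tendsto (fun n => F n z) atTop (𝓝 0)) := by
    filter_upwards [hconv] with z ⟨h1, h2, h3, h4, h5⟩
    refine ⟨(sq_nonneg _).trans (h1 0).1, fun hz => ?_⟩
    obtain ⟨e1, e2⟩ := hχK z hz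
    simp only [e1, one_mul, one_smul, velGrad, velDeriv, transport, e2] at h2 h3 h4 h5
    simp at h3 h5
    exact ⟨h2, h3, h4, h5⟩
  obtain ⟨B0, hB0⟩ := hc.exists_bound_of_continuous hφ1.continuous
  obtain ⟨B1, hB1⟩ := (hc.fderiv (𝕜 := ℝ)).exists_bound_of_continuous
    (hφ1.continuous_fderiv one_ne_zero)
  obtain ⟨B2, hB2⟩ := (hasCompactSupport_transport hc).exists_bound_of_continuous
    (continuous_transport hφ1)
  have hB0' : 0 ≤ B0 := (norm_nonneg _).trans (hB0 0)
  have hB1' : 0 ≤ B1 := (norm_nonneg _).trans (hB1 0)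
  have hB2' : 0 ≤ B2 := (norm_nonneg _).trans (hB2 0)
  have hvd : ∀ z e, |velDeriv φ z e| ≤ B1 * ‖e‖ := fun z e => by
    refine ((fderiv ℝ φ z).le_opNorm _).trans ?_
    have : ‖((0, 0, e) : Z d)‖ = ‖e‖ := by simp [Prod.norm_def]
    rw [this]
    exact mul_le_mul_of_nonneg_right (hB1 z) (norm_nonneg _)
  have hvdc : ∀ {X : Z d → E d}, Continuous X → Continuous fun z => velDeriv φ z (X z) :=
    fun hX => (hφ1.continuous_fderiv one_ne_zero).clm_apply
      (continuous_const.prodMk (continuous_const.prodMk hX))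
  constructor
  · intro e
    have key := tendsto_integral_cutoff hc hD
      (q := fun n z => b (w n z) * velDeriv φ z e + b1 (w n z) * inner ℝ (G n z) e * φ z)
      (p := fun z => b (u z) * velDeriv φ z e + b1 (u z) * inner ℝ (g z) e * φ z)
      (fun n => ((hbc.comp (hwc n)).mul (continuous_velDeriv hφ1 e)).add
        (((hb1c.comp (hwc n)).mul ((hGc n).inner continuous_const)).mul hφ1.continuous))
      (B := M * (B1 * ‖e‖) + 2 * M * ‖e‖ * B0) ?_ ?_
    · refine ⟨tendsto_nhds_unique key.2 ?_, key.1⟩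
      simp_rw [smooth_chain_grad hb hb1c (hsm _).1 (hgrad _) hφ1 hc e]
      exact tendsto_const_nhds
    · filter_upwards [hconv, hlimK] with z ⟨hz, _⟩ ⟨hD0, _⟩ n
      by_cases hzK : z ∈ K
      · obtain ⟨h1, h2, h3, h4⟩ := hz n
        rw [Set.indicator_of_mem hzK, Pi.one_apply]
        have a1 : |b (w n z) * velDeriv φ z e| ≤ M * (1 + D z) * (B1 * ‖e‖) := by
          rw [abs_mul]
          refine mul_le_mul ((hM _).trans ?_) (hvd z e) (abs_nonneg _) (by positivity)
          gcongr
        have a2 : |b1 (w n z) * inner ℝ (G n z) e * φ z| ≤ (2 * M * (1 + D z)) * ‖e‖ * B0 := by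
          rw [abs_mul, abs_mul]
          refine mul_le_mul ?_ (hB0 z) (abs_nonneg _) (by positivity)
          refine (mul_le_mul (hM1 _) (abs_real_inner_le_norm _ _) (abs_nonneg _)
            (by positivity)).trans ?_
          rw [← mul_assoc]
          refine mul_le_mul_of_nonneg_right ?_ (norm_nonneg _)
          rw [← sq_abs] at h1
          have : (1 + |w n z|) * ‖G n z‖ ≤ 2 * (1 + D z) := by
            nlinarith [sq_nonneg (1 - |w n z|), sq_nonneg (1 + |w n z| - ‖G n z‖)]
          nlinarith
        refine (abs_add_le _ _).trans ((add_le_add a1 a2).trans (le_of_eq ?_))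
        ring
      · obtain ⟨e1, e2⟩ := hzero z hzK
        simp only [velDeriv, e1, e2]
        rw [Set.indicator_of_notMem hzK]
        simp
        positivity
    · filter_upwards [hlimK] with z ⟨_, hz⟩
      by_cases hzK : z ∈ K
      · obtain ⟨h1, h2, -, -⟩ := hz hzK
        exact (((hbc.tendsto _).comp h1).mul_const _).add
          ((((hb1c.tendsto _).comp h1).mul (h2.inner tendsto_const_nhds)).mul_const _)
      · obtain ⟨e1, e2⟩ := hzero z hzK
        simp [velDeriv, e1, e2]
  · intro hφ0
    have key := tendsto_integral_cutoff hc hD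
      (q := fun n z => b2 (w n z) * inner ℝ (G n z) (H n z) * φ z +
        b1 (w n z) * velDeriv φ z (H n z) - b1 (w n z) * F n z * φ z - b (w n z) * transport φ z)
      (p := fun z => b2 (u z) * inner ℝ (g z) (h z) * φ z + b1 (u z) * velDeriv φ z (h z) -
        b (u z) * transport φ z)
      (fun n => (((((hb2.comp (hwc n)).mul ((hGc n).inner (hHc n))).mul hφ1.continuous).add
        ((hb1c.comp (hwc n)).mul (hvdc (hHc n)))).sub
        (((hb1c.comp (hwc n)).mul (hFc n)).mul hφ1.continuous)).sub
        ((hbc.comp (hwc n)).mul (continuous_transport hφ1)))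
      (B := M * B0 + 2 * M * B1 + 2 * M * B0 + M * B2) ?_ ?_
    · exact ⟨le_of_tendsto' key.2 fun n => smooth_chain_le hb hb1 hb2 hpos (hsm n).1 (hsm n).2.2.1
        (hGc n) (hFc n) (hw0 n) (hgrad n) (hle n) hφ1 hc hφ0, key.1⟩
    · filter_upwards [hconv, hlimK] with z ⟨hz, _⟩ ⟨hD0, _⟩ n
      by_cases hzK : z ∈ K
      · obtain ⟨h1, h2, h3, h4⟩ := hz n
        rw [Set.indicator_of_mem hzK, Pi.one_apply]
        have hw2 : |w n z| ^ 2 ≤ D z := by rwa [sq_abs]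
        have hF2 : |F n z| ^ 2 ≤ D z := by rwa [sq_abs]
        have hgen : ∀ y : ℝ, y ^ 2 ≤ D z → |b1 (w n z)| * y ≤ 2 * M * (1 + D z) ∨ y < 0 := by
          intro y hy
          rcases lt_or_ge y 0 with h0 | h0
          · exact Or.inr h0
          left
          refine (mul_le_mul_of_nonneg_right (hM1 _) h0).trans ?_
          have : (1 + |w n z|) * y ≤ 2 * (1 + D z) := by
            nlinarith [sq_nonneg (1 - |w n z|), sq_nonneg (1 + |w n z| - y)]
          nlinarith
        have a1 : |b2 (w n z) * inner ℝ (G n z) (H n z) * φ z| ≤ M * (1 + D z) * B0 := by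
          rw [abs_mul, abs_mul]
          refine mul_le_mul ?_ (hB0 z) (abs_nonneg _) (by positivity)
          refine mul_le_mul (hM2 _) ((abs_real_inner_le_norm _ _).trans ?_) (abs_nonneg _) hM0
          nlinarith [sq_nonneg (‖G n z‖ - ‖H n z‖)]
        have a2 : |b1 (w n z) * velDeriv φ z (H n z)| ≤ 2 * M * (1 + D z) * B1 := by
          rw [abs_mul]
          refine (mul_le_mul_of_nonneg_left (hvd z _) (abs_nonneg _)).trans ?_
          have := (hgen _ h3).resolve_right (norm_nonneg _).not_gt
          calc |b1 (w n z)| * (B1 * ‖H n z‖) = (|b1 (w n z)| * ‖H n z‖) * B1 := by ring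
            _ ≤ _ := by gcongr
        have a3 : |b1 (w n z) * F n z * φ z| ≤ 2 * M * (1 + D z) * B0 := by
          rw [abs_mul, abs_mul]
          exact mul_le_mul ((hgen _ hF2).resolve_right (abs_nonneg _).not_gt) (hB0 z)
            (abs_nonneg _) (by positivity)
        have a4 : |b (w n z) * transport φ z| ≤ M * (1 + D z) * B2 := by
          rw [abs_mul]
          refine mul_le_mul ((hM _).trans ?_) (hB2 z) (abs_nonneg _) (by positivity)
          gcongr
        refine (abs_sub _ _).trans ((add_le_add ((abs_sub _ _).trans (add_le_add
          ((abs_add_le _ _).trans (add_le_add a1 a2)) a3)) a4).trans (le_of_eq ?_))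
        ring
      · obtain ⟨e1, e2⟩ := hzero z hzK
        simp only [velDeriv, transport, e1, e2]
        rw [Set.indicator_of_notMem hzK]
        simp
        positivity
    · filter_upwards [hlimK] with z ⟨_, hz⟩
      by_cases hzK : z ∈ K
      · obtain ⟨h1, h2, h3, h4⟩ := hz hzK
        have hv : Tendsto (fun n => velDeriv φ z (H n z)) atTop (𝓝 (velDeriv φ z (h z))) := by
          simp only [← inner_velGrad]
          exact tendsto_const_nhds.inner h3
        have := ((((((hb2.tendsto _).comp h1).mul (h2.inner h3)).mul_const (φ z)).add
          (((hb1c.tendsto _).comp h1).mul hv)).sub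
          ((((hb1c.tendsto _).comp h1).mul h4).mul_const (φ z))).sub
          (((hbc.tendsto _).comp h1).mul_const (transport φ z))
        simpa using this
      · obtain ⟨e1, e2⟩ := hzero z hzK
        simp [velDeriv, transport, e1, e2]

end Chain

/-! ### Truncation, the Caccioppoli inequality and absorption. -/

section Energy

variable {d : ℕ}

theorem LocL2.of_le {V W : Type*} [NormedAddCommGroup V] [NormedAddCommGroup W] {f : Z d → V}
    (hf : LocL2 f) {F : Z d → W} (hm : ∀ K : Set (Z d), IsCompact K →
    AEStronglyMeasurable F (volume.restrict K)) (hle : ∀ z, ‖F z‖ ≤ ‖f z‖) : LocL2 F :=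
  fun K hK => (hf K hK).of_le (hm K hK) (Eventually.of_forall hle)

theorem LocL2.integrableOn {V : Type*} [NormedAddCommGroup V] {f : Z d → V} (hf : LocL2 f)
    {K : Set (Z d)} (hK : IsCompact K) : IntegrableOn f K := by
  have : IsFiniteMeasure (volume.restrict K) := ⟨by simpa using hK.measure_lt_top⟩
  exact (hf K hK).integrable (by norm_num)

theorem LocL2.integrableOn_sq {V : Type*} [NormedAddCommGroup V] {f : Z d → V} (hf : LocL2 f)
    {K : Set (Z d)} (hK : IsCompact K) : IntegrableOn (fun z => ‖f z‖ ^ 2) K :=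
  (memLp_two_iff_integrable_sq_norm (hf K hK).aestronglyMeasurable).1 (hf K hK)

/-- A smooth convex approximation of `(s - κ)₊`. -/
noncomputable def hinge (κ s : ℝ) : ℝ := √(s ^ 2 + κ ^ 2) - κ

/-- The last bound is the nonlinear gain of the De Giorgi iteration: it turns an L² estimate of one
truncation into an L¹ estimate of the next, in place of a Chebyshev argument on level sets. The
third keeps track of how much has been cut off. -/
theorem hinge_spec {κ : ℝ} (hκ : 0 < κ) (s : ℝ) : 0 ≤ hinge κ s ∧ hinge κ s ≤ |s| ∧
    s - κ ≤ hinge κ s ∧ hinge κ s ≤ s ^ 2 / (2 * κ) := by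
  unfold hinge
  have h1 : κ ≤ √(s ^ 2 + κ ^ 2) := Real.le_sqrt_of_sq_le (by nlinarith [sq_nonneg s])
  have h2 : s ≤ √(s ^ 2 + κ ^ 2) := Real.le_sqrt_of_sq_le (by nlinarith [sq_nonneg κ])
  have h3 : √(s ^ 2 + κ ^ 2) ≤ |s| + κ := by
    refine Real.sqrt_le_iff.2 ⟨by positivity, ?_⟩
    nlinarith [sq_abs s, abs_nonneg s, mul_nonneg (abs_nonneg s) hκ.le]
  have h4 : √(s ^ 2 + κ ^ 2) ≤ s ^ 2 / (2 * κ) + κ := by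
    refine Real.sqrt_le_iff.2 ⟨by positivity, ?_⟩
    have e : (s ^ 2 / (2 * κ) + κ) ^ 2 = (s ^ 2 / (2 * κ)) ^ 2 + s ^ 2 + κ ^ 2 := by
      field_simp
      ring
    rw [e]
    nlinarith [sq_nonneg (s ^ 2 / (2 * κ))]
  exact ⟨by linarith, by linarith, by linarith, by linarith⟩

theorem hasDerivAt_sqrt_add {κ : ℝ} (hκ : 0 < κ) (s : ℝ) :
    HasDerivAt (fun s => √(s ^ 2 + κ ^ 2)) (s / √(s ^ 2 + κ ^ 2)) s := by
  have hp : 0 < s ^ 2 + κ ^ 2 := by positivity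
  have h := (((hasDerivAt_pow 2 s).add_const (κ ^ 2)).sqrt hp.ne')
  convert h using 1
  field_simp
  norm_num
  ring

theorem hasDerivAt_div_sqrt {κ : ℝ} (hκ : 0 < κ) (s : ℝ) :
    HasDerivAt (fun s => s / √(s ^ 2 + κ ^ 2)) (κ ^ 2 / √(s ^ 2 + κ ^ 2) ^ 3) s := by
  have hp : 0 < s ^ 2 + κ ^ 2 := by positivity
  have hq : 0 < √(s ^ 2 + κ ^ 2) := Real.sqrt_pos.2 hp
  refine ((hasDerivAt_id' s).div (hasDerivAt_sqrt_add hκ s) hq.ne').congr_deriv ?_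
  have e : √(s ^ 2 + κ ^ 2) ^ 2 = s ^ 2 + κ ^ 2 := Real.sq_sqrt hp.le
  field_simp
  rw [e]
  ring

theorem abs_div_sqrt_le {κ : ℝ} (hκ : 0 < κ) (s : ℝ) : |s / √(s ^ 2 + κ ^ 2)| ≤ 1 := by
  have hq : 0 < √(s ^ 2 + κ ^ 2) := Real.sqrt_pos.2 (by positivity)
  rw [abs_div, abs_of_pos hq, div_le_one hq]
  exact Real.le_sqrt_of_sq_le (by nlinarith [sq_abs s, sq_nonneg κ])

/-- The smooth truncation of a subsolution is a subsolution. -/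
theorem IsSub.hinge {lam Lam τ : ℝ} {u : Z d → ℝ} {g h : Z d → E d}
    (hu : IsSub lam Lam τ u g h) (hlam : 0 < lam) {κ : ℝ} (hκ : 0 < κ) :
    IsSub lam Lam τ (fun z => hinge κ (u z)) (fun z => (u z / √(u z ^ 2 + κ ^ 2)) • g z)
      (fun z => (u z / √(u z ^ 2 + κ ^ 2)) • h z) := by
  have hq : ∀ s : ℝ, 0 < √(s ^ 2 + κ ^ 2) := fun s => Real.sqrt_pos.2 (by positivity)
  have hb : ∀ s, HasDerivAt (KineticFP.hinge κ) (s / √(s ^ 2 + κ ^ 2)) s := fun s =>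
    (hasDerivAt_sqrt_add hκ s).sub_const κ
  have hb1 := hasDerivAt_div_sqrt hκ
  have hb1c : Continuous fun s : ℝ => s / √(s ^ 2 + κ ^ 2) :=
    continuous_iff_continuousAt.2 fun s => (hb1 s).continuousAt
  have hbc : Continuous (KineticFP.hinge κ) :=
    continuous_iff_continuousAt.2 fun s => (hb s).continuousAt
  have hb2c : Continuous fun s : ℝ => κ ^ 2 / √(s ^ 2 + κ ^ 2) ^ 3 :=
    continuous_const.div (by fun_prop) fun s => (pow_pos (hq s) 3).ne'
  have hpos : ∀ s : ℝ, 0 ≤ s → 0 ≤ s / √(s ^ 2 + κ ^ 2) := fun s hs => div_nonneg hs (hq s).le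
  have hM : ∀ s, |KineticFP.hinge κ s| ≤ (1 + 1 / κ) * (1 + s ^ 2) := fun s => by
    obtain ⟨h1, h2, -, -⟩ := hinge_spec hκ s
    rw [abs_of_nonneg h1]
    have h3 : 0 ≤ 1 / κ * (1 + s ^ 2) := by positivity
    nlinarith [sq_abs s, sq_nonneg (|s| - 1)]
  have hM1 : ∀ s : ℝ, |s / √(s ^ 2 + κ ^ 2)| ≤ (1 + 1 / κ) * (1 + |s|) := fun s => by
    refine (abs_div_sqrt_le hκ s).trans ?_
    have h3 : 0 ≤ 1 / κ * (1 + |s|) := by positivity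
    nlinarith [abs_nonneg s]
  have hM2 : ∀ s : ℝ, |κ ^ 2 / √(s ^ 2 + κ ^ 2) ^ 3| ≤ 1 + 1 / κ := fun s => by
    rw [abs_of_nonneg (by positivity)]
    have h1 : κ ≤ √(s ^ 2 + κ ^ 2) := Real.le_sqrt_of_sq_le (by nlinarith [sq_nonneg s])
    calc κ ^ 2 / √(s ^ 2 + κ ^ 2) ^ 3 ≤ κ ^ 2 / κ ^ 3 := by gcongr
      _ = 1 / κ := by field_simp
      _ ≤ _ := by linarith
  have hchain := fun (φ : Z d → ℝ) (hφ : ContDiff ℝ ∞ φ) (hc : HasCompactSupport φ)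
    (hφτ : ∀ z ∈ tsupport φ, τ < z.1) =>
    hu.chain hb hb1 hb2c hpos hM hM1 hM2 hφ hc hφτ
  have L1 : LocL2 fun z => KineticFP.hinge κ (u z) := hu.locL2_fst.of_le
    (fun K hK => hbc.comp_aestronglyMeasurable (hu.locL2_fst K hK).aestronglyMeasurable) fun z => by
      obtain ⟨h1, h2, -, -⟩ := hinge_spec hκ (u z)
      rwa [Real.norm_of_nonneg h1]
  have hsm : ∀ X : Z d → E d, LocL2 X → LocL2 fun z => (u z / √(u z ^ 2 + κ ^ 2)) • X z :=
    fun X hX => hX.of_le (fun K hK => (hb1c.comp_aestronglyMeasurable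
      (hu.locL2_fst K hK).aestronglyMeasurable).smul (hX K hK).aestronglyMeasurable) fun z => by
      rw [norm_smul]
      exact mul_le_of_le_one_left (norm_nonneg _) (abs_div_sqrt_le hκ _)
  have L2 := hsm _ hu.locL2_grad
  have L3 := hsm _ hu.locL2_flux
  refine ⟨fun z => (hinge_spec hκ _).1, L1, L2, L3, fun z => ?_, fun z => ?_, ?_, ?_⟩
  · rw [inner_smul_left, inner_smul_right, norm_smul, mul_pow, Real.norm_eq_abs, sq_abs,
      conj_trivial]
    nlinarith [mul_le_mul_of_nonneg_left (hu.lower z) (sq_nonneg (u z / √(u z ^ 2 + κ ^ 2)))]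
  · rw [inner_smul_left, inner_smul_right, norm_smul, mul_pow, Real.norm_eq_abs, sq_abs,
      conj_trivial]
    nlinarith [mul_le_mul_of_nonneg_left (hu.upper z) (sq_nonneg (u z / √(u z ^ 2 + κ ^ 2)))]
  · intro φ hφ hc hφτ e
    have hφ1 : ContDiff ℝ 1 φ := hφ.of_le (mod_cast le_top)
    obtain ⟨h1, h2⟩ := (hchain φ hφ hc hφτ).1 e
    have i1 : Integrable fun z => KineticFP.hinge κ (u z) * velDeriv φ z e :=
      (L1.smul_compact (continuous_velDeriv hφ1 e) (hasCompactSupport_velDeriv hc e)).2.congr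
        (Eventually.of_forall fun z => by simp [mul_comm])
    have i2 : Integrable fun z => u z / √(u z ^ 2 + κ ^ 2) * inner ℝ (g z) e * φ z :=
      (h2.sub i1).congr (Eventually.of_forall fun z => by simp)
    rw [integral_add i1 i2] at h1
    rw [eq_neg_of_add_eq_zero_left h1]
    simp only [inner_smul_left, conj_trivial]
  · intro φ hφ hc hφτ hφ0
    have hφ1 : ContDiff ℝ 1 φ := hφ.of_le (mod_cast le_top)
    obtain ⟨h1, h2⟩ := (hchain φ hφ hc hφτ).2 hφ0
    have i1 : Integrable fun z => KineticFP.hinge κ (u z) * transport φ z :=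
      (L1.smul_compact (continuous_transport hφ1) (hasCompactSupport_transport hc)).2.congr
        (Eventually.of_forall fun z => by simp [mul_comm])
    have i2 := (L3.velDeriv_compact hφ1 hc).2
    rw [← sub_nonpos, ← integral_sub i2 i1]
    refine le_trans (integral_mono (i2.sub i1) h2 fun z => ?_) h1
    have hin : 0 ≤ inner ℝ (g z) (h z) := by
      rw [real_inner_comm]
      exact (by positivity : 0 ≤ lam * ‖g z‖ ^ 2).trans (hu.lower z)
    -- Convexity of the truncation: the term with the second derivative has a sign and can be
    -- dropped.
    have h5 : 0 ≤ κ ^ 2 / √(u z ^ 2 + κ ^ 2) ^ 3 * inner ℝ (g z) (h z) * φ z :=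
      mul_nonneg (mul_nonneg (by positivity) hin) (hφ0 z)
    simp only [velDeriv_smul]
    linarith

theorem IsSub.inner_nonneg {lam Lam τ : ℝ} {u : Z d → ℝ} {g h : Z d → E d}
    (hu : IsSub lam Lam τ u g h) (hlam : 0 < lam) (z : Z d) : 0 ≤ inner ℝ (h z) (g z) :=
  (by positivity : 0 ≤ lam * ‖g z‖ ^ 2).trans (hu.lower z)

/-- A cutoff function supported in `S` at times larger than `τ`, with derivatives of size `A`. -/
structure IsCutoff (τ A : ℝ) (S : Set (Z d)) (χ : Z d → ℝ) : Prop where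
  smooth : ContDiff ℝ ∞ χ
  compact : HasCompactSupport χ
  time : ∀ z ∈ tsupport χ, τ < z.1
  nonneg : ∀ z, 0 ≤ χ z
  le_one : ∀ z, χ z ≤ 1
  supp : tsupport χ ⊆ S
  velDeriv_le : ∀ z e, |velDeriv χ z e| ≤ A * ‖e‖
  transport_le : ∀ z, |transport χ z| ≤ A ^ 2

theorem IsCutoff.eq_zero {τ A : ℝ} {S : Set (Z d)} {χ : Z d → ℝ} (hχ : IsCutoff τ A S χ) {z : Z d}
    (hz : z ∉ S) : χ z = 0 ∧ fderiv ℝ χ z = 0 :=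
  ⟨image_eq_zero_of_notMem_tsupport fun h => hz (hχ.supp h),
    fderiv_eq_zero_of_notMem fun h => hz (hχ.supp h)⟩

/-- The Caccioppoli inequality. -/
theorem IsSub.energy {lam Lam τ : ℝ} {u : Z d → ℝ} {g h : Z d → E d}
    (hu : IsSub lam Lam τ u g h) (hlam : 0 < lam) (hLam : 0 < Lam) {A : ℝ}
    {S : Set (Z d)} (hS : IsCompact S) {χ : Z d → ℝ} (hχ : IsCutoff τ A S χ) :
    (Integrable fun z => χ z ^ 2 * inner ℝ (h z) (g z)) ∧
    ∫ z, χ z ^ 2 * inner ℝ (h z) (g z) ≤ (4 * Lam + 2) * A ^ 2 * ∫ z in S, u z ^ 2 := by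
  have hχ1 : ContDiff ℝ 1 χ := hχ.smooth.of_le (mod_cast le_top)
  have hχχ : tsupport (fun z => χ z * χ z) ⊆ tsupport χ := tsupport_mul_subset_left
  -- This is the rigorous form of testing the equation with χ²u.
  obtain ⟨h1, h2⟩ := (hu.chain (b := fun s => s ^ 2 / 2) (b1 := fun s => s) (b2 := fun _ => 1)
    (fun s => by simpa using (hasDerivAt_pow 2 s).div_const 2) (fun s => hasDerivAt_id s) continuous_const (fun s hs => hs) (M := 1)
    (fun s => by rw [abs_of_nonneg (by positivity)]; nlinarith [sq_nonneg s])
    (fun s => by linarith [abs_nonneg s]) (fun s => by norm_num)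
    (hχ.smooth.mul hχ.smooth) hχ.compact.mul_right (fun z hz => hχ.time z (hχχ hz))).2
    (fun z => mul_self_nonneg _)
  set X : Z d → ℝ := fun z => 1 * inner ℝ (g z) (h z) * (χ z * χ z) +
    u z * velDeriv (fun z => χ z * χ z) z (h z) -
    u z ^ 2 / 2 * transport (fun z => χ z * χ z) z with hX
  have hu2 : IntegrableOn (fun z => u z ^ 2) S := by
    simpa using hu.locL2_fst.integrableOn_sq hS
  have hi : Integrable (S.indicator fun z => u z ^ 2) :=
    (integrable_indicator_iff hS.measurableSet).2 hu2
  have hbd : Integrable fun z => 2 * X z +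
      (4 * Lam + 2) * A ^ 2 * (S.indicator (fun z => u z ^ 2) z) :=
    (Integrable.const_mul h2 2).add (hi.const_mul _)
  have hnn : ∀ z, 0 ≤ χ z ^ 2 * inner ℝ (h z) (g z) := fun z =>
    mul_nonneg (sq_nonneg _) (hu.inner_nonneg hlam z)
  have hpt : ∀ z, χ z ^ 2 * inner ℝ (h z) (g z) ≤
      2 * X z + (4 * Lam + 2) * A ^ 2 * (S.indicator (fun z => u z ^ 2) z) := by
    intro z
    simp only [hX]
    rw [velDeriv_mul hχ1 hχ1, transport_mul hχ1 hχ1, real_inner_comm (h z) (g z)]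
    by_cases hz : z ∈ S
    · rw [Set.indicator_of_mem hz]
      have e1 := hχ.velDeriv_le z (h z)
      have e2 := hχ.transport_le z
      have e3 := hu.upper z
      have p0 := hχ.nonneg z
      have p1 := hχ.le_one z
      have hun := hu.nonneg z
      set I := inner ℝ (h z) (g z)
      set V := velDeriv χ z (h z)
      set W := transport χ z
      have k1 : -(u z * (χ z * V)) ≤ u z * χ z * (A * ‖h z‖) := by
        have := (abs_le.1 e1).1
        nlinarith [mul_nonneg hun p0]
      have k2 : u z ^ 2 * (χ z * W) ≤ u z ^ 2 * A ^ 2 := by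
        have := (abs_le.1 e2).2
        have h5 : χ z * W ≤ A ^ 2 := by nlinarith [sq_nonneg A]
        exact mul_le_mul_of_nonneg_left h5 (sq_nonneg _)
      -- Young's inequality, multiplied by 4Λ so that |h|² ≤ Λ h·g applies. It costs one of the two
      -- copies of the energy density contained in 2X.
      have k3 : 4 * Lam * (u z * χ z * (A * ‖h z‖)) ≤ χ z ^ 2 * ‖h z‖ ^ 2 + 4 * Lam ^ 2 * (A ^ 2 * u z ^ 2) := by
        nlinarith [sq_nonneg (χ z * ‖h z‖ - 2 * Lam * (A * u z))]
      have k4 : χ z ^ 2 * ‖h z‖ ^ 2 ≤ χ z ^ 2 * (Lam * I) :=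
        mul_le_mul_of_nonneg_left e3 (sq_nonneg _)
      have k5 : 4 * (u z * χ z * (A * ‖h z‖)) ≤ χ z ^ 2 * I + 4 * Lam * (A ^ 2 * u z ^ 2) := by
        have : Lam * (4 * (u z * χ z * (A * ‖h z‖))) ≤
            Lam * (χ z ^ 2 * I + 4 * Lam * (A ^ 2 * u z ^ 2)) := by linarith
        exact le_of_mul_le_mul_left this hLam
      nlinarith
    · obtain ⟨e1, e2⟩ := hχ.eq_zero hz
      rw [Set.indicator_of_notMem hz]
      simp [e1]
  have hm : AEStronglyMeasurable (fun z => χ z ^ 2 * inner ℝ (h z) (g z)) := by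
    have m1 := (hu.locL2_flux.smul_compact hχ1.continuous hχ.compact).1.aestronglyMeasurable
    have m2 := (hu.locL2_grad.smul_compact hχ1.continuous hχ.compact).1.aestronglyMeasurable
    refine (m1.inner (𝕜 := ℝ) m2).congr (Eventually.of_forall fun z => ?_)
    simp only [inner_smul_left, inner_smul_right, conj_trivial]
    ring
  refine ⟨hbd.mono' hm (Eventually.of_forall fun z => ?_), ?_⟩
  · rw [Real.norm_of_nonneg (hnn z)]
    exact hpt z
  · refine (integral_mono_of_nonneg (Eventually.of_forall hnn) hbd
      (Eventually.of_forall hpt)).trans ?_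
    have e : ∫ z, (2 * X z + (4 * Lam + 2) * A ^ 2 * (S.indicator (fun z => u z ^ 2) z)) =
        2 * (∫ z, X z) + (4 * Lam + 2) * A ^ 2 * ∫ z in S, u z ^ 2 := by
      rw [integral_add (Integrable.const_mul h2 2) (hi.const_mul _), integral_const_mul,
        integral_const_mul, integral_indicator hS.measurableSet]
    rw [e]
    linarith

/-- The directional bound is tested in the direction of the gradient itself and then divided by its
norm. -/
theorem IsCutoff.norm_velGrad_sq_le {τ A : ℝ} {S : Set (Z d)} {χ : Z d → ℝ}
    (hχ : IsCutoff τ A S χ) (hA : 0 ≤ A) (z : Z d) :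
    ‖velGrad (fun z => χ z * χ z) z‖ ≤ 2 * A := by
  have hχ1 : ContDiff ℝ 1 χ := hχ.smooth.of_le (mod_cast le_top)
  have h5 : ‖velGrad (fun z => χ z * χ z) z‖ ^ 2 ≤
      2 * A * ‖velGrad (fun z => χ z * χ z) z‖ := by
    rw [← real_inner_self_eq_norm_sq, inner_velGrad, velDeriv_mul hχ1 hχ1]
    have h6 := (abs_le.1 (hχ.velDeriv_le z (velGrad (fun z => χ z * χ z) z))).2
    have h7 : 0 ≤ A * ‖velGrad (fun z => χ z * χ z) z‖ := by positivity
    have h8 := hχ.nonneg z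
    have h9 := hχ.le_one z
    nlinarith
  rcases (norm_nonneg (velGrad (fun z => χ z * χ z) z)).eq_or_lt with h0 | h0
  · rw [← h0]; positivity
  · rw [sq] at h5
    exact le_of_mul_le_mul_right h5 h0

/-- Here x, a, b, I stand for χ, ‖g‖, ‖h‖, h·g. All error terms of the equation for χ²u reduce to u²
and the energy density χ²I. The cutoff is squared so that differentiating it leaves a factor χ next
to the flux, as the energy requires. -/
theorem absorb_pointwise {lam Lam r A x u V W I a b N : ℝ} (hlam : 0 < lam)
    (p0 : 0 ≤ x) (p1 : x ≤ 1)
    (e4 : lam * a ^ 2 ≤ I) (e3 : b ^ 2 ≤ Lam * I) (e1 : |V| ≤ A * b) (e2 : |W| ≤ A ^ 2)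
    (hN : 0 ≤ N) (hG : N ≤ x ^ 2 * a + u * (2 * A)) :
    (r ^ 2 * |u * (x * W + x * W) - (x * V + x * V)| + r * N + r * (x ^ 2 * b)) ^ 2 ≤
      3 * (8 * (r * A) ^ 4 + 8 * (r * A) ^ 2) * u ^ 2 +
      3 * (8 * (r * A) ^ 2 * r ^ 2 * Lam + r ^ 2 * (2 / lam + Lam)) * (x ^ 2 * I) := by
  have hχ4 : x ^ 4 ≤ x ^ 2 := pow_le_pow_of_le_one p0 p1 (by norm_num)
  have hχ2 : x ^ 2 ≤ 1 := pow_le_one₀ p0 p1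
  have hV2 : V ^ 2 ≤ A ^ 2 * (Lam * I) := by
    have := sq_le_sq' (abs_le.1 e1).1 (abs_le.1 e1).2
    rw [mul_pow] at this
    exact this.trans (mul_le_mul_of_nonneg_left e3 (sq_nonneg _))
  have hW2 : W ^ 2 ≤ A ^ 4 := by
    have := sq_le_sq' (abs_le.1 e2).1 (abs_le.1 e2).2
    calc W ^ 2 ≤ (A ^ 2) ^ 2 := this
      _ = A ^ 4 := by ring
  have kF : |u * (x * W + x * W) - (x * V + x * V)| ^ 2 ≤
      8 * A ^ 4 * u ^ 2 + 8 * A ^ 2 * Lam * (x ^ 2 * I) := by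
    rw [sq_abs]
    have s1 : (u * (x * W + x * W) - (x * V + x * V)) ^ 2 ≤
        8 * (u ^ 2 * (x ^ 2 * W ^ 2)) + 8 * (x ^ 2 * V ^ 2) := by
      nlinarith [sq_nonneg (u * (x * W) + x * V)]
    have s2 : x ^ 2 * W ^ 2 ≤ A ^ 4 :=
      (mul_le_of_le_one_left (sq_nonneg _) hχ2).trans hW2
    have s3 := mul_le_mul_of_nonneg_left hV2 (sq_nonneg x)
    have s4 := mul_le_mul_of_nonneg_left s2 (sq_nonneg u)
    linarith
  have kG : N ^ 2 ≤ 2 / lam * (x ^ 2 * I) + 8 * A ^ 2 * u ^ 2 := by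
    refine (pow_le_pow_left₀ hN hG 2).trans ?_
    have s1 : a ^ 2 ≤ I / lam := by
      rw [le_div_iff₀ hlam]; linarith
    have s2 : x ^ 4 * a ^ 2 ≤ x ^ 2 * (I / lam) :=
      mul_le_mul hχ4 s1 (sq_nonneg _) (sq_nonneg _)
    have s3 : 2 / lam * (x ^ 2 * I) = 2 * (x ^ 2 * (I / lam)) := by field_simp
    rw [s3]
    nlinarith [sq_nonneg (x ^ 2 * a - u * (2 * A))]
  have kH : (x ^ 2 * b) ^ 2 ≤ Lam * (x ^ 2 * I) := by
    have : x ^ 4 * b ^ 2 ≤ x ^ 2 * (Lam * I) :=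
      mul_le_mul hχ4 e3 (sq_nonneg _) (sq_nonneg _)
    linarith
  have e : ∀ a b c : ℝ, (a + b + c) ^ 2 ≤ 3 * (a ^ 2 + b ^ 2 + c ^ 2) := fun a b c => by
    nlinarith [sq_nonneg (a - b), sq_nonneg (a - c), sq_nonneg (b - c)]
  refine (e _ _ _).trans ?_
  have kF' := mul_le_mul_of_nonneg_left kF (by positivity : 0 ≤ r ^ 4)
  have kG' := mul_le_mul_of_nonneg_left kG (by positivity : 0 ≤ r ^ 2)
  have kH' := mul_le_mul_of_nonneg_left kH (by positivity : 0 ≤ r ^ 2)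
  rw [mul_pow, mul_pow r N, mul_pow r (x ^ 2 * b), ← pow_mul]
  linarith

/-- The Poincaré inequality is applied to χ²u at radius r = θ/A, the scale of the cutoff reduced by
θ. Since rA = θ, the Caccioppoli inequality bounds the error by a multiple of θ² ∫_S u², which a
small θ makes less than the prescribed ε. The price is the factor θ^{-(4d+2)} on the mass term. -/
theorem exists_absorb (d : ℕ) {lam Lam : ℝ} (hlam : 0 < lam) (hLam : 0 < Lam) {ε : ℝ}
    (hε : 0 < ε) : ∃ C : ℝ, 0 < C ∧ ∀ (τ : ℝ) (u : Z d → ℝ) (g h : Z d → E d),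
    IsSub lam Lam τ u g h → ∀ A : ℝ, 0 < A → ∀ (S : Set (Z d)) (χ : Z d → ℝ), IsCompact S →
    IsCutoff τ A S χ → ∫ z, (χ z ^ 2 * u z) ^ 2 ≤
      ε * (∫ z in S, u z ^ 2) + C * A ^ (4 * d + 2) * (∫ z in S, u z) ^ 2 := by
  obtain ⟨C, hC, hP⟩ := exists_poincare d
  set M : ℝ := 3 * (16 + (8 * Lam + (2 / lam + Lam)) * (4 * Lam + 2)) with hM
  have hM0 : 0 < M := by positivity
  obtain ⟨θ, hθ0, hθ1, hθ⟩ : ∃ θ : ℝ, 0 < θ ∧ θ ≤ 1 ∧ C * (M * θ ^ 2) ≤ ε := by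
    refine ⟨min 1 (√(ε / (C * M))), lt_min one_pos (Real.sqrt_pos.2 (by positivity)),
      min_le_left _ _, ?_⟩
    have h1 : min 1 (√(ε / (C * M))) ^ 2 ≤ ε / (C * M) := by
      refine (pow_le_pow_left₀ (le_min one_pos.le (Real.sqrt_nonneg _)) (min_le_right _ _) 2).trans
        (Real.sq_sqrt (by positivity)).le
    calc C * (M * min 1 (√(ε / (C * M))) ^ 2) ≤ C * (M * (ε / (C * M))) := by gcongr
      _ = ε := by field_simp
  refine ⟨C / θ ^ (4 * d + 2), by positivity, fun τ u g h hu A hA S χ hS hχ => ?_⟩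
  have hχ1 : ContDiff ℝ 1 χ := hχ.smooth.of_le (mod_cast le_top)
  have hχχ : tsupport (fun z => χ z * χ z) ⊆ tsupport χ := tsupport_mul_subset_left
  have hloc := hu.localize (hχ.smooth.mul hχ.smooth) hχ.compact.mul_right
    (fun z hz => hχ.time z (hχχ hz)) (fun z => mul_self_nonneg (χ z))
  set r : ℝ := θ / A with hr
  have hr0 : 0 < r := by positivity
  have hrA : r * A = θ := by rw [hr]; field_simp
  have hmain := hP r hr0 _ _ _ _ hloc
  obtain ⟨hEi, hE⟩ := hu.energy hlam hLam hS hχ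
  have hu1 : IntegrableOn u S := hu.locL2_fst.integrableOn hS
  have hu2 : IntegrableOn (fun z => u z ^ 2) S := by
    simpa using hu.locL2_fst.integrableOn_sq hS
  have hi : Integrable (S.indicator fun z => u z ^ 2) :=
    (integrable_indicator_iff hS.measurableSet).2 hu2
  have hmass : (∫ z, χ z * χ z * u z) ^ 2 ≤ (∫ z in S, u z) ^ 2 := by
    have hn : ∀ z, 0 ≤ χ z * χ z * u z := fun z => mul_nonneg (mul_self_nonneg _) (hu.nonneg z)
    refine pow_le_pow_left₀ (integral_nonneg hn) ?_ 2
    rw [← integral_indicator hS.measurableSet]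
    refine integral_mono_of_nonneg (Eventually.of_forall hn)
      ((integrable_indicator_iff hS.measurableSet).2 hu1) (Eventually.of_forall fun z => ?_)
    by_cases hz : z ∈ S
    · simp only [Set.indicator_of_mem hz]
      have := hχ.le_one z
      have h0 := hχ.nonneg z
      exact mul_le_of_le_one_left (hu.nonneg z) (by nlinarith)
    · simp [Set.indicator_of_notMem hz, (hχ.eq_zero hz).1]
  set a1 : ℝ := 3 * (8 * θ ^ 4 + 8 * θ ^ 2) with ha1
  set a2 : ℝ := 3 * (8 * θ ^ 2 * r ^ 2 * Lam + r ^ 2 * (2 / lam + Lam)) with ha2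
  have hbdi : Integrable fun z => a1 * S.indicator (fun z => u z ^ 2) z +
      a2 * (χ z ^ 2 * inner ℝ (h z) (g z)) := (hi.const_mul _).add (hEi.const_mul _)
  have herr : ∫ z, (r ^ 2 * |u z * transport (fun z => χ z * χ z) z -
      velDeriv (fun z => χ z * χ z) z (h z)| + r * ‖(χ z * χ z) • g z +
      u z • velGrad (fun z => χ z * χ z) z‖ + r * ‖(χ z * χ z) • h z‖) ^ 2 ≤
      a1 * (∫ z in S, u z ^ 2) + a2 * ((4 * Lam + 2) * A ^ 2 * ∫ z in S, u z ^ 2) := by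
    have ha2' : 0 ≤ a2 := by positivity
    refine le_trans (integral_mono_of_nonneg (Eventually.of_forall fun z => sq_nonneg _) hbdi
      (Eventually.of_forall fun z => ?_)) ?_
    · by_cases hz : z ∈ S
      · simp only [Set.indicator_of_mem hz]
        rw [velDeriv_mul hχ1 hχ1, transport_mul hχ1 hχ1]
        have hn : ‖(χ z * χ z) • g z + u z • velGrad (fun z => χ z * χ z) z‖ ≤
            χ z ^ 2 * ‖g z‖ + u z * (2 * A) := by
          refine (norm_add_le _ _).trans (add_le_add (le_of_eq ?_) ?_)
          · rw [norm_smul, Real.norm_of_nonneg (mul_self_nonneg _), sq]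
          · rw [norm_smul, Real.norm_of_nonneg (hu.nonneg z)]
            exact mul_le_mul_of_nonneg_left (hχ.norm_velGrad_sq_le hA.le z) (hu.nonneg z)
        have hn2 : ‖(χ z * χ z) • h z‖ = χ z ^ 2 * ‖h z‖ := by
          rw [norm_smul, Real.norm_of_nonneg (mul_self_nonneg _), sq]
        rw [hn2, ha1, ha2, ← hrA]
        exact absorb_pointwise hlam (hχ.nonneg z) (hχ.le_one z)
          (hu.lower z) (hu.upper z) (hχ.velDeriv_le z (h z))
          (hχ.transport_le z) (norm_nonneg _) hn
      · obtain ⟨e1, e2⟩ := hχ.eq_zero hz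
        have e3 : velGrad (fun z => χ z * χ z) z = 0 := by
          have : fderiv ℝ (fun z => χ z * χ z) z = 0 := by
            rw [fderiv_fun_mul (hχ1.differentiable one_ne_zero z)
              (hχ1.differentiable one_ne_zero z), e1]
            simp
          simp [velGrad, this]
        simp only [velDeriv_mul hχ1 hχ1, transport_mul hχ1 hχ1, Set.indicator_of_notMem hz, e3, e1]
        simp
    · rw [integral_add (hi.const_mul _) (hEi.const_mul _), integral_const_mul,
        integral_const_mul, integral_indicator hS.measurableSet]
      gcongr
  have hS0 : 0 ≤ ∫ z in S, u z ^ 2 := integral_nonneg fun z => sq_nonneg _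
  -- As θ ≤ 1, the sum 8θ⁴ + 8θ² is at most 16θ², the source of the 16 in M; in the energy part A²
  -- is compensated by r²A² = θ².
  have hcoef : a1 + a2 * ((4 * Lam + 2) * A ^ 2) ≤ M * θ ^ 2 := by
    have hθ2 : θ ^ 2 ≤ 1 := pow_le_one₀ hθ0.le hθ1
    have e1 : a2 * ((4 * Lam + 2) * A ^ 2) =
        3 * ((8 * Lam * θ ^ 2 + (2 / lam + Lam)) * (4 * Lam + 2)) * θ ^ 2 := by
      rw [ha2, ← hrA]; ring
    rw [e1, ha1, hM]
    have e2 : 8 * Lam * θ ^ 2 ≤ 8 * Lam := by nlinarith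
    have e3 : 3 * ((8 * Lam * θ ^ 2 + (2 / lam + Lam)) * (4 * Lam + 2)) * θ ^ 2 ≤
        3 * ((8 * Lam + (2 / lam + Lam)) * (4 * Lam + 2)) * θ ^ 2 := by gcongr
    nlinarith [sq_nonneg θ]
  have hlhs : ∫ z, (χ z ^ 2 * u z) ^ 2 = ∫ z, (χ z * χ z * u z) ^ 2 := by
    simp only [sq (χ _)]
  rw [hlhs]
  refine hmain.trans ?_
  rw [add_comm]
  refine add_le_add ?_ ?_
  · calc _ ≤ C * (a1 * (∫ z in S, u z ^ 2) + a2 * ((4 * Lam + 2) * A ^ 2 * ∫ z in S, u z ^ 2)) :=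
        mul_le_mul_of_nonneg_left herr hC.le
      _ = C * (a1 + a2 * ((4 * Lam + 2) * A ^ 2)) * ∫ z in S, u z ^ 2 := by ring
      _ ≤ ε * ∫ z in S, u z ^ 2 := by
        refine mul_le_mul_of_nonneg_right (le_trans ?_ hθ) hS0
        exact mul_le_mul_of_nonneg_left hcoef hC.le
  · have e : C / r ^ (4 * d + 2) = C / θ ^ (4 * d + 2) * A ^ (4 * d + 2) := by
      rw [hr, div_pow]; field_simp
    rw [e]
    exact mul_le_mul_of_nonneg_left hmass (by positivity)

end Energy

/-! ### Reverse Hölder inequality and De Giorgi iteration. -/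

section DeGiorgi

variable {d : ℕ}

/-- Absorption of a small multiple of the same quantity on a larger domain. -/
theorem absorb_iterate {φ : ℝ → ℝ} {B s t : ℝ} (m : ℕ) (hst : s < t) (hB : 0 ≤ B)
    (hmono : ∀ σ, s ≤ σ → σ ≤ t → φ σ ≤ φ t)
    (h : ∀ σ σ', s ≤ σ → σ < σ' → σ' ≤ t →
      φ σ ≤ (1 / 2) ^ (m + 1) * φ σ' + B / (σ' - σ) ^ m) :
    φ s ≤ 2 ^ (m + 1) * (B / (t - s) ^ m) := by
  have hts : 0 < t - s := sub_pos.2 hst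
  set P := B / (t - s) ^ m with hP
  have hP0 : 0 ≤ P := by positivity
  -- The radii approach t with gaps halved at each step. The n-th gap costs 2^{m(n+1)}, the n
  -- contractions gain 2^{-(m+1)n}, and a geometric series of ratio 1/2 is left.
  set q : ℕ → ℝ := fun n => t - (t - s) * (1 / 2) ^ n with hq
  have hqs : ∀ n, s ≤ q n := fun n => by
    have : (1 / 2 : ℝ) ^ n ≤ 1 := pow_le_one₀ (by norm_num) (by norm_num)
    simp only [hq]
    nlinarith
  have hqt : ∀ n, q n ≤ t := fun n => by
    have : (0 : ℝ) ≤ (1 / 2 : ℝ) ^ n := by positivity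
    simp only [hq]
    nlinarith
  have hqd : ∀ n, q (n + 1) - q n = (t - s) * (1 / 2) ^ (n + 1) := fun n => by
    simp only [hq]
    ring
  have hind : ∀ n, φ s ≤ ((1 / 2) ^ (m + 1)) ^ n * φ (q n) +
      2 ^ m * P * (2 - 2 * (1 / 2) ^ n) := by
    intro n
    induction n with
    | zero => simp [hq]
    | succ n ih =>
      have h1 := h (q n) (q (n + 1)) (hqs n) (by
        have := hqd n
        have h2 : 0 < (t - s) * (1 / 2) ^ (n + 1) := by positivity
        linarith) (hqt _)
      rw [hqd] at h1
      have h3 := mul_le_mul_of_nonneg_left h1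
        (by positivity : (0 : ℝ) ≤ ((1 / 2) ^ (m + 1)) ^ n)
      have e : ((1 / 2 : ℝ) ^ (m + 1)) ^ n * (B / ((t - s) * (1 / 2) ^ (n + 1)) ^ m) =
          2 ^ m * P * (1 / 2) ^ n := by
        rw [hP, mul_pow]
        have e2 : ((1 / 2 : ℝ) ^ (m + 1)) ^ n = ((1 / 2 : ℝ) ^ (n + 1)) ^ m * 2 ^ m *
            (1 / 2) ^ n := by
          have : (2 : ℝ) ^ m * (1 / 2) ^ m = 1 := by rw [← mul_pow]; norm_num
          calc ((1 / 2 : ℝ) ^ (m + 1)) ^ n = (1 / 2) ^ (m * n + n) := by rw [← pow_mul]; ring_nf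
            _ = (1 / 2) ^ (m * n) * (1 / 2) ^ n * (2 ^ m * (1 / 2) ^ m) := by
              rw [this, pow_add, mul_one]
            _ = (1 / 2) ^ (m * n + m) * 2 ^ m * (1 / 2) ^ n := by rw [pow_add]; ring
            _ = _ := by rw [← pow_mul]; ring_nf
        rw [e2]
        have : ((1 / 2 : ℝ) ^ (n + 1)) ^ m ≠ 0 := by positivity
        field_simp
      have e3 : (2 : ℝ) - 2 * (1 / 2) ^ (n + 1) = (2 - 2 * (1 / 2) ^ n) + (1 / 2) ^ n := by
        rw [pow_succ]; ring
      rw [e3, mul_add, pow_succ]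
      rw [mul_add, e] at h3
      linarith
  have hlim : Tendsto (fun n : ℕ => ((1 / 2 : ℝ) ^ (m + 1)) ^ n * φ t + 2 ^ (m + 1) * P) atTop
      (𝓝 (0 * φ t + 2 ^ (m + 1) * P)) :=
    ((tendsto_pow_atTop_nhds_zero_of_lt_one (by positivity)
      (pow_lt_one₀ (by norm_num) (by norm_num) (by omega))).mul_const _).add_const _
  rw [zero_mul, zero_add] at hlim
  refine ge_of_tendsto' hlim fun n => (hind n).trans ?_
  have h1 := mul_le_mul_of_nonneg_left (hmono (q n) (hqs n) (hqt n))
    (by positivity : (0 : ℝ) ≤ ((1 / 2) ^ (m + 1)) ^ n)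
  have h2 : 0 ≤ 2 ^ m * P * (2 * (1 / 2) ^ n) := by positivity
  have h3 : (2 : ℝ) ^ (m + 1) * P = 2 ^ m * P * 2 := by ring
  rw [h3]
  linarith

/-- An increasing family of compact sets admitting cutoffs between them. -/
structure IsScale (τ A : ℝ) (D : ℝ → Set (Z d)) : Prop where
  compact : ∀ s, 0 ≤ s → s ≤ 1 → IsCompact (D s)
  mono : ∀ s s', 0 ≤ s → s ≤ s' → s' ≤ 1 → D s ⊆ D s'
  cutoff : ∀ s s', 0 ≤ s → s < s' → s' ≤ 1 →
    ∃ χ, IsCutoff τ (A / (s' - s)) (D s') χ ∧ ∀ z ∈ D s, χ z = 1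

/-- `exists_absorb` leaves a small multiple of the L² norm on the larger set. With m = 4d + 2 and ε
= 2^{-(m+1)} it is removed by `absorb_iterate`, and only the mass stays on the right. -/
theorem exists_reverse_holder (d : ℕ) {lam Lam : ℝ} (hlam : 0 < lam) (hLam : 0 < Lam) :
    ∃ C : ℝ, 0 < C ∧ ∀ (τ : ℝ) (u : Z d → ℝ) (g h : Z d → E d),
    IsSub lam Lam τ u g h → ∀ (A : ℝ) (D : ℝ → Set (Z d)), 0 < A → IsScale τ A D →
    ∀ s t, 0 ≤ s → s < t → t ≤ 1 →
      ∫ z in D s, u z ^ 2 ≤ C * (A / (t - s)) ^ (4 * d + 2) * (∫ z in D t, u z) ^ 2 := by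
  obtain ⟨C, hC, hmain⟩ := exists_absorb d hlam hLam
    (by positivity : (0 : ℝ) < (1 / 2) ^ (4 * d + 2 + 1))
  refine ⟨2 ^ (4 * d + 2 + 1) * C, by positivity, fun τ u g h hu A D hA hD s t hs hst ht => ?_⟩
  have hint : ∀ σ, 0 ≤ σ → σ ≤ 1 → IntegrableOn (fun z => u z ^ 2) (D σ) := fun σ h1 h2 => by
    simpa using hu.locL2_fst.integrableOn_sq (hD.compact σ h1 h2)
  have hint1 : ∀ σ, 0 ≤ σ → σ ≤ 1 → IntegrableOn u (D σ) := fun σ h1 h2 =>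
    hu.locL2_fst.integrableOn (hD.compact σ h1 h2)
  have key := absorb_iterate (φ := fun σ => ∫ z in D σ, u z ^ 2)
    (B := C * A ^ (4 * d + 2) * (∫ z in D t, u z) ^ 2) (4 * d + 2) hst (by positivity)
    (fun σ h1 h2 => setIntegral_mono_set (hint t (hs.trans hst.le) ht)
      (Eventually.of_forall fun z => sq_nonneg _)
      (hD.mono σ t (hs.trans h1) h2 ht).eventuallyLE) ?_
  · refine key.trans (le_of_eq ?_)
    rw [div_pow]
    ring
  · intro σ σ' h1 h2 h3
    obtain ⟨χ, hχ, hχ1⟩ := hD.cutoff σ σ' (hs.trans h1) h2 (h3.trans ht)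
    have hσ' : 0 ≤ σ' := (hs.trans h1).trans h2.le
    have hσσ : 0 < σ' - σ := sub_pos.2 h2
    have hb := hmain τ u g h hu (A / (σ' - σ)) (by positivity) (D σ') χ
      (hD.compact σ' hσ' (h3.trans ht)) hχ
    have hDm : MeasurableSet (D σ) :=
      (hD.compact σ (hs.trans h1) (h2.le.trans (h3.trans ht))).measurableSet
    have hle : ∫ z in D σ, u z ^ 2 ≤ ∫ z, (χ z ^ 2 * u z) ^ 2 := by
      rw [← integral_indicator hDm]
      refine integral_mono_of_nonneg (Eventually.of_forall fun z =>
        Set.indicator_nonneg (fun _ _ => sq_nonneg _) z) ?_ (Eventually.of_forall fun z => ?_)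
      · exact (hu.locL2_fst.smul_compact (hχ.smooth.continuous.pow 2)
          (HasCompactSupport.intro hχ.compact fun z hz => by
            simp [image_eq_zero_of_notMem_tsupport hz])).1.integrable_sq
      · by_cases hz : z ∈ D σ
        · simp [Set.indicator_of_mem hz, hχ1 z hz]
        · simp only [Set.indicator_of_notMem hz]
          positivity
    have hm : (∫ z in D σ', u z) ^ 2 ≤ (∫ z in D t, u z) ^ 2 := by
      refine pow_le_pow_left₀ (integral_nonneg fun z => hu.nonneg z) ?_ 2
      exact setIntegral_mono_set (hint1 t (hs.trans hst.le) ht)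
        (Eventually.of_forall fun z => hu.nonneg z) (hD.mono σ' t hσ' h3 ht).eventuallyLE
    refine hle.trans (hb.trans ?_)
    refine add_le_add le_rfl ?_
    calc C * (A / (σ' - σ)) ^ (4 * d + 2) * (∫ z in D σ', u z) ^ 2
        ≤ C * (A / (σ' - σ)) ^ (4 * d + 2) * (∫ z in D t, u z) ^ 2 := by gcongr
      _ = _ := by rw [div_pow]; ring

/-- Iterated truncation. -/
noncomputable def truncSeq (ℓ : ℝ) (u : Z d → ℝ) : ℕ → Z d → ℝ
  | 0 => u
  | n + 1 => fun z => hinge (ℓ * (1 / 2) ^ (n + 1)) (truncSeq ℓ u n z)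

theorem IsSub.truncSeq {lam Lam τ : ℝ} {u : Z d → ℝ} {g h : Z d → E d}
    (hu : IsSub lam Lam τ u g h) (hlam : 0 < lam) {ℓ : ℝ} (hℓ : 0 < ℓ) (n : ℕ) :
    ∃ g' h' : Z d → E d, IsSub lam Lam τ (truncSeq ℓ u n) g' h' := by
  induction n with
  | zero => exact ⟨g, h, hu⟩
  | succ n ih =>
    obtain ⟨g', h', hn⟩ := ih
    exact ⟨_, _, hn.hinge hlam (by positivity)⟩

/-- The levels ℓ 2^{-k} cut off in the first n steps add up to ℓ(1 − 2^{-n}) < ℓ, so the part of u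
above ℓ survives every truncation. -/
theorem le_truncSeq {ℓ : ℝ} (hℓ : 0 < ℓ) (u : Z d → ℝ) (n : ℕ) (z : Z d) :
    u z - ℓ * (1 - (1 / 2) ^ n) ≤ truncSeq ℓ u n z := by
  induction n with
  | zero => simp [truncSeq]
  | succ n ih =>
    have := (hinge_spec (by positivity : 0 < ℓ * (1 / 2) ^ (n + 1)) (truncSeq ℓ u n z)).2.2.1
    simp only [truncSeq]
    have e : (1 / 2 : ℝ) ^ (n + 1) = (1 / 2) ^ n / 2 := by rw [pow_succ]; ring
    rw [e] at this ⊢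
    linarith

/-- If N decays like Q^{-n}, squaring gives Q^{-2n} and the factor Q^n returns Q^{-n}; the smallness
of the first term supplies the missing 1/Q. -/
theorem quadratic_decay {N : ℕ → ℝ} {P Q : ℝ} (hP : 0 ≤ P) (hQ : 0 < Q) (h0 : ∀ n, 0 ≤ N n)
    (h : ∀ n, N (n + 1) ≤ P * Q ^ n * N n ^ 2) (hs : P * N 0 * Q ≤ 1) (n : ℕ) :
    N n ≤ N 0 * (1 / Q) ^ n := by
  induction n with
  | zero => simp
  | succ n ih =>
    refine (h n).trans ?_
    have h1 : N n ^ 2 ≤ (N 0 * (1 / Q) ^ n) ^ 2 := pow_le_pow_left₀ (h0 n) ih 2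
    calc P * Q ^ n * N n ^ 2 ≤ P * Q ^ n * (N 0 * (1 / Q) ^ n) ^ 2 := by gcongr
      _ = (P * N 0 * Q) * (N 0 * (1 / Q) ^ (n + 1)) := by
        rw [one_div, inv_pow, inv_pow, pow_succ]
        field_simp
        ring
      _ ≤ 1 * (N 0 * (1 / Q) ^ (n + 1)) :=
        mul_le_mul_of_nonneg_right hs (mul_nonneg (h0 0) (by positivity))
      _ = _ := one_mul _

/-- Local boundedness of subsolutions, in terms of their mass. -/
theorem exists_local_bound (d : ℕ) {lam Lam : ℝ} (hlam : 0 < lam) (hLam : 0 < Lam) :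
    ∃ C : ℝ, 0 < C ∧ ∀ (τ : ℝ) (u : Z d → ℝ) (g h : Z d → E d),
    IsSub lam Lam τ u g h → ∀ (A : ℝ) (D : ℝ → Set (Z d)), 0 < A → IsScale τ A D →
      ∀ᵐ z, z ∈ D 0 → u z ≤ C * A ^ (4 * d + 2) * ∫ z in D 1, u z := by
  obtain ⟨C, hC, hmain⟩ := exists_reverse_holder d hlam hLam
  set m := 4 * d + 2 with hm
  set Q : ℝ := 2 ^ (m + 1) with hQ
  have hQ0 : 0 < Q := by positivity
  refine ⟨C * 2 ^ m * Q, by positivity, fun τ u g h hu A D hA hD => ?_⟩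
  have hN0 : 0 ≤ ∫ z in D 1, u z := integral_nonneg fun z => hu.nonneg z
  have hhalf : ∀ n : ℕ, (0 : ℝ) ≤ (1 / 2) ^ n ∧ (1 / 2 : ℝ) ^ n ≤ 1 := fun n =>
    ⟨by positivity, pow_le_one₀ (by norm_num) (by norm_num)⟩
  have hlevel : ∀ ℓ : ℝ, 0 < ℓ → C * 2 ^ m * Q * A ^ m * (∫ z in D 1, u z) ≤ ℓ →
      ∀ᵐ z, z ∈ D 0 → u z ≤ ℓ := by
    intro ℓ hℓ hle
    set N : ℕ → ℝ := fun n => ∫ z in D ((1 / 2) ^ n), truncSeq ℓ u n z with hN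
    have hsub := hu.truncSeq hlam hℓ
    have hnn : ∀ n z, 0 ≤ truncSeq ℓ u n z := fun n z => by
      obtain ⟨g', h', hn⟩ := hsub n
      exact hn.nonneg z
    have hNn : ∀ n, 0 ≤ N n := fun n => integral_nonneg fun z => hnn n z
    have hstep : ∀ n, N (n + 1) ≤ (C * A ^ m * 2 ^ m / ℓ) * Q ^ n * N n ^ 2 := by
      intro n
      obtain ⟨g', h', hn⟩ := hsub n
      have hlt : (1 / 2 : ℝ) ^ (n + 1) < (1 / 2) ^ n :=
        pow_lt_pow_right_of_lt_one₀ (by norm_num) (by norm_num) (Nat.lt_succ_self n)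
      have h1 := hmain τ _ g' h' hn A D hA hD _ _ (hhalf (n + 1)).1 hlt (hhalf n).2
      have hdiff : (1 / 2 : ℝ) ^ n - (1 / 2) ^ (n + 1) = (1 / 2) ^ (n + 1) := by
        rw [pow_succ]; ring
      rw [hdiff] at h1
      have hκ : 0 < ℓ * (1 / 2) ^ (n + 1) := by positivity
      -- The quadratic bound for `hinge` trades the L¹ norm of the new truncation for the L² norm of
      -- the old one, to which the reverse Hölder inequality applies.
      have h2 : N (n + 1) ≤ ∫ z in D ((1 / 2) ^ (n + 1)),
          truncSeq ℓ u n z ^ 2 / (2 * (ℓ * (1 / 2) ^ (n + 1))) := by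
        refine integral_mono_of_nonneg (Eventually.of_forall fun z => hnn (n + 1) z) ?_
          (Eventually.of_forall fun z => (hinge_spec hκ _).2.2.2)
        have : IntegrableOn (fun z => truncSeq ℓ u n z ^ 2) (D ((1 / 2) ^ (n + 1))) := by
          simpa using hn.locL2_fst.integrableOn_sq
            (hD.compact _ (hhalf (n + 1)).1 (hhalf (n + 1)).2)
        exact this.div_const _
      rw [integral_div] at h2
      refine h2.trans ?_
      rw [div_le_iff₀ (by positivity)]
      refine h1.trans (le_of_eq ?_)
      -- The gap of the sets contributes 2^{m(n+1)} and the level contributes 2^n / ℓ; together this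
      -- is 2^m Q^n / ℓ with Q = 2^{m+1}.
      have e1 : (A / (1 / 2) ^ (n + 1)) ^ m = A ^ m * (2 ^ (n + 1)) ^ m := by
        rw [← mul_pow]; congr 1; rw [one_div, inv_pow, div_inv_eq_mul]
      have e2 : Q ^ n * (2 * (1 / 2 : ℝ) ^ (n + 1)) * 2 ^ m = (2 ^ (n + 1)) ^ m := by
        have : (2 : ℝ) ^ n * (2 * (1 / 2) ^ (n + 1)) = 1 := by
          rw [← mul_assoc, ← pow_succ, ← mul_pow]; norm_num
        calc Q ^ n * (2 * (1 / 2 : ℝ) ^ (n + 1)) * 2 ^ m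
            = 2 ^ (m * n) * (2 ^ n * (2 * (1 / 2) ^ (n + 1))) * 2 ^ m := by
              rw [hQ, ← pow_mul, add_mul, one_mul, pow_add]; ring
          _ = _ := by rw [this, mul_one, ← pow_add, ← pow_mul]; ring_nf
      rw [e1, ← e2]
      field_simp
      rfl
    have hsmall : (C * A ^ m * 2 ^ m / ℓ) * N 0 * Q ≤ 1 := by
      have e : N 0 = ∫ z in D 1, u z := by simp [hN, truncSeq]
      rw [e, div_mul_eq_mul_div, div_mul_eq_mul_div, div_le_one hℓ]
      linarith
    have hdecay := quadratic_decay (by positivity) hQ0 hNn hstep hsmall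
    have hlim : Tendsto (fun n : ℕ => N 0 * (1 / Q) ^ n) atTop (𝓝 (N 0 * 0)) := by
      refine (tendsto_pow_atTop_nhds_zero_of_lt_one (by positivity) ?_).const_mul _
      rw [div_lt_one hQ0]
      exact one_lt_pow₀ (by norm_num) (by omega)
    rw [mul_zero] at hlim
    have hi0 : IntegrableOn (fun z => max (u z - ℓ) 0) (D 0) := by
      refine (hu.locL2_fst.integrableOn (hD.compact 0 le_rfl zero_le_one)).mono'
        ((((hu.locL2_fst _ (hD.compact 0 le_rfl zero_le_one)).aestronglyMeasurable.sub
          aestronglyMeasurable_const)).sup aestronglyMeasurable_const)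
        (Eventually.of_forall fun z => ?_)
      rw [Real.norm_of_nonneg (le_max_right _ _)]
      exact max_le (by linarith) (hu.nonneg z)
    -- The positive part of u − ℓ lies below every truncation, and their masses tend to zero.
    have hzero : ∫ z in D 0, max (u z - ℓ) 0 ≤ 0 := by
      refine ge_of_tendsto' hlim fun n => le_trans ?_ (hdecay n)
      obtain ⟨g', h', hn⟩ := hsub n
      have hin := hn.locL2_fst.integrableOn (hD.compact _ (hhalf n).1 (hhalf n).2)
      calc ∫ z in D 0, max (u z - ℓ) 0 ≤ ∫ z in D 0, truncSeq ℓ u n z := by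
            refine integral_mono hi0 (hin.mono_set (hD.mono 0 _ le_rfl (hhalf n).1 (hhalf n).2))
              fun z => max_le ?_ (hnn n z)
            have h1 := le_truncSeq hℓ u n z
            have h2 : 0 ≤ ℓ * (1 / 2) ^ n := by positivity
            linarith
        _ ≤ N n := setIntegral_mono_set hin (Eventually.of_forall fun z => hnn n z)
            (hD.mono 0 _ le_rfl (hhalf n).1 (hhalf n).2).eventuallyLE
    have hae := (setIntegral_eq_zero_iff_of_nonneg_ae
      (Eventually.of_forall fun z => le_max_right (u z - ℓ) 0) hi0).1
      (le_antisymm hzero (integral_nonneg fun z => le_max_right _ _))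
    have := (ae_restrict_iff' (hD.compact 0 le_rfl zero_le_one).measurableSet).1 hae
    filter_upwards [this] with z hz hz0
    have h1 := hz hz0
    simp only [Pi.zero_apply] at h1
    have := le_max_left (u z - ℓ) 0
    linarith
  -- Levels have to be positive while the mass may vanish, so 1/(n+1) is added and sent to zero.
  have hall : ∀ᵐ z, ∀ n : ℕ, z ∈ D 0 →
      u z ≤ C * 2 ^ m * Q * A ^ m * (∫ z in D 1, u z) + 1 / ((n : ℝ) + 1) :=
    ae_all_iff.2 fun n => hlevel _ (by positivity)
      (le_add_of_nonneg_right (by positivity))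
  filter_upwards [hall] with z hz hz0
  have hlim := (tendsto_one_div_add_atTop_nhds_zero_nat (𝕜 := ℝ)).const_add
    (C * 2 ^ m * Q * A ^ m * (∫ z in D 1, u z))
  rw [add_zero] at hlim
  exact ge_of_tendsto' hlim fun n => hz n hz0

end DeGiorgi

/-! ### Kinetic cylinders and their cutoffs. -/

section Cylinder

variable {d : ℕ}

theorem exists_smoothTransition_bound :
    ∃ c : ℝ, 1 ≤ c ∧ ∀ x, |deriv Real.smoothTransition x| ≤ c := by
  have hc : Continuous (deriv Real.smoothTransition) :=
    (Real.smoothTransition.contDiff (n := 1)).continuous_deriv le_rfl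
  have hs : HasCompactSupport (deriv Real.smoothTransition) := by
    refine HasCompactSupport.intro (isCompact_Icc (a := (0 : ℝ)) (b := 1)) fun x hx => ?_
    rcases lt_or_ge x 0 with h0 | h0
    · have : Real.smoothTransition =ᶠ[𝓝 x] fun _ => 0 := by
        filter_upwards [Iio_mem_nhds h0] with y hy
        exact Real.smoothTransition.zero_of_nonpos (le_of_lt hy)
      rw [this.deriv_eq, deriv_const]
    · have h1 : 1 < x := by
        by_contra h
        exact hx ⟨h0, not_lt.1 h⟩
      have : Real.smoothTransition =ᶠ[𝓝 x] fun _ => 1 := by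
        filter_upwards [Ioi_mem_nhds h1] with y hy
        exact Real.smoothTransition.one_of_one_le (le_of_lt hy)
      rw [this.deriv_eq, deriv_const]
  obtain ⟨c, hcb⟩ := hs.exists_bound_of_continuous hc
  exact ⟨max 1 c, le_max_left _ _, fun x => (hcb x).trans (le_max_right _ _)⟩

/-- A smooth step along the level sets of `n`. -/
noncomputable def ramp (n : Z d → ℝ) (c : ℝ) (z : Z d) : ℝ := Real.smoothTransition (n z / c)

theorem ramp_spec {n : Z d → ℝ} (hn : ContDiff ℝ ∞ n) {c : ℝ} (hc : 0 < c) :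
    ContDiff ℝ ∞ (ramp n c) ∧ (∀ z, 0 ≤ ramp n c z) ∧ (∀ z, ramp n c z ≤ 1) ∧
    (∀ z, c ≤ n z → ramp n c z = 1) ∧ (∀ z, n z ≤ 0 → ramp n c z = 0) ∧
    ∀ c0, (∀ x, |deriv Real.smoothTransition x| ≤ c0) → ∀ z w,
      |fderiv ℝ (ramp n c) z w| ≤ c0 * (|fderiv ℝ n z w| / c) := by
  refine ⟨Real.smoothTransition.contDiff.comp (hn.div_const c),
    fun z => Real.smoothTransition.nonneg _, fun z => Real.smoothTransition.le_one _,
    fun z hz => Real.smoothTransition.one_of_one_le ((one_le_div hc).2 hz),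
    fun z hz => Real.smoothTransition.zero_of_nonpos (div_nonpos_of_nonpos_of_nonneg hz hc.le),
    fun c0 h0 z w => ?_⟩
  have h1 : HasDerivAt Real.smoothTransition (deriv Real.smoothTransition (n z / c)) (n z / c) :=
    ((Real.smoothTransition.contDiff (n := 1)).differentiable one_ne_zero _).hasDerivAt
  have h2 : HasFDerivAt (fun z => n z / c) (c⁻¹ • fderiv ℝ n z) z := by
    have := ((hn.differentiable (by simp)) z).hasFDerivAt.const_smul c⁻¹
    refine this.congr_of_eventuallyEq (Eventually.of_forall fun y => ?_)
    simp [div_eq_inv_mul]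
  have h3 : fderiv ℝ (ramp n c) z =
      deriv Real.smoothTransition (n z / c) • (c⁻¹ • fderiv ℝ n z) :=
    (h1.comp_hasFDerivAt z h2).fderiv
  rw [h3]
  simp only [smul_apply, smul_eq_mul, abs_mul]
  rw [abs_of_pos (inv_pos.2 hc), ← div_eq_inv_mul]
  exact mul_le_mul_of_nonneg_right (h0 _) (by positivity)

theorem abs_fderiv_mul_le {f g : Z d → ℝ} (hf : ContDiff ℝ ∞ f) (hg : ContDiff ℝ ∞ g)
    (f0 : ∀ z, 0 ≤ f z) (f1 : ∀ z, f z ≤ 1) (g0 : ∀ z, 0 ≤ g z) (g1 : ∀ z, g z ≤ 1) (z w : Z d) :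
    |fderiv ℝ (fun z => f z * g z) z w| ≤ |fderiv ℝ f z w| + |fderiv ℝ g z w| := by
  rw [fderiv_fun_mul (hf.differentiable (by simp) z) (hg.differentiable (by simp) z)]
  simp only [add_apply, smul_apply, smul_eq_mul]
  refine (abs_add_le _ _).trans ?_
  rw [abs_mul, abs_mul, abs_of_nonneg (f0 z), abs_of_nonneg (g0 z), add_comm]
  exact add_le_add (mul_le_of_le_one_left (abs_nonneg _) (g1 z))
    (mul_le_of_le_one_left (abs_nonneg _) (f1 z))

/-- Cylinders in time, position and velocity around a free transport trajectory. -/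
def cyl (T T₂ R P : ℝ) (x₀ v₀ : E d) (s : ℝ) : Set (Z d) :=
  {z | 0 ≤ z.1 - T * (1 - s / 2) ∧ 0 ≤ T₂ + s * T - z.1 ∧ 0 ≤ R ^ 2 * (1 + s) - ‖z.2.2 - v₀‖ ^ 2 ∧
    0 ≤ P ^ 2 * (1 + s) - ‖z.2.1 - x₀ - z.1 • v₀‖ ^ 2}

theorem isClosed_cyl (T T₂ R P : ℝ) (x₀ v₀ : E d) (s : ℝ) :
    IsClosed (cyl T T₂ R P x₀ v₀ s) := by
  have h1 : IsClosed {z : Z d | 0 ≤ z.1 - T * (1 - s / 2)} :=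
    isClosed_le continuous_const (by fun_prop)
  have h2 : IsClosed {z : Z d | 0 ≤ T₂ + s * T - z.1} :=
    isClosed_le continuous_const (by fun_prop)
  have h3 : IsClosed {z : Z d | 0 ≤ R ^ 2 * (1 + s) - ‖z.2.2 - v₀‖ ^ 2} :=
    isClosed_le continuous_const (by fun_prop)
  have h4 : IsClosed {z : Z d | 0 ≤ P ^ 2 * (1 + s) - ‖z.2.1 - x₀ - z.1 • v₀‖ ^ 2} :=
    isClosed_le continuous_const (by fun_prop)
  exact h1.inter (h2.inter (h3.inter h4))

theorem isCompact_cyl (T T₂ R P : ℝ) (x₀ v₀ : E d) (s : ℝ) :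
    IsCompact (cyl T T₂ R P x₀ v₀ s) := by
  set a := |T * (1 - s / 2)| + |T₂ + s * T| with ha
  have hsub : cyl T T₂ R P x₀ v₀ s ⊆ Set.Icc (-a) a ×ˢ
      (Metric.closedBall (0 : E d) (‖x₀‖ + a * ‖v₀‖ + √(P ^ 2 * (1 + s))) ×ˢ
        Metric.closedBall v₀ (√(R ^ 2 * (1 + s)))) := by
    rintro ⟨t, x, v⟩ ⟨h1, h2, h3, h4⟩
    simp only at h1 h2 h3 h4
    have ht : |t| ≤ a := by
      rw [abs_le]
      have := neg_abs_le (T * (1 - s / 2))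
      have := le_abs_self (T₂ + s * T)
      have := abs_nonneg (T * (1 - s / 2))
      have := abs_nonneg (T₂ + s * T)
      constructor <;> linarith
    refine ⟨abs_le.1 ht, ?_, ?_⟩
    · rw [mem_closedBall_zero_iff]
      have e : x = x₀ + t • v₀ + (x - x₀ - t • v₀) := by abel
      have h5 : ‖x - x₀ - t • v₀‖ ≤ √(P ^ 2 * (1 + s)) := Real.le_sqrt_of_sq_le (by linarith)
      have h6 : ‖t • v₀‖ ≤ a * ‖v₀‖ := by
        rw [norm_smul]
        exact mul_le_mul_of_nonneg_right ht (norm_nonneg _)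
      simp only
      rw [e]
      refine (norm_add_le _ _).trans (add_le_add ((norm_add_le _ _).trans
        (add_le_add le_rfl h6)) h5)
    · rw [mem_closedBall_iff_norm]
      exact Real.le_sqrt_of_sq_le (by linarith)
  exact (isCompact_Icc.prod ((isCompact_closedBall _ _).prod
    (isCompact_closedBall _ _))).of_isClosed_subset (isClosed_cyl _ _ _ _ _ _ _) hsub

theorem cyl_mono {T T₂ R P : ℝ} (hT : 0 ≤ T) (x₀ v₀ : E d) {s s' : ℝ} (h : s ≤ s') :
    cyl T T₂ R P x₀ v₀ s ⊆ cyl T T₂ R P x₀ v₀ s' := by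
  rintro z ⟨h1, h2, h3, h4⟩
  refine ⟨?_, ?_, ?_, ?_⟩ <;> nlinarith [sq_nonneg R, sq_nonneg P]

-- The cutoff is a product of four ramps. Ramps in time have width comparable to T, so their
-- derivative is of order 1/T = (1/√T)². The velocity gradient is of order 1/R ≤ 1/√T. The position
-- ramp is written in the frame moving with v₀, so its transport derivative involves only v − v₀ and
-- is of order R/P ≤ 1/T. R and P are bounded only from below, which later lets the cylinders
-- exhaust the space. The largest cylinder starts at T/2 > τ.
set_option maxHeartbeats 1000000 in
theorem exists_isScale_cyl (d : ℕ) : ∃ C : ℝ, 0 < C ∧ ∀ (τ T T₂ R P : ℝ) (x₀ v₀ : E d),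
    0 < T → τ < T / 2 → 0 < R → T ≤ R ^ 2 → R * T ≤ P →
    IsScale τ (C / √T) (cyl T T₂ R P x₀ v₀) := by
  obtain ⟨c0, hc1, hc0⟩ := exists_smoothTransition_bound
  -- For the transport derivative 7 = 2 + 1 + 4: the lower time ramp has half the width, the upper
  -- one the full width, and the position ramp contributes 4. The velocity gradient needs only 4.
  refine ⟨7 * c0, by positivity, fun τ T T₂ R P x₀ v₀ hT hτ hR hTR hRP => ?_⟩
  have hP : 0 < P := lt_of_lt_of_le (by positivity) hRP
  refine ⟨fun s _ _ => isCompact_cyl _ _ _ _ _ _ _, fun s s' _ h _ => cyl_mono hT.le _ _ h,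
    fun s s' hs hss hs' => ?_⟩
  have hδ : 0 < s' - s := sub_pos.2 hss
  have hδ1 : s' - s ≤ 1 := by linarith
  set δ := s' - s with hδdef
  have n1 : ContDiff ℝ ∞ fun z : Z d => z.1 - T * (1 - s' / 2) := by fun_prop
  have n2 : ContDiff ℝ ∞ fun z : Z d => T₂ + s' * T - z.1 := by fun_prop
  have n3 : ContDiff ℝ ∞ fun z : Z d => R ^ 2 * (1 + s') - ‖z.2.2 - v₀‖ ^ 2 :=
    contDiff_const.sub (ContDiff.norm_sq ℝ (by fun_prop))
  have n4 : ContDiff ℝ ∞ fun z : Z d => P ^ 2 * (1 + s') - ‖z.2.1 - x₀ - z.1 • v₀‖ ^ 2 :=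
    contDiff_const.sub (ContDiff.norm_sq ℝ (by fun_prop))
  obtain ⟨r1, p1, q1, a1, b1, d1⟩ := ramp_spec n1 (by positivity : 0 < T * (δ / 2))
  obtain ⟨r2, p2, q2, a2, b2, d2⟩ := ramp_spec n2 (by positivity : 0 < δ * T)
  obtain ⟨r3, p3, q3, a3, b3, d3⟩ := ramp_spec n3 (by positivity : 0 < R ^ 2 * δ)
  obtain ⟨r4, p4, q4, a4, b4, d4⟩ := ramp_spec n4 (by positivity : 0 < P ^ 2 * δ)
  have f1 : ∀ z w : Z d, fderiv ℝ (fun z : Z d => z.1 - T * (1 - s' / 2)) z w = w.1 := by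
    intro z w
    have h : HasFDerivAt (fun z : Z d => z.1 - T * (1 - s' / 2))
      (ContinuousLinearMap.fst ℝ ℝ (E d × E d)) z := hasFDerivAt_fst.sub_const _
    rw [h.fderiv]; rfl
  have f2 : ∀ z w : Z d, fderiv ℝ (fun z : Z d => T₂ + s' * T - z.1) z w = -w.1 := by
    intro z w
    have h : HasFDerivAt (fun z : Z d => T₂ + s' * T - z.1)
      (-ContinuousLinearMap.fst ℝ ℝ (E d × E d)) z := hasFDerivAt_fst.const_sub _
    rw [h.fderiv]; rfl
  have f3 : ∀ z w : Z d, fderiv ℝ (fun z : Z d => R ^ 2 * (1 + s') - ‖z.2.2 - v₀‖ ^ 2) z w =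
      -(2 * inner ℝ (z.2.2 - v₀) w.2.2) := by
    intro z w
    have h0 : HasFDerivAt (fun z : Z d => z.2.2 - v₀) ((ContinuousLinearMap.snd ℝ (E d) (E d)).comp
      (ContinuousLinearMap.snd ℝ ℝ (E d × E d))) z :=
      (hasFDerivAt_snd.comp z hasFDerivAt_snd).sub_const _
    rw [(h0.norm_sq.const_sub _).fderiv]
    simp [inner_sub_left]
  have f4 : ∀ z w : Z d,
      fderiv ℝ (fun z : Z d => P ^ 2 * (1 + s') - ‖z.2.1 - x₀ - z.1 • v₀‖ ^ 2) z w =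
      -(2 * inner ℝ (z.2.1 - x₀ - z.1 • v₀) (w.2.1 - w.1 • v₀)) := by
    intro z w
    have h0 : HasFDerivAt (fun z : Z d => z.2.1 - x₀ - z.1 • v₀)
      ((ContinuousLinearMap.fst ℝ (E d) (E d)).comp (ContinuousLinearMap.snd ℝ ℝ (E d × E d)) -
        (ContinuousLinearMap.fst ℝ ℝ (E d × E d)).smulRight v₀) z :=
      ((hasFDerivAt_fst.comp z hasFDerivAt_snd).sub_const _).sub (hasFDerivAt_fst.smul_const v₀)
    rw [(h0.norm_sq.const_sub _).fderiv]
    simp [inner_sub_left, inner_sub_right, inner_smul_left, inner_smul_right]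
    ring
  set ρ1 := ramp (fun z : Z d => z.1 - T * (1 - s' / 2)) (T * (δ / 2))
  set ρ2 := ramp (fun z : Z d => T₂ + s' * T - z.1) (δ * T)
  set ρ3 := ramp (fun z : Z d => R ^ 2 * (1 + s') - ‖z.2.2 - v₀‖ ^ 2) (R ^ 2 * δ)
  set ρ4 := ramp (fun z : Z d => P ^ 2 * (1 + s') - ‖z.2.1 - x₀ - z.1 • v₀‖ ^ 2) (P ^ 2 * δ)
  set χ : Z d → ℝ := fun z => (ρ1 z * ρ2 z) * (ρ3 z * ρ4 z) with hχ
  have hsupp : tsupport χ ⊆ cyl T T₂ R P x₀ v₀ s' := by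
    refine closure_minimal (fun z hz => ?_) (isClosed_cyl _ _ _ _ _ _ _)
    have hz' : (ρ1 z * ρ2 z) * (ρ3 z * ρ4 z) ≠ 0 := hz
    refine ⟨?_, ?_, ?_, ?_⟩ <;> by_contra hneg <;> apply hz'
    · rw [b1 z (not_le.1 hneg).le]; ring
    · rw [b2 z (not_le.1 hneg).le]; ring
    · rw [b3 z (not_le.1 hneg).le]; ring
    · rw [b4 z (not_le.1 hneg).le]; ring
  have hfd : ∀ z w, |fderiv ℝ χ z w| ≤ (|fderiv ℝ ρ1 z w| + |fderiv ℝ ρ2 z w|) +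
      (|fderiv ℝ ρ3 z w| + |fderiv ℝ ρ4 z w|) := fun z w =>
    (abs_fderiv_mul_le (r1.mul r2) (r3.mul r4) (fun z => mul_nonneg (p1 z) (p2 z))
      (fun z => mul_le_one₀ (q1 z) (p2 z) (q2 z)) (fun z => mul_nonneg (p3 z) (p4 z))
      (fun z => mul_le_one₀ (q3 z) (p4 z) (q4 z)) z w).trans
      (add_le_add (abs_fderiv_mul_le r1 r2 p1 q1 p2 q2 z w)
        (abs_fderiv_mul_le r3 r4 p3 q3 p4 q4 z w))
  have hsT : √T ≤ R := Real.sqrt_le_iff.2 ⟨hR.le, hTR⟩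
  have hsT0 : 0 < √T := Real.sqrt_pos.2 hT
  refine ⟨χ, ⟨(r1.mul r2).mul (r3.mul r4), ?_, fun z hz => ?_, fun z =>
    mul_nonneg (mul_nonneg (p1 z) (p2 z)) (mul_nonneg (p3 z) (p4 z)), fun z => ?_, hsupp,
    fun z e => ?_, fun z => ?_⟩, fun z hz => ?_⟩
  · exact (isCompact_cyl _ _ _ _ _ _ _).of_isClosed_subset (isClosed_tsupport _) hsupp
  · have := (hsupp hz).1
    nlinarith
  · exact mul_le_one₀ (mul_le_one₀ (q1 z) (p2 z) (q2 z)) (mul_nonneg (p3 z) (p4 z))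
      (mul_le_one₀ (q3 z) (p4 z) (q4 z))
  · by_cases hz : z ∈ tsupport χ
    · obtain ⟨-, -, h3, -⟩ := hsupp hz
      refine (hfd z _).trans ?_
      have g1 := d1 c0 hc0 z (0, 0, e)
      have g2 := d2 c0 hc0 z (0, 0, e)
      have g3 := d3 c0 hc0 z (0, 0, e)
      have g4 := d4 c0 hc0 z (0, 0, e)
      rw [f1] at g1
      rw [f2] at g2
      rw [f3] at g3
      rw [f4] at g4
      simp only [neg_zero, abs_zero, zero_div, mul_zero, zero_smul, sub_zero, inner_zero_right,
        abs_neg] at g1 g2 g3 g4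
      have hv : ‖z.2.2 - v₀‖ ≤ 2 * R := by
        refine (sq_le_sq₀ (by positivity) (by positivity)).1 ?_
        nlinarith [sq_nonneg R]
      have hin : |2 * inner ℝ (z.2.2 - v₀) e| / (R ^ 2 * δ) ≤ 4 / (√T * δ) * ‖e‖ := by
        rw [abs_mul, abs_two]
        have h5 : |inner ℝ (z.2.2 - v₀) e| ≤ 2 * R * ‖e‖ :=
          (abs_real_inner_le_norm _ _).trans (mul_le_mul_of_nonneg_right hv (norm_nonneg _))
        calc 2 * |inner ℝ (z.2.2 - v₀) e| / (R ^ 2 * δ) ≤ 2 * (2 * R * ‖e‖) / (R ^ 2 * δ) := by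
              gcongr
          _ = 4 / (R * δ) * ‖e‖ := by field_simp; ring
          _ ≤ _ := by gcongr
      have h6 : c0 * (4 / (√T * δ) * ‖e‖) ≤ 7 * c0 / √T / δ * ‖e‖ := by
        have : 7 * c0 / √T / δ * ‖e‖ = c0 * (7 / (√T * δ) * ‖e‖) := by field_simp
        rw [this]
        gcongr
        norm_num
      have h7 := mul_le_mul_of_nonneg_left hin (by positivity : 0 ≤ c0)
      linarith
    · rw [velDeriv, fderiv_eq_zero_of_notMem hz]
      simp
      positivity
  · have hrhs : 7 * c0 * (1 / (T * δ)) ≤ (7 * c0 / √T / δ) ^ 2 := by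
      have e : (7 * c0 / √T / δ) ^ 2 = (7 * c0) ^ 2 * (1 / (T * δ ^ 2)) := by
        rw [div_pow, div_pow, Real.sq_sqrt hT.le]
        field_simp
      rw [e]
      have e1 : 7 * c0 ≤ (7 * c0) ^ 2 := by nlinarith
      have e2 : T * δ ^ 2 ≤ T * δ :=
        mul_le_mul_of_nonneg_left (by nlinarith) hT.le
      gcongr
    refine le_trans ?_ hrhs
    by_cases hz : z ∈ tsupport χ
    · obtain ⟨-, -, h3, h4⟩ := hsupp hz
      refine (hfd z _).trans ?_
      have g1 := d1 c0 hc0 z (1, z.2.2, 0)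
      have g2 := d2 c0 hc0 z (1, z.2.2, 0)
      have g3 := d3 c0 hc0 z (1, z.2.2, 0)
      have g4 := d4 c0 hc0 z (1, z.2.2, 0)
      rw [f1] at g1
      rw [f2] at g2
      rw [f3] at g3
      rw [f4] at g4
      simp only [neg_zero, abs_zero, zero_div, mul_zero, one_smul, inner_zero_right,
        abs_neg, abs_one] at g1 g2 g3 g4
      have hin : |2 * inner ℝ (z.2.1 - x₀ - z.1 • v₀) (z.2.2 - v₀)| / (P ^ 2 * δ) ≤
          4 * (1 / (T * δ)) := by
        rw [abs_mul, abs_two]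
        have h5 : |inner ℝ (z.2.1 - x₀ - z.1 • v₀) (z.2.2 - v₀)| ≤ 2 * (P * R) := by
          refine (abs_real_inner_le_norm _ _).trans ?_
          have k3 : ‖z.2.2 - v₀‖ ^ 2 ≤ 2 * R ^ 2 := by nlinarith [sq_nonneg R]
          have k4 : ‖z.2.1 - x₀ - z.1 • v₀‖ ^ 2 ≤ 2 * P ^ 2 := by nlinarith [sq_nonneg P]
          refine (sq_le_sq₀ (by positivity) (by positivity)).1 ?_
          rw [mul_pow]
          refine (mul_le_mul k4 k3 (sq_nonneg _) (by positivity)).trans (le_of_eq (by ring))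
        calc 2 * |inner ℝ (z.2.1 - x₀ - z.1 • v₀) (z.2.2 - v₀)| / (P ^ 2 * δ)
            ≤ 2 * (2 * (P * R)) / (P ^ 2 * δ) := by gcongr
          _ = 4 * (R / (P * δ)) := by field_simp; ring
          _ ≤ 4 * (1 / (T * δ)) := by
              refine mul_le_mul_of_nonneg_left ?_ (by norm_num)
              rw [div_le_div_iff₀ (by positivity) (by positivity)]
              nlinarith
      have h7 := mul_le_mul_of_nonneg_left hin (by positivity : 0 ≤ c0)
      have h8 : c0 * (1 / (T * (δ / 2))) = 2 * (c0 * (1 / (T * δ))) := by field_simp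
      have h9 : c0 * (1 / (δ * T)) = c0 * (1 / (T * δ)) := by rw [mul_comm δ T]
      linarith
    · rw [transport, fderiv_eq_zero_of_notMem hz]
      simp
      positivity
  · obtain ⟨h1, h2, h3, h4⟩ := hz
    have hδs : s' = s + δ := by rw [hδdef]; ring
    have e1 : ρ1 z = 1 := a1 z (by rw [hδs]; nlinarith)
    have e2 : ρ2 z = 1 := a2 z (by rw [hδs]; nlinarith)
    have e3 : ρ3 z = 1 := a3 z (by rw [hδs]; nlinarith)
    have e4 : ρ4 z = 1 := a4 z (by rw [hδs]; nlinarith)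
    simp [hχ, e1, e2, e3, e4]

end Cylinder

/-! ### Integrability of the flux on time slabs. -/

section Flux

variable {d : ℕ}

/-- Points with time in `[a, b]`. -/
def slab (d : ℕ) (a b : ℝ) : Set (Z d) := {z | a ≤ z.1 ∧ z.1 ≤ b}

theorem measurableSet_slab (a b : ℝ) : MeasurableSet (slab d a b) :=
  (measurableSet_le measurable_const measurable_fst).inter
    (measurableSet_le measurable_fst measurable_const)

theorem LocL2.aestronglyMeasurable {V : Type*} [NormedAddCommGroup V] {f : Z d → V}
    (hf : LocL2 f) : AEStronglyMeasurable f := by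
  have h : AEStronglyMeasurable f (volume.restrict (⋃ n : ℕ, Metric.closedBall (0 : Z d) n)) :=
    aestronglyMeasurable_iUnion_iff.2 fun n =>
      (hf _ (isCompact_closedBall _ _)).aestronglyMeasurable
  rwa [Metric.iUnion_closedBall_nat, Measure.restrict_univ] at h

/-- Left translation by (0, p) is a Galilean change of frame, which adds p to the centre; it makes
all cylinders congruent and the local constants independent of the centre. -/
theorem cyl_eq_preimage (T T₂ R P s : ℝ) (p : E d × E d) :
    cyl T T₂ R P (-p.1) (-p.2) s = lt (0, p) ⁻¹' cyl T T₂ R P 0 0 s := by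
  ext z
  have e1 : z.2.2 - -p.2 = p.2 + z.2.2 - 0 := by abel
  have e2 : z.2.1 - -p.1 - z.1 • -p.2 = p.1 + z.2.1 + z.1 • p.2 - 0 - (0 + z.1) • 0 := by
    simp only [smul_neg, smul_zero]; abel
  simp only [cyl, lt, Set.mem_ofPred_eq, Set.mem_preimage, e1, e2, zero_add]

theorem volume_cyl (T T₂ R P s : ℝ) (p : E d × E d) :
    volume (cyl T T₂ R P (-p.1) (-p.2) s) = volume (cyl T T₂ R P (0 : E d) 0 s) := by
  rw [cyl_eq_preimage]
  exact (measurePreserving_lt _).measure_preimage (isClosed_cyl _ _ _ _ _ _ _).nullMeasurableSet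

/-- Caccioppoli between the parameters 0 and 1/2 bounds the flux in L² by u in L², the reverse
Hölder inequality between 1/2 and 1 bounds that by the mass, and Cauchy–Schwarz passes from L² to L¹
of the flux. -/
theorem exists_flux_cyl {lam Lam : ℝ} (hlam : 0 < lam) (hLam : 0 < Lam) {τ T T₂ : ℝ}
    (hT : 0 < T) (hτ : τ < T / 2) {R P : ℝ} (hR : 0 < R) (hTR : T ≤ R ^ 2) (hRP : R * T ≤ P) :
    ∃ C : ℝ≥0∞, C ≠ ⊤ ∧ ∀ (u : Z d → ℝ) (g h : Z d → E d), IsSub lam Lam τ u g h →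
      ∀ p : E d × E d, ∫⁻ z in cyl T T₂ R P (-p.1) (-p.2) 0, ‖h z‖ₑ ≤
        C * ∫⁻ z in cyl T T₂ R P (-p.1) (-p.2) 1, ‖u z‖ₑ := by
  obtain ⟨A0, hA0, hscale⟩ := exists_isScale_cyl d
  obtain ⟨C, hC, hrh⟩ := exists_reverse_holder d hlam hLam
  set A := A0 / √T with hA
  have hA' : 0 < A := by have := Real.sqrt_pos.2 hT; positivity
  set C1 : ℝ := Lam * ((4 * Lam + 2) * (A / (1 / 2 - 0)) ^ 2 *
    (C * (A / (1 - 1 / 2)) ^ (4 * d + 2))) with hC1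
  have hC10 : 0 ≤ C1 := by positivity
  set K : ℝ≥0∞ := volume (cyl T T₂ R P (0 : E d) 0 0) * ENNReal.ofReal C1 with hK
  have hKt : K ≠ ⊤ := ENNReal.mul_ne_top (isCompact_cyl _ _ _ _ _ _ _).measure_lt_top.ne
    ENNReal.ofReal_ne_top
  -- From X² ≤ K Y² one gets X ≤ (K + 1) Y, because K ≤ (K + 1)²; this avoids a square root of K.
  refine ⟨K + 1, by simp [hKt], fun u g h hu p => ?_⟩
  have hD := hscale τ T T₂ R P (-p.1) (-p.2) hT hτ hR hTR hRP
  set D := cyl T T₂ R P (-p.1) (-p.2) with hDdef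
  have hDc : ∀ s, IsCompact (D s) := fun s => isCompact_cyl _ _ _ _ _ _ _
  obtain ⟨χ, hχ, hχ1⟩ := hD.cutoff 0 (1 / 2) le_rfl (by norm_num) (by norm_num)
  obtain ⟨hEi, hE⟩ := hu.energy hlam hLam (hDc _) hχ
  have hrh' := hrh τ u g h hu A D hA' hD (1 / 2) 1 (by norm_num) (by norm_num) le_rfl
  have hh2 : IntegrableOn (fun z => ‖h z‖ ^ 2) (D 0) := hu.locL2_flux.integrableOn_sq (hDc 0)
  have hu1 : IntegrableOn u (D 1) := hu.locL2_fst.integrableOn (hDc 1)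
  have hreal : ∫ z in D 0, ‖h z‖ ^ 2 ≤ C1 * (∫ z in D 1, u z) ^ 2 := by
    have h1 : ∫ z in D 0, ‖h z‖ ^ 2 ≤ ∫ z, Lam * (χ z ^ 2 * inner ℝ (h z) (g z)) := by
      rw [← integral_indicator (hDc 0).measurableSet]
      refine integral_mono_of_nonneg (Eventually.of_forall fun z =>
        Set.indicator_nonneg (fun _ _ => sq_nonneg _) z) (hEi.const_mul _)
        (Eventually.of_forall fun z => ?_)
      by_cases hz : z ∈ D 0
      · simp only [Set.indicator_of_mem hz, hχ1 z hz]
        linarith [hu.upper z]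
      · simp only [Set.indicator_of_notMem hz]
        exact mul_nonneg hLam.le (mul_nonneg (sq_nonneg _) (hu.inner_nonneg hlam z))
    rw [integral_const_mul] at h1
    refine h1.trans ?_
    rw [hC1, mul_assoc]
    refine mul_le_mul_of_nonneg_left (hE.trans ?_) hLam.le
    rw [mul_assoc ((4 * Lam + 2) * (A / (1 / 2 - 0)) ^ 2)]
    exact mul_le_mul_of_nonneg_left hrh' (by positivity)
  have hE1 : ∫⁻ z in D 0, ‖h z‖ₑ ^ 2 ≤ ENNReal.ofReal C1 * (∫⁻ z in D 1, ‖u z‖ₑ) ^ 2 := by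
    have e1 : ∫⁻ z in D 0, ‖h z‖ₑ ^ 2 = ENNReal.ofReal (∫ z in D 0, ‖h z‖ ^ 2) := by
      rw [ofReal_integral_eq_lintegral_ofReal hh2 (Eventually.of_forall fun z => sq_nonneg _)]
      refine lintegral_congr fun z => ?_
      rw [← ofReal_norm, ENNReal.ofReal_pow (norm_nonneg _)]
    have e2 : ∫⁻ z in D 1, ‖u z‖ₑ = ENNReal.ofReal (∫ z in D 1, u z) := by
      rw [ofReal_integral_eq_lintegral_ofReal hu1 (Eventually.of_forall fun z => hu.nonneg z)]
      refine lintegral_congr fun z => ?_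
      rw [← ofReal_norm, Real.norm_of_nonneg (hu.nonneg z)]
    rw [e1, e2, ← ENNReal.ofReal_pow (integral_nonneg fun z => hu.nonneg z),
      ← ENNReal.ofReal_mul hC10]
    exact ENNReal.ofReal_le_ofReal hreal
  have hcs := lintegral_sq_le (κ := volume.restrict (D 0)) (φ := fun z => ‖h z‖ₑ)
    hu.locL2_flux.aestronglyMeasurable.restrict.enorm
  rw [Measure.restrict_apply_univ, hDdef, volume_cyl] at hcs
  refine (ENNReal.pow_right_strictMono two_ne_zero).le_iff_le.1 (hcs.trans ?_)
  calc _ ≤ volume (cyl T T₂ R P (0 : E d) 0 0) *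
        (ENNReal.ofReal C1 * (∫⁻ z in D 1, ‖u z‖ₑ) ^ 2) := by gcongr
    _ = K * (∫⁻ z in D 1, ‖u z‖ₑ) ^ 2 := by rw [hK, mul_assoc]
    _ ≤ (K + 1) ^ 2 * (∫⁻ z in D 1, ‖u z‖ₑ) ^ 2 := by
        gcongr
        calc K ≤ K + 1 := le_self_add
          _ = (K + 1) * 1 := (mul_one _).symm
          _ ≤ (K + 1) * (K + 1) := by gcongr; exact le_add_self
          _ = (K + 1) ^ 2 := (sq _).symm
    _ = _ := (mul_pow _ _ _).symm

/-- The measure of the set of cylinder centres whose cylinder contains a given point. -/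
theorem lintegral_indicator_cyl (T T₂ R P s : ℝ) : ∃ c : ℝ≥0∞, c ≠ ⊤ ∧
    (0 < R → 0 < P → 0 ≤ s → c ≠ 0) ∧ ∀ z : Z d,
    ∫⁻ p : E d × E d, (cyl T T₂ R P (0 : E d) 0 s).indicator 1 (lt (0, p) z) =
      (slab d (T * (1 - s / 2)) (T₂ + s * T)).indicator (fun _ => c) z := by
  set B : Set (E d × E d) := {p | 0 ≤ R ^ 2 * (1 + s) - ‖p.2‖ ^ 2 ∧
    0 ≤ P ^ 2 * (1 + s) - ‖p.1‖ ^ 2} with hB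
  have hBm : MeasurableSet B :=
    ((isClosed_le continuous_const (by fun_prop : Continuous fun p : E d × E d =>
      R ^ 2 * (1 + s) - ‖p.2‖ ^ 2)).inter
    (isClosed_le continuous_const (by fun_prop : Continuous fun p : E d × E d =>
      P ^ 2 * (1 + s) - ‖p.1‖ ^ 2))).measurableSet
  refine ⟨volume B, ?_, fun hR hP hs => ?_, fun z => ?_⟩
  · have hsub : B ⊆ Metric.closedBall (0 : E d) (√(P ^ 2 * (1 + s))) ×ˢ
        Metric.closedBall (0 : E d) (√(R ^ 2 * (1 + s))) := by
      rintro p ⟨h1, h2⟩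
      simp only [Set.mem_prod, mem_closedBall_zero_iff]
      exact ⟨Real.le_sqrt_of_sq_le (by linarith), Real.le_sqrt_of_sq_le (by linarith)⟩
    exact ((measure_mono hsub).trans_lt
      ((isCompact_closedBall _ _).prod (isCompact_closedBall _ _)).measure_lt_top).ne
  · have hsub : Metric.ball (0 : E d) P ×ˢ Metric.ball (0 : E d) R ⊆ B := by
      rintro p ⟨h1, h2⟩
      rw [mem_ball_zero_iff] at h1 h2
      have k1 := pow_le_pow_left₀ (norm_nonneg _) h1.le 2
      have k2 := pow_le_pow_left₀ (norm_nonneg _) h2.le 2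
      constructor <;> nlinarith [sq_nonneg R, sq_nonneg P]
    refine (lt_of_lt_of_le ?_ (measure_mono hsub)).ne'
    exact (Metric.isOpen_ball.prod Metric.isOpen_ball).measure_pos _
      ⟨0, by simp [hP, hR]⟩
  -- As a function of p, the position and velocity of (0, p) ∘ z are a shear composed with a
  -- translation, so the set of admissible centres has the volume of B whatever z is.
  · have hmp : MeasurePreserving (fun p : E d × E d =>
        (p.1 + z.2.1 + z.1 • p.2, p.2 + z.2.2)) := by
      have h1 : MeasurePreserving (fun q : E d × E d =>
          (q.1 + z.2.2, q.2 + (z.2.1 + z.1 • q.1))) := by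
        refine MeasurePreserving.skew_product (g := fun v x => x + (z.2.1 + z.1 • v))
          (measurePreserving_add_right volume z.2.2) (by fun_prop)
          (Eventually.of_forall fun v => ?_)
        exact (measurePreserving_add_right volume (z.2.1 + z.1 • v)).map_eq
      have h2 : MeasurePreserving (Prod.swap ∘ (fun q : E d × E d =>
          (q.1 + z.2.2, q.2 + (z.2.1 + z.1 • q.1))) ∘ Prod.swap) :=
        (Measure.measurePreserving_swap (μ := (volume : Measure (E d)))
        (ν := (volume : Measure (E d)))).comp (h1.comp (Measure.measurePreserving_swap
          (μ := (volume : Measure (E d))) (ν := (volume : Measure (E d)))))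
      convert h2 using 2 with p
      simp [add_assoc]
    by_cases hz : z ∈ slab d (T * (1 - s / 2)) (T₂ + s * T)
    · rw [Set.indicator_of_mem hz]
      have e : ∀ p : E d × E d, (cyl T T₂ R P (0 : E d) 0 s).indicator (1 : Z d → ℝ≥0∞)
          (lt (0, p) z) = B.indicator 1 (p.1 + z.2.1 + z.1 • p.2, p.2 + z.2.2) := by
        intro p
        obtain ⟨z1, z2⟩ := hz
        simp only [Set.indicator_apply, cyl, lt, hB, Set.mem_ofPred_eq, sub_zero, smul_zero,
          zero_add, sub_nonneg, z1, z2, true_and, Pi.one_apply]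
      simp_rw [e]
      rw [hmp.lintegral_comp (measurable_one.indicator hBm), lintegral_indicator_one hBm]
    · rw [Set.indicator_of_notMem hz]
      have e : ∀ p : E d × E d, (cyl T T₂ R P (0 : E d) 0 s).indicator (1 : Z d → ℝ≥0∞)
          (lt (0, p) z) = 0 := by
        intro p
        refine Set.indicator_of_notMem (fun h => hz ?_) _
        obtain ⟨h1, h2, -, -⟩ := h
        simp only [lt, zero_add, sub_nonneg] at h1 h2
        exact ⟨h1, h2⟩
      simp_rw [e]
      simp

/-- By Tonelli, every point of the slab is covered by the same volume c of centres. An estimate on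
all cylinders thus integrates to an estimate on the slab, and c ≠ 0 allows division by it. -/
theorem lintegral_lintegral_cyl (T T₂ R P s : ℝ) : ∃ c : ℝ≥0∞, c ≠ ⊤ ∧
    (0 < R → 0 < P → 0 ≤ s → c ≠ 0) ∧ ∀ F : Z d → ℝ≥0∞, AEMeasurable F →
    ∫⁻ p : E d × E d, ∫⁻ z in cyl T T₂ R P (-p.1) (-p.2) s, F z =
      c * ∫⁻ z in slab d (T * (1 - s / 2)) (T₂ + s * T), F z := by
  obtain ⟨c, hc, hc0, hcz⟩ := lintegral_indicator_cyl (d := d) T T₂ R P s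
  refine ⟨c, hc, hc0, fun F hF => ?_⟩
  have hm : MeasurableSet (cyl T T₂ R P (0 : E d) 0 s) := (isClosed_cyl _ _ _ _ _ _ _).measurableSet
  have e1 : ∀ p : E d × E d, ∫⁻ z in cyl T T₂ R P (-p.1) (-p.2) s, F z =
      ∫⁻ z, (cyl T T₂ R P (0 : E d) 0 s).indicator 1 (lt (0, p) z) * F z := by
    intro p
    rw [cyl_eq_preimage, ← lintegral_indicator ((measurePreserving_lt _).measurable hm)]
    refine lintegral_congr fun z => ?_
    by_cases hz : lt (0, p) z ∈ cyl T T₂ R P (0 : E d) 0 s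
    · rw [Set.indicator_of_mem (by exact hz), Set.indicator_of_mem hz]; simp
    · rw [Set.indicator_of_notMem (by exact hz), Set.indicator_of_notMem hz]; simp
  simp_rw [e1]
  have hmeas : Measurable fun q : (E d × E d) × Z d =>
      (cyl T T₂ R P (0 : E d) 0 s).indicator (1 : Z d → ℝ≥0∞) (lt (0, q.1) q.2) := by
    refine (measurable_one.indicator hm).comp ?_
    exact ((contDiff_lt (n := 0)).continuous.comp (by fun_prop :
      Continuous fun q : (E d × E d) × Z d => (((0, q.1) : Z d), q.2))).measurable
  rw [lintegral_lintegral_swap]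
  · have e2 : ∀ z : Z d, ∫⁻ p : E d × E d,
        (cyl T T₂ R P (0 : E d) 0 s).indicator 1 (lt (0, p) z) * F z =
        (slab d (T * (1 - s / 2)) (T₂ + s * T)).indicator (fun z => c * F z) z := by
      intro z
      have hmz : Measurable fun p : E d × E d =>
          (cyl T T₂ R P (0 : E d) 0 s).indicator (1 : Z d → ℝ≥0∞) (lt (0, p) z) :=
        hmeas.comp measurable_prodMk_right
      rw [lintegral_mul_const _ hmz, hcz]
      by_cases hz : z ∈ slab d (T * (1 - s / 2)) (T₂ + s * T)
      · rw [Set.indicator_of_mem hz, Set.indicator_of_mem hz]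
      · rw [Set.indicator_of_notMem hz, Set.indicator_of_notMem hz, zero_mul]
    simp_rw [e2]
    rw [lintegral_indicator (measurableSet_slab _ _), lintegral_const_mul' _ _ hc]
  · exact hmeas.aemeasurable.mul
      (hF.comp_quasiMeasurePreserving Measure.quasiMeasurePreserving_snd)

/-- Integrability of the flux of an integrable subsolution. -/
theorem IsSub.lintegral_flux_lt_top {lam Lam τ : ℝ} {u : Z d → ℝ} {g h : Z d → E d}
    (hu : IsSub lam Lam τ u g h) (hlam : 0 < lam) (hLam : 0 < Lam) {T T₂ : ℝ} (hT : 0 < T)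
    (hτ : τ < T / 2) (hfin : ∫⁻ z in slab d (T / 2) (T₂ + T), ‖u z‖ₑ ≠ ⊤) :
    ∫⁻ z in slab d T T₂, ‖h z‖ₑ ≠ ⊤ := by
  have hR : 0 < √T := Real.sqrt_pos.2 hT
  have hP : 0 < √T * T := by positivity
  -- The smallest admissible cylinders: R = √T and P = R T.
  obtain ⟨C, hC, hloc⟩ := exists_flux_cyl (d := d) (T₂ := T₂) hlam hLam hT hτ hR
    (Real.sq_sqrt hT.le).ge le_rfl
  obtain ⟨c0, hc0, hc0', h0⟩ := lintegral_lintegral_cyl (d := d) T T₂ (√T) (√T * T) 0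
  obtain ⟨c1, hc1, -, h1⟩ := lintegral_lintegral_cyl (d := d) T T₂ (√T) (√T * T) 1
  have k0 := h0 (fun z => ‖h z‖ₑ) hu.locL2_flux.aestronglyMeasurable.enorm
  have k1 := h1 (fun z => ‖u z‖ₑ) hu.locL2_fst.aestronglyMeasurable.enorm
  have e0 : T * (1 - 0 / 2) = T := by ring
  have e0' : T₂ + 0 * T = T₂ := by ring
  have e1 : T * (1 - 1 / 2) = T / 2 := by ring
  have e1' : T₂ + 1 * T = T₂ + T := by ring
  rw [e0, e0'] at k0
  rw [e1, e1'] at k1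
  have hle : c0 * ∫⁻ z in slab d T T₂, ‖h z‖ₑ ≤
      C * (c1 * ∫⁻ z in slab d (T / 2) (T₂ + T), ‖u z‖ₑ) := by
    rw [← k0, ← k1, ← lintegral_const_mul' _ _ hC]
    exact lintegral_mono fun p => hloc u g h hu p
  have hlt : c0 * ∫⁻ z in slab d T T₂, ‖h z‖ₑ ≠ ⊤ :=
    ne_top_of_le_ne_top (ENNReal.mul_ne_top hC (ENNReal.mul_ne_top hc1 hfin)) hle
  intro htop
  rw [htop, ENNReal.mul_top (hc0' hR hP le_rfl)] at hlt
  exact hlt rfl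

end Flux

/-! ### Monotonicity of the mass. -/

section Mass

variable {d : ℕ}

/-- Positions are cut at R² and velocities at R. On the support v·∇_x costs at most a multiple of
R/R², so both the transport derivative and the velocity gradient are O(1/R). -/
theorem exists_spatial_cutoff (d : ℕ) : ∃ C : ℝ, 0 < C ∧ ∀ R : ℝ, 1 ≤ R →
    ∃ η : Z d → ℝ, ContDiff ℝ ∞ η ∧ (∀ z, 0 ≤ η z) ∧ (∀ z, η z ≤ 1) ∧
      (∀ z ∈ tsupport η, ‖z.2.1‖ ≤ 2 * R ^ 2 ∧ ‖z.2.2‖ ≤ 2 * R) ∧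
      (∀ z, ‖z.2.1‖ ≤ R ^ 2 → ‖z.2.2‖ ≤ R → η z = 1) ∧
      (∀ z e, |velDeriv η z e| ≤ C / R * ‖e‖) ∧ ∀ z, |transport η z| ≤ C / R := by
  obtain ⟨c0, hc1, hc0⟩ := exists_smoothTransition_bound
  refine ⟨8 * c0, by positivity, fun R hR => ?_⟩
  have hR0 : 0 < R := by linarith
  have n3 : ContDiff ℝ ∞ fun z : Z d => 2 * R ^ 2 - ‖z.2.2‖ ^ 2 :=
    contDiff_const.sub (ContDiff.norm_sq ℝ (by fun_prop))
  have n4 : ContDiff ℝ ∞ fun z : Z d => 2 * R ^ 4 - ‖z.2.1‖ ^ 2 :=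
    contDiff_const.sub (ContDiff.norm_sq ℝ (by fun_prop))
  obtain ⟨r3, p3, q3, a3, b3, d3⟩ := ramp_spec n3 (by positivity : 0 < R ^ 2)
  obtain ⟨r4, p4, q4, a4, b4, d4⟩ := ramp_spec n4 (by positivity : 0 < R ^ 4)
  have f3 : ∀ z w : Z d, fderiv ℝ (fun z : Z d => 2 * R ^ 2 - ‖z.2.2‖ ^ 2) z w =
      -(2 * inner ℝ z.2.2 w.2.2) := by
    intro z w
    have h0 : HasFDerivAt (fun z : Z d => z.2.2) ((ContinuousLinearMap.snd ℝ (E d) (E d)).comp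
      (ContinuousLinearMap.snd ℝ ℝ (E d × E d))) z := hasFDerivAt_snd.comp z hasFDerivAt_snd
    rw [(h0.norm_sq.const_sub _).fderiv]
    simp
  have f4 : ∀ z w : Z d, fderiv ℝ (fun z : Z d => 2 * R ^ 4 - ‖z.2.1‖ ^ 2) z w =
      -(2 * inner ℝ z.2.1 w.2.1) := by
    intro z w
    have h0 : HasFDerivAt (fun z : Z d => z.2.1) ((ContinuousLinearMap.fst ℝ (E d) (E d)).comp
      (ContinuousLinearMap.snd ℝ ℝ (E d × E d))) z := hasFDerivAt_fst.comp z hasFDerivAt_snd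
    rw [(h0.norm_sq.const_sub _).fderiv]
    simp
  set ρ3 := ramp (fun z : Z d => 2 * R ^ 2 - ‖z.2.2‖ ^ 2) (R ^ 2)
  set ρ4 := ramp (fun z : Z d => 2 * R ^ 4 - ‖z.2.1‖ ^ 2) (R ^ 4)
  have hsupp : ∀ z ∈ tsupport fun z => ρ3 z * ρ4 z, ‖z.2.1‖ ≤ 2 * R ^ 2 ∧ ‖z.2.2‖ ≤ 2 * R := by
    have hcl : IsClosed {z : Z d | ‖z.2.1‖ ≤ 2 * R ^ 2 ∧ ‖z.2.2‖ ≤ 2 * R} :=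
      (isClosed_le (by fun_prop : Continuous fun z : Z d => ‖z.2.1‖) continuous_const).inter
        (isClosed_le (by fun_prop : Continuous fun z : Z d => ‖z.2.2‖) continuous_const)
    refine closure_minimal (fun z hz => ?_) hcl
    have hz' : ρ3 z * ρ4 z ≠ 0 := hz
    have k3 : 0 < 2 * R ^ 2 - ‖z.2.2‖ ^ 2 := by
      by_contra h
      exact hz' (by rw [b3 z (not_lt.1 h), zero_mul])
    have k4 : 0 < 2 * R ^ 4 - ‖z.2.1‖ ^ 2 := by
      by_contra h
      exact hz' (by rw [b4 z (not_lt.1 h), mul_zero])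
    refine ⟨(sq_le_sq₀ (norm_nonneg _) (by positivity)).1 ?_,
      (sq_le_sq₀ (norm_nonneg _) (by positivity)).1 ?_⟩
    · have : 0 ≤ R ^ 4 := by positivity
      nlinarith
    · nlinarith [sq_nonneg R]
  have hfd : ∀ z w, |fderiv ℝ (fun z => ρ3 z * ρ4 z) z w| ≤
      c0 * (2 * |inner ℝ z.2.2 w.2.2| / R ^ 2) + c0 * (2 * |inner ℝ z.2.1 w.2.1| / R ^ 4) := by
    intro z w
    refine (abs_fderiv_mul_le r3 r4 p3 q3 p4 q4 z w).trans ?_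
    have g3 := d3 c0 hc0 z w
    have g4 := d4 c0 hc0 z w
    rw [f3, abs_neg, abs_mul, abs_two] at g3
    rw [f4, abs_neg, abs_mul, abs_two] at g4
    exact add_le_add g3 g4
  refine ⟨fun z => ρ3 z * ρ4 z, r3.mul r4, fun z => mul_nonneg (p3 z) (p4 z),
    fun z => mul_le_one₀ (q3 z) (p4 z) (q4 z), hsupp, fun z hx hv => ?_, fun z e => ?_,
    fun z => ?_⟩
  · have k3 := pow_le_pow_left₀ (norm_nonneg _) hv 2
    have k4 := pow_le_pow_left₀ (norm_nonneg _) hx 2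
    change ρ3 z * ρ4 z = 1
    rw [a3 z (by linarith), a4 z (by rw [← pow_mul] at k4; norm_num at k4; linarith), one_mul]
  · by_cases hz : z ∈ tsupport fun z => ρ3 z * ρ4 z
    · obtain ⟨-, hv⟩ := hsupp z hz
      refine (hfd z _).trans ?_
      simp only [inner_zero_right, abs_zero, mul_zero, zero_div, add_zero]
      have h5 : |inner ℝ z.2.2 e| ≤ 2 * R * ‖e‖ :=
        (abs_real_inner_le_norm _ _).trans (mul_le_mul_of_nonneg_right hv (norm_nonneg _))
      calc c0 * (2 * |inner ℝ z.2.2 e| / R ^ 2) ≤ c0 * (2 * (2 * R * ‖e‖) / R ^ 2) := by gcongr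
        _ = 4 * c0 / R * ‖e‖ := by field_simp; ring
        _ ≤ 8 * c0 / R * ‖e‖ := by gcongr; norm_num
    · rw [velDeriv, fderiv_eq_zero_of_notMem hz]
      simp
      positivity
  · by_cases hz : z ∈ tsupport fun z => ρ3 z * ρ4 z
    · obtain ⟨hx, hv⟩ := hsupp z hz
      refine (hfd z _).trans ?_
      simp only [inner_zero_right, abs_zero, mul_zero, zero_div, zero_add]
      have h5 : |inner ℝ z.2.1 z.2.2| ≤ 2 * R ^ 2 * (2 * R) :=
        (abs_real_inner_le_norm _ _).trans (mul_le_mul hx hv (norm_nonneg _) (by positivity))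
      calc c0 * (2 * |inner ℝ z.2.1 z.2.2| / R ^ 4) ≤ c0 * (2 * (2 * R ^ 2 * (2 * R)) / R ^ 4) := by
            gcongr
        _ = 8 * c0 / R := by field_simp; ring
    · rw [transport, fderiv_eq_zero_of_notMem hz]
      simp
      positivity

/-- The test function is ψ(t) times a spatial cutoff. As u and its flux are integrable on the slab,
all terms carrying a derivative of the spatial cutoff vanish in the limit, and only the time
derivative of ψ is left. -/
theorem IsSub.integral_mul_deriv_nonneg {lam Lam τ : ℝ} {u : Z d → ℝ} {g h : Z d → E d}
    (hu : IsSub lam Lam τ u g h) (hlam : 0 < lam) (hLam : 0 < Lam) {T T₂ : ℝ} (hT : 0 < T)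
    (hτ : τ < T / 2) (hfin : ∫⁻ z in slab d (T / 2) (T₂ + T), ‖u z‖ₑ ≠ ⊤) {ψ : ℝ → ℝ}
    (hψ : ContDiff ℝ ∞ ψ) (hψ0 : ∀ t, 0 ≤ ψ t) (hψs : tsupport ψ ⊆ Set.Icc T T₂) :
    0 ≤ ∫ z : Z d, u z * deriv ψ z.1 := by
  obtain ⟨C, hC, hcut⟩ := exists_spatial_cutoff d
  have hψc : HasCompactSupport ψ := isCompact_Icc.of_isClosed_subset (isClosed_tsupport _) hψs
  have hψ' : Continuous (deriv ψ) := hψ.continuous_deriv (by simp)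
  obtain ⟨B, hB⟩ := hψc.exists_bound_of_continuous hψ.continuous
  obtain ⟨B', hB'⟩ := hψc.deriv.exists_bound_of_continuous hψ'
  have hB0 : 0 ≤ B := (norm_nonneg _).trans (hB 0)
  have hB0' : 0 ≤ B' := (norm_nonneg _).trans (hB' 0)
  choose η hη η0 η1 hηs hη1 hηv hηt using fun n : ℕ => hcut ((n : ℝ) + 1) (by
    have : (0 : ℝ) ≤ n := n.cast_nonneg
    linarith)
  have hΨ : ContDiff ℝ ∞ fun z : Z d => ψ z.1 := hψ.comp contDiff_fst
  have hΨd : ∀ z w : Z d, fderiv ℝ (fun z : Z d => ψ z.1) z w = deriv ψ z.1 * w.1 := by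
    intro z w
    have h1 : HasFDerivAt (fun z : Z d => ψ z.1)
        (deriv ψ z.1 • ContinuousLinearMap.fst ℝ ℝ (E d × E d)) z :=
      (hψ.differentiable (by simp) z.1).hasDerivAt.comp_hasFDerivAt z hasFDerivAt_fst
    rw [h1.fderiv]
    simp
  have hzero : ∀ t, t ∉ Set.Icc T T₂ → ψ t = 0 ∧ deriv ψ t = 0 := fun t ht =>
    ⟨image_eq_zero_of_notMem_tsupport fun h => ht (hψs h), by
      by_contra h
      exact ht (hψs (support_deriv_subset h))⟩
  set q : ℕ → Z d → ℝ := fun n z => u z * (deriv ψ z.1 * η n z + ψ z.1 * transport (η n) z) -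
    ψ z.1 * velDeriv (η n) z (h z) with hq
  have hη' : ∀ n, ContDiff ℝ 1 (η n) := fun n => (hη n).of_le (mod_cast le_top)
  have hΨ1 : ContDiff ℝ 1 fun z : Z d => ψ z.1 := hΨ.of_le (mod_cast le_top)
  have eT : ∀ n z, transport (fun z => ψ z.1 * η n z) z =
      deriv ψ z.1 * η n z + ψ z.1 * transport (η n) z := by
    intro n z
    rw [transport_mul hΨ1 (hη' n), transport, transport, hΨd]
    ring
  have eV : ∀ n z e, velDeriv (fun z => ψ z.1 * η n z) z e = ψ z.1 * velDeriv (η n) z e := by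
    intro n z e
    rw [velDeriv_mul hΨ1 (hη' n), velDeriv, velDeriv, hΨd]
    simp
  have hsup : ∀ n, tsupport (fun z : Z d => ψ z.1 * η n z) ⊆
      {z : Z d | z.1 ∈ Set.Icc T T₂} ∩ tsupport (η n) := by
    intro n
    refine Set.subset_inter ?_ tsupport_mul_subset_right
    refine closure_minimal (fun z hz => ?_) (isClosed_Icc.preimage continuous_fst)
    by_contra h
    exact hz (by simp [(hzero z.1 h).1])
  have hqn : ∀ n, 0 ≤ ∫ z, q n z := by
    intro n
    set R : ℝ := (n : ℝ) + 1
    have hcomp : HasCompactSupport fun z : Z d => ψ z.1 * η n z := by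
      refine (isCompact_Icc.prod ((isCompact_closedBall (0 : E d) (2 * R ^ 2)).prod
        (isCompact_closedBall (0 : E d) (2 * R)))).of_isClosed_subset (isClosed_tsupport _)
        (s := Set.Icc T T₂ ×ˢ (Metric.closedBall (0 : E d) (2 * R ^ 2) ×ˢ
          Metric.closedBall (0 : E d) (2 * R))) fun z hz => ?_
      obtain ⟨h1, h2⟩ := hsup n hz
      obtain ⟨h3, h4⟩ := hηs n z h2
      exact ⟨h1, mem_closedBall_zero_iff.2 h3, mem_closedBall_zero_iff.2 h4⟩
    have hle := hu.le (fun z => ψ z.1 * η n z) (hΨ.mul (hη n)) hcomp (fun z hz => by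
      have := (hsup n hz).1.1
      linarith) fun z => mul_nonneg (hψ0 _) (η0 n z)
    have i1 : Integrable fun z => u z * transport (fun z => ψ z.1 * η n z) z :=
      (hu.locL2_fst.smul_compact (continuous_transport (hΨ1.mul (hη' n)))
        (hasCompactSupport_transport hcomp)).2.congr
        (Eventually.of_forall fun z => by simp [mul_comm])
    have i2 := (hu.locL2_flux.velDeriv_compact (hΨ1.mul (hη' n)) hcomp).2
    have e : ∫ z, q n z = (∫ z, u z * transport (fun z => ψ z.1 * η n z) z) -
        ∫ z, velDeriv (fun z => ψ z.1 * η n z) z (h z) := by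
      rw [← integral_sub i1 i2]
      refine integral_congr_ae (Eventually.of_forall fun z => ?_)
      simp only [hq, eT, eV]
    rw [e]
    linarith
  have hfin' : ∫⁻ z in slab d T T₂, ‖u z‖ₑ ≠ ⊤ := by
    refine ne_top_of_le_ne_top hfin (lintegral_mono_set fun z hz => ?_)
    obtain ⟨h1, h2⟩ := hz
    exact ⟨by linarith, by linarith⟩
  have hflux := hu.lintegral_flux_lt_top hlam hLam hT hτ hfin
  have iu : Integrable ((slab d T T₂).indicator fun z => ‖u z‖) := by
    refine (integrable_indicator_iff (measurableSet_slab _ _)).2 (Integrable.norm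
      ⟨hu.locL2_fst.aestronglyMeasurable.restrict, lt_top_iff_ne_top.2 hfin'⟩)
  have ih : Integrable ((slab d T T₂).indicator fun z => ‖h z‖) := by
    refine (integrable_indicator_iff (measurableSet_slab _ _)).2 (Integrable.norm
      ⟨hu.locL2_flux.aestronglyMeasurable.restrict, lt_top_iff_ne_top.2 hflux⟩)
  have hCn : ∀ n : ℕ, 0 ≤ C / ((n : ℝ) + 1) ∧ C / ((n : ℝ) + 1) ≤ C := fun n =>
    ⟨by positivity, div_le_self hC.le (by
      have : (0 : ℝ) ≤ n := n.cast_nonneg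
      linarith)⟩
  have hlim : Tendsto (fun n => ∫ z, q n z) atTop (𝓝 (∫ z : Z d, u z * deriv ψ z.1)) := by
    refine tendsto_integral_of_dominated_convergence
      (fun z => (B' + B * C) * (slab d T T₂).indicator (fun z => ‖u z‖) z +
        B * C * (slab d T T₂).indicator (fun z => ‖h z‖) z) (fun n => ?_)
      ((iu.const_mul _).add (ih.const_mul _)) (fun n => Eventually.of_forall fun z => ?_)
      (Eventually.of_forall fun z => ?_)
    · have m1 : Continuous fun z => deriv ψ z.1 * η n z + ψ z.1 * transport (η n) z :=
        ((hψ'.comp continuous_fst).mul (hη n).continuous).add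
          (hΨ.continuous.mul (continuous_transport (hη' n)))
      have m2 : AEStronglyMeasurable fun z => velDeriv (η n) z (h z) := by
        simp only [← inner_velGrad]
        exact (continuous_velGrad (hη' n)).aestronglyMeasurable.inner (𝕜 := ℝ)
          hu.locL2_flux.aestronglyMeasurable
      exact (hu.locL2_fst.aestronglyMeasurable.mul m1.aestronglyMeasurable).sub
        (hΨ.continuous.aestronglyMeasurable.mul m2)
    · by_cases hz : z ∈ slab d T T₂
      · simp only [Set.indicator_of_mem hz, hq]
        have b1 : |ψ z.1| ≤ B := hB z.1
        have b2 : |deriv ψ z.1| ≤ B' := hB' z.1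
        have b3 : |η n z| ≤ 1 := by rw [abs_of_nonneg (η0 n z)]; exact η1 n z
        have b4 : |transport (η n) z| ≤ C := (hηt n z).trans (hCn n).2
        have b5 : |velDeriv (η n) z (h z)| ≤ C * ‖h z‖ := (hηv n z _).trans
          (mul_le_mul_of_nonneg_right (hCn n).2 (norm_nonneg _))
        have c1 : |deriv ψ z.1 * η n z + ψ z.1 * transport (η n) z| ≤ B' * 1 + B * C := by
          refine (abs_add_le _ _).trans (add_le_add ?_ ?_)
          · rw [abs_mul]; exact mul_le_mul b2 b3 (abs_nonneg _) hB0'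
          · rw [abs_mul]; exact mul_le_mul b1 b4 (abs_nonneg _) hB0
        refine (abs_sub _ _).trans (add_le_add ?_ ?_)
        · rw [abs_mul, mul_comm]
          rw [mul_one] at c1
          exact mul_le_mul_of_nonneg_right c1 (abs_nonneg _)
        · rw [abs_mul, mul_assoc]
          exact mul_le_mul b1 b5 (abs_nonneg _) hB0
      · obtain ⟨e1, e2⟩ := hzero z.1 fun h => hz h
        simp [hq, e1, e2, Set.indicator_of_notMem hz]
    · have hn1 : Tendsto (fun n : ℕ => C / ((n : ℝ) + 1)) atTop (𝓝 0) := by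
        have := (tendsto_one_div_add_atTop_nhds_zero_nat (𝕜 := ℝ)).const_mul C
        simpa [div_eq_mul_inv] using this
      have hv0 : Tendsto (fun n => velDeriv (η n) z (h z)) atTop (𝓝 0) := by
        refine squeeze_zero_norm (fun n => hηv n z (h z)) ?_
        simpa using hn1.mul_const ‖h z‖
      have ht0 : Tendsto (fun n => transport (η n) z) atTop (𝓝 0) :=
        squeeze_zero_norm (fun n => hηt n z) hn1
      have h1 : Tendsto (fun n => η n z) atTop (𝓝 1) := by
        refine tendsto_const_nhds.congr' ?_
        obtain ⟨N, hN⟩ := exists_nat_ge (‖z.2.1‖ + ‖z.2.2‖)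
        filter_upwards [eventually_ge_atTop N] with n hn
        have hn' : (N : ℝ) ≤ n := by exact_mod_cast hn
        have k1 := norm_nonneg z.2.1
        have k2 := norm_nonneg z.2.2
        refine (hη1 n z ?_ ?_).symm
        · nlinarith
        · linarith
      have := ((((h1.const_mul (deriv ψ z.1)).add (ht0.const_mul (ψ z.1))).const_mul (u z))).sub
        (hv0.const_mul (ψ z.1))
      simpa using this
  exact ge_of_tendsto' hlim hqn

/-- A continuous function whose distributional derivative is nonpositive is nonincreasing. -/
theorem le_of_integral_mul_deriv_nonneg {m : ℝ → ℝ} {T T₂ : ℝ} (hm : ContinuousOn m (Set.Icc T T₂))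
    (h : ∀ ψ : ℝ → ℝ, ContDiff ℝ ∞ ψ → (∀ t, 0 ≤ ψ t) → tsupport ψ ⊆ Set.Icc T T₂ →
      0 ≤ ∫ t, m t * deriv ψ t) {t₁ t₂ : ℝ} (h1 : T ≤ t₁) (h12 : t₁ ≤ t₂) (h2 : t₂ < T₂) :
    m t₂ ≤ m t₁ := by
  by_contra hlt
  push Not at hlt
  obtain ⟨c, hc1, hc2⟩ := exists_between hlt
  have hnear : ∀ t, T ≤ t → t < T₂ → ∀ U ∈ 𝓝 (m t), ∃ ε > 0, ∀ s, t ≤ s → s ≤ t + ε → m s ∈ U := by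
    intro t ht ht' U hU
    have hcont : ContinuousWithinAt m (Set.Icc T T₂) t := hm t ⟨ht, ht'.le⟩
    obtain ⟨ε, hε, hball⟩ := Metric.mem_nhdsWithin_iff.1 (hcont hU)
    refine ⟨min (ε / 2) (T₂ - t), lt_min (by positivity) (by linarith), fun s hs hs' => ?_⟩
    have e1 := min_le_left (ε / 2) (T₂ - t)
    have e2 := min_le_right (ε / 2) (T₂ - t)
    refine hball ⟨?_, by linarith, by linarith⟩
    rw [Metric.mem_ball, Real.dist_eq, abs_of_nonneg (by linarith)]
    linarith
  obtain ⟨c', hc1', hc2'⟩ := exists_between hc2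
  obtain ⟨ε1, hε1, hm1⟩ := hnear t₁ h1 (by linarith) _ (Iio_mem_nhds hc1)
  obtain ⟨ε2, hε2, hm2⟩ := hnear t₂ (by linarith) h2 _ (Ioi_mem_nhds hc2')
  set ε := min (min ε1 ε2) (T₂ - t₂) with hε
  have hε0 : 0 < ε := lt_min (lt_min hε1 hε2) (by linarith)
  have hεa : ε ≤ ε1 := (min_le_left _ _).trans (min_le_left _ _)
  have hεb : ε ≤ ε2 := (min_le_left _ _).trans (min_le_right _ _)
  have hεc : ε ≤ T₂ - t₂ := min_le_right _ _
  -- A smooth step rising from 0 to 1 on [a, a + ε]. The difference of the steps at t₁ and t₂ is a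
  -- nonnegative test function, and its derivative compares the averages of m just after t₁ and just
  -- after t₂.
  set α : ℝ → ℝ → ℝ := fun a s => Real.smoothTransition ((s - a) / ε) with hα
  have hαs : ∀ a, ContDiff ℝ ∞ (α a) := fun a =>
    Real.smoothTransition.contDiff.comp (by fun_prop)
  have hα0 : ∀ a s, s ≤ a → α a s = 0 := fun a s hs =>
    Real.smoothTransition.zero_of_nonpos (div_nonpos_of_nonpos_of_nonneg (by linarith) hε0.le)
  have hα1 : ∀ a s, a + ε ≤ s → α a s = 1 := fun a s hs =>
    Real.smoothTransition.one_of_one_le ((one_le_div hε0).2 (by linarith))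
  have hαm : ∀ a, Monotone (α a) := fun a s s' hs =>
    Real.smoothTransition.monotone (div_le_div_of_nonneg_right (by linarith) hε0.le)
  have hαd : ∀ a s, 0 ≤ deriv (α a) s := fun a s => (hαm a).deriv_nonneg
  have hαd0 : ∀ a s, s ∉ Set.Icc a (a + ε) → deriv (α a) s = 0 := by
    intro a s hs
    rcases lt_or_ge s a with h0 | h0
    · have : α a =ᶠ[𝓝 s] fun _ => 0 := by
        filter_upwards [Iio_mem_nhds h0] with y hy using hα0 a y (le_of_lt hy)
      rw [this.deriv_eq, deriv_const]
    · have h1 : a + ε < s := by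
        by_contra h
        exact hs ⟨h0, not_lt.1 h⟩
      have : α a =ᶠ[𝓝 s] fun _ => 1 := by
        filter_upwards [Ioi_mem_nhds h1] with y hy using hα1 a y (le_of_lt hy)
      rw [this.deriv_eq, deriv_const]
  have hαc : ∀ a, Continuous (deriv (α a)) := fun a => (hαs a).continuous_deriv (by simp)
  have hαi : ∀ a, Integrable (deriv (α a)) := fun a =>
    (hαc a).integrable_of_hasCompactSupport (HasCompactSupport.intro isCompact_Icc (hαd0 a))
  have hαI : ∀ a, ∫ s, deriv (α a) s = 1 := by
    intro a
    have := integral_of_hasDerivAt_of_tendsto (f := α a) (f' := deriv (α a)) (m := 0) (n := 1)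
      (fun s => ((hαs a).differentiable (by simp) s).hasDerivAt) (hαi a)
      (tendsto_const_nhds.congr' (by
        filter_upwards [eventually_le_atBot a] with s hs using (hα0 a s hs).symm))
      (tendsto_const_nhds.congr' (by
        filter_upwards [eventually_ge_atTop (a + ε)] with s hs using (hα1 a s hs).symm))
    rw [this, sub_zero]
  have hmi : ∀ a, T ≤ a → a + ε ≤ T₂ → Integrable fun s => m s * deriv (α a) s := by
    intro a ha ha'
    have h3 : IntegrableOn (fun s => m s * deriv (α a) s) (Set.Icc a (a + ε)) :=
      ((hm.mono (Set.Icc_subset_Icc ha ha')).mul (hαc a).continuousOn).integrableOn_Icc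
    exact h3.integrable_of_forall_notMem_eq_zero fun s hs => by simp [hαd0 a s hs]
  have hψ := h (fun s => α t₁ s - α t₂ s) ((hαs _).sub (hαs _)) (fun s => sub_nonneg.2
    (Real.smoothTransition.monotone (div_le_div_of_nonneg_right (by linarith) hε0.le))) ?_
  · have hd : ∀ s, deriv (fun s => α t₁ s - α t₂ s) s = deriv (α t₁) s - deriv (α t₂) s :=
      fun s => deriv_fun_sub ((hαs _).differentiable (by simp) s)
        ((hαs _).differentiable (by simp) s)
    simp only [hd, mul_sub] at hψ
    have i1 := hmi t₁ h1 (by linarith)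
    have i2 := hmi t₂ (by linarith) (by linarith)
    rw [integral_sub i1 i2] at hψ
    have b1 : ∫ s, m s * deriv (α t₁) s ≤ c := by
      calc ∫ s, m s * deriv (α t₁) s ≤ ∫ s, c * deriv (α t₁) s := by
            refine integral_mono i1 ((hαi t₁).const_mul c) fun s => ?_
            by_cases hs : s ∈ Set.Icc t₁ (t₁ + ε)
            · exact mul_le_mul_of_nonneg_right
                (le_of_lt (hm1 s hs.1 (hs.2.trans (by linarith)))) (hαd _ _)
            · simp [hαd0 _ s hs]
        _ = c := by rw [integral_const_mul, hαI, mul_one]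
    have b2 : c' ≤ ∫ s, m s * deriv (α t₂) s := by
      calc c' = ∫ s, c' * deriv (α t₂) s := by rw [integral_const_mul, hαI, mul_one]
        _ ≤ ∫ s, m s * deriv (α t₂) s := by
            refine integral_mono ((hαi t₂).const_mul c') i2 fun s => ?_
            by_cases hs : s ∈ Set.Icc t₂ (t₂ + ε)
            · exact mul_le_mul_of_nonneg_right
                (le_of_lt (hm2 s hs.1 (hs.2.trans (by linarith)))) (hαd _ _)
            · simp [hαd0 _ s hs]
    linarith
  · refine closure_minimal (fun s hs => ?_) isClosed_Icc
    by_contra hs'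
    refine hs ?_
    simp only
    rcases lt_or_ge s T with h0 | h0
    · rw [hα0 t₁ s (by linarith), hα0 t₂ s (by linarith), sub_zero]
    · have h3 : T₂ < s := by
        by_contra h3
        exact hs' ⟨h0, not_lt.1 h3⟩
      rw [hα1 t₁ s (by linarith), hα1 t₂ s (by linarith), sub_self]

end Mass

/-! ### From weak solutions to the pointwise bound. -/

section Solution

variable {d : ℕ}

theorem IsL2Loc.locL2_indicator {V : Type*} [NormedAddCommGroup V] {F : Z d → V}
    (hF : IsL2Loc F) {τ : ℝ} (hτ : 0 < τ) : LocL2 ({z : Z d | τ < z.1}.indicator F) := by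
  intro K hK
  have hm : MeasurableSet {z : Z d | τ < z.1} := measurableSet_lt measurable_const measurable_fst
  rw [memLp_indicator_iff_restrict hm, Measure.restrict_restrict hm]
  have hcl : IsClosed {z : Z d | τ ≤ z.1} := isClosed_le continuous_const continuous_fst
  refine (hF (K ∩ {z | τ ≤ z.1}) (hK.inter_right hcl) fun z hz => lt_of_lt_of_le hτ hz.2).mono_measure
    (Measure.restrict_mono (show {z : Z d | τ < z.1} ∩ K ⊆ K ∩ {z | τ ≤ z.1} from
      fun z hz => ⟨hz.2, le_of_lt (show τ < z.1 from hz.1)⟩) le_rfl)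

/-- For the second bound the nonnegative form of a is evaluated at ξ − Λ⁻¹aξ and expanded using
symmetry; the cubic term is estimated by a ≤ Λ at the vector aξ. -/
theorem IsElliptic.flux_spec {lam Lam : ℝ} {a : Z d → Matrix (Fin d) (Fin d) ℝ}
    (ha : IsElliptic lam Lam a) (hlam : 0 < lam) (hLam : 0 < Lam) {z : Z d} (hz : z ∈ posTime d)
    (ξ : E d) : lam * ‖ξ‖ ^ 2 ≤ inner ℝ (Matrix.toEuclideanLin (a z) ξ) ξ ∧
      ‖Matrix.toEuclideanLin (a z) ξ‖ ^ 2 ≤ Lam * inner ℝ (Matrix.toEuclideanLin (a z) ξ) ξ := by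
  have hsym : (Matrix.toEuclideanLin (a z)).IsSymmetric := by
    rw [Matrix.isSymmetric_toEuclideanLin_iff, Matrix.IsHermitian,
      Matrix.conjTranspose_eq_transpose_of_trivial]
    exact ha.symm z hz
  set L := Matrix.toEuclideanLin (a z)
  refine ⟨by rw [real_inner_comm]; exact ha.lower z hz ξ, ?_⟩
  have h1 : 0 ≤ inner ℝ (ξ - Lam⁻¹ • L ξ) (L (ξ - Lam⁻¹ • L ξ)) := 
    (by positivity : 0 ≤ lam * ‖ξ - Lam⁻¹ • L ξ‖ ^ 2).trans (ha.lower z hz _)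
  have h2 := ha.upper z hz (L ξ)
  have h3 : inner ℝ ξ (L (L ξ)) = ‖L ξ‖ ^ 2 := by
    rw [← hsym ξ (L ξ), real_inner_self_eq_norm_sq]
  have h4 : inner ℝ (L ξ) (L ξ) = ‖L ξ‖ ^ 2 := real_inner_self_eq_norm_sq _
  rw [map_sub, map_smul, inner_sub_left, inner_sub_right, inner_sub_right, inner_smul_right,
    inner_smul_left, inner_smul_left, inner_smul_right, h3, h4, conj_trivial] at h1
  rw [real_inner_comm]
  change 0 ≤ inner ℝ ξ (L ξ) - Lam⁻¹ * ‖L ξ‖ ^ 2 - (Lam⁻¹ * ‖L ξ‖ ^ 2 -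
    Lam⁻¹ * (Lam⁻¹ * inner ℝ (L ξ) (L (L ξ)))) at h1
  have h5 : Lam⁻¹ * (Lam⁻¹ * inner ℝ (L ξ) (L (L ξ))) ≤ Lam⁻¹ * ‖L ξ‖ ^ 2 := by
    refine mul_le_mul_of_nonneg_left ?_ (inv_nonneg.2 hLam.le)
    rw [inv_mul_le_iff₀ hLam]
    exact h2
  have h6 : Lam⁻¹ * ‖L ξ‖ ^ 2 ≤ inner ℝ ξ (L ξ) := by linarith
  rwa [inv_mul_le_iff₀ hLam] at h6

theorem IsElliptic.isL2Loc_flux {lam Lam : ℝ} {a : Z d → Matrix (Fin d) (Fin d) ℝ}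
    (ha : IsElliptic lam Lam a) (hlam : 0 < lam) (hLam : 0 < Lam) {g : Z d → E d}
    (hg : IsL2Loc g) : IsL2Loc fun z => Matrix.toEuclideanLin (a z) (g z) := by
  intro K hK hKp
  have hgK := hg K hK hKp
  refine hgK.of_le_mul (c := Lam) ?_ ?_
  · have e : (fun z => Matrix.toEuclideanLin (a z) (g z)) = fun z =>
        ∑ i, (∑ j, a z i j * g z j) • (EuclideanSpace.single i (1 : ℝ) : E d) := by
      funext z
      ext k
      simp [Matrix.toLpLin_apply, Matrix.mulVec, dotProduct, Pi.single_apply]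
    rw [e]
    refine AEMeasurable.aestronglyMeasurable ?_
    refine Finset.aemeasurable_fun_sum _ fun i _ => AEMeasurable.smul_const ?_ _
    refine Finset.aemeasurable_fun_sum _ fun j _ => ?_
    refine ((ha.meas i j).mono_measure (Measure.restrict_mono hKp le_rfl)).mul ?_
    exact ((EuclideanSpace.proj (𝕜 := ℝ) j).continuous.comp_aestronglyMeasurable
      hgK.aestronglyMeasurable).aemeasurable
  · refine (ae_restrict_iff' hK.measurableSet).2 (Eventually.of_forall fun z hz => ?_)
    have h1 := (ha.flux_spec hlam hLam (hKp hz) (g z)).2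
    have h2 := real_inner_le_norm (Matrix.toEuclideanLin (a z) (g z)) (g z)
    rcases (norm_nonneg (Matrix.toEuclideanLin (a z) (g z))).eq_or_lt with h0 | h0
    · rw [← h0]; positivity
    · have h3 : ‖Matrix.toEuclideanLin (a z) (g z)‖ * ‖Matrix.toEuclideanLin (a z) (g z)‖ ≤
          (Lam * ‖g z‖) * ‖Matrix.toEuclideanLin (a z) (g z)‖ := by nlinarith
      exact le_of_mul_le_mul_right h3 h0

/-- Slicewise nonnegativity implies almost everywhere nonnegativity. -/
theorem ae_nonneg_of_slices {F : Z d → ℝ} (hF : AEStronglyMeasurable F)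
    (h : ∀ t : ℝ, ∀ᵐ p : E d × E d, 0 ≤ F (t, p)) : ∀ᵐ z, 0 ≤ F z := by
  have hm : AEMeasurable fun z => ENNReal.ofReal (-F z) := hF.aemeasurable.neg.ennreal_ofReal
  have h0 : ∫⁻ z, ENNReal.ofReal (-F z) = 0 := by
    rw [Measure.volume_eq_prod] at hm ⊢
    rw [lintegral_prod _ hm]
    refine (lintegral_congr fun t => ?_).trans lintegral_zero
    rw [lintegral_congr_ae (g := fun _ => 0), lintegral_zero]
    filter_upwards [h t] with p hp
    simpa using hp
  filter_upwards [(lintegral_eq_zero_iff' hm).1 h0] with z hz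
  simpa using hz

/-- A nonnegative weak solution, truncated in time, is a subsolution. -/
theorem IsSolution.exists_isSub {lam Lam : ℝ} (hlam : 0 < lam) (hLam : 0 < Lam)
    {a : Z d → Matrix (Fin d) (Fin d) ℝ} (ha : IsElliptic lam Lam a) {fin : E d × E d → ℝ}
    {f : Z d → ℝ} (hf : IsSolution a fin f)
    (hpos : ∀ t : ℝ, 0 ≤ t → ∀ᵐ p : E d × E d, 0 ≤ f (t, p)) {τ : ℝ} (hτ : 0 < τ) :
    ∃ g h : Z d → E d,
      IsSub lam Lam τ ({z : Z d | τ < z.1}.indicator fun z => |f z|) g h := by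
  obtain ⟨g, hg, hwg, hweak⟩ := hf.weak
  have hh := ha.isL2Loc_flux hlam hLam hg
  set S : Set (Z d) := {z | τ < z.1} with hS
  have hfS := hf.locL2.locL2_indicator hτ
  -- A subsolution in the sense of `IsSub` is nonnegative everywhere, whereas f is so only almost
  -- everywhere on each time slice. Hence |f|, which agrees with f almost everywhere after time τ.
  have hae : ∀ᵐ z, S.indicator (fun z => |f z|) z = S.indicator f z := by
    have h1 : ∀ᵐ z, 0 ≤ S.indicator f z := by
      refine ae_nonneg_of_slices hfS.aestronglyMeasurable fun t => ?_
      rcases lt_or_ge τ t with h | h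
      · filter_upwards [hpos t (hτ.le.trans h.le)] with p hp
        rwa [Set.indicator_of_mem (by exact h)]
      · refine Eventually.of_forall fun p => ?_
        rw [Set.indicator_of_notMem (by exact not_lt.2 h)]
    filter_upwards [h1] with z hz
    by_cases hzS : z ∈ S
    · rw [Set.indicator_of_mem hzS] at hz ⊢
      rw [Set.indicator_of_mem hzS, abs_of_nonneg hz]
    · rw [Set.indicator_of_notMem hzS, Set.indicator_of_notMem hzS]
  have htest : ∀ φ : Z d → ℝ, ContDiff ℝ ∞ φ → HasCompactSupport φ →
      (∀ z ∈ tsupport φ, τ < z.1) → IsTest φ := fun φ h1 h2 h3 =>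
    ⟨h1, h2, fun z hz => hτ.trans (h3 z hz)⟩
  have hout : ∀ φ : Z d → ℝ, (∀ z ∈ tsupport φ, τ < z.1) → ∀ z, z ∉ S →
      φ z = 0 ∧ fderiv ℝ φ z = 0 := fun φ h3 z hz =>
    ⟨image_eq_zero_of_notMem_tsupport fun h => hz (h3 z h),
      fderiv_eq_zero_of_notMem fun h => hz (h3 z h)⟩
  refine ⟨S.indicator g, S.indicator fun z => Matrix.toEuclideanLin (a z) (g z),
    fun z => Set.indicator_nonneg (fun _ _ => abs_nonneg _) z, ?_, hg.locL2_indicator hτ,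
    hh.locL2_indicator hτ, fun z => ?_, fun z => ?_, ?_, ?_⟩
  · intro K hK
    exact (hfS K hK).ae_eq (ae_restrict_of_ae (hae.mono fun z hz => hz.symm))
  · by_cases hz : z ∈ S
    · rw [Set.indicator_of_mem hz, Set.indicator_of_mem hz]
      exact (ha.flux_spec hlam hLam (hτ.trans hz) _).1
    · simp [Set.indicator_of_notMem hz]
  · by_cases hz : z ∈ S
    · rw [Set.indicator_of_mem hz, Set.indicator_of_mem hz]
      exact (ha.flux_spec hlam hLam (hτ.trans hz) _).2
    · simp [Set.indicator_of_notMem hz]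
  · intro φ h1 h2 h3 e
    have h4 := hwg φ (htest φ h1 h2 h3) e
    have e1 : ∫ z, S.indicator (fun z => |f z|) z * velDeriv φ z e = ∫ z, f z * velDeriv φ z e := by
      refine integral_congr_ae ?_
      filter_upwards [hae] with z hz
      rw [hz]
      by_cases hzS : z ∈ S
      · rw [Set.indicator_of_mem hzS]
      · simp [velDeriv, (hout φ h3 z hzS).2]
    have e2 : ∫ z, inner ℝ (S.indicator g z) e * φ z = ∫ z, inner ℝ (g z) e * φ z := by
      refine integral_congr_ae (Eventually.of_forall fun z => ?_)
      by_cases hzS : z ∈ S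
      · simp only [Set.indicator_of_mem hzS]
      · simp [(hout φ h3 z hzS).1]
    rw [e1, e2, h4]
  · intro φ h1 h2 h3 _
    have h4 := hweak φ (htest φ h1 h2 h3)
    have e1 : ∫ z, S.indicator (fun z => |f z|) z * transport φ z = ∫ z, f z * transport φ z := by
      refine integral_congr_ae ?_
      filter_upwards [hae] with z hz
      rw [hz]
      by_cases hzS : z ∈ S
      · rw [Set.indicator_of_mem hzS]
      · simp [transport, (hout φ h3 z hzS).2]
    have e2 : ∫ z, velDeriv φ z (S.indicator (fun z => Matrix.toEuclideanLin (a z) (g z)) z) =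
        ∫ z, velDeriv φ z (Matrix.toEuclideanLin (a z) (g z)) := by
      refine integral_congr_ae (Eventually.of_forall fun z => ?_)
      by_cases hzS : z ∈ S
      · simp only [Set.indicator_of_mem hzS]
      · simp [velDeriv, (hout φ h3 z hzS).2]
    rw [e1, e2, h4]

/-- The total mass at time `t`. -/
noncomputable def mass (f : Z d → ℝ) (t : ℝ) : ℝ := ∫ p : E d × E d, |f (t, p)|

theorem IsSolution.continuousOn_mass {a : Z d → Matrix (Fin d) (Fin d) ℝ}
    {fin : E d × E d → ℝ} {f : Z d → ℝ} (hf : IsSolution a fin f) :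
    ContinuousOn (mass f) (Set.Ici 0) := by
  intro t ht
  refine tendsto_iff_norm_sub_tendsto_zero.2 ?_
  refine squeeze_zero' (Eventually.of_forall fun s => norm_nonneg _) ?_ (hf.continuous t ht)
  filter_upwards [self_mem_nhdsWithin] with s hs
  have i1 := hf.integrable s hs
  have i2 := hf.integrable t ht
  rw [mass, mass, ← integral_sub i1.abs i2.abs]
  refine (norm_integral_le_integral_norm _).trans (integral_mono (i1.abs.sub i2.abs).norm
    (i1.sub i2).abs fun p => ?_)
  exact abs_abs_sub_abs_le_abs_sub _ _

theorem lintegral_slab_le {a : Z d → Matrix (Fin d) (Fin d) ℝ}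
    {fin : E d × E d → ℝ} {f : Z d → ℝ} (hf : IsSolution a fin f) {τ : ℝ} (hτ : 0 < τ)
    {a₁ b₁ M : ℝ} (hM : ∀ t, 0 ≤ t → t ≤ b₁ → mass f t ≤ M) :
    ∫⁻ z in slab d a₁ b₁, ‖{z : Z d | τ < z.1}.indicator (fun z => |f z|) z‖ₑ ≤
      ENNReal.ofReal M * ENNReal.ofReal (b₁ - a₁) := by
  set S : Set (Z d) := {z | τ < z.1} with hS
  have hSm : MeasurableSet S := measurableSet_lt measurable_const measurable_fst
  have hm : AEMeasurable fun z => ‖S.indicator (fun z => |f z|) z‖ₑ := by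
    have h1 := (hf.locL2.locL2_indicator hτ).aestronglyMeasurable.enorm
    refine h1.congr (Eventually.of_forall fun z => ?_)
    change ‖S.indicator f z‖ₑ = ‖S.indicator (fun z => |f z|) z‖ₑ
    by_cases hz : z ∈ S
    · rw [Set.indicator_of_mem hz, Set.indicator_of_mem hz, ← ofReal_norm, ← ofReal_norm,
        Real.norm_eq_abs, Real.norm_eq_abs, abs_abs]
    · rw [Set.indicator_of_notMem hz, Set.indicator_of_notMem hz]
  rw [← lintegral_indicator (measurableSet_slab _ _)]
  have hm2 := hm.indicator (measurableSet_slab (d := d) a₁ b₁)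
  rw [Measure.volume_eq_prod] at hm2 ⊢
  rw [lintegral_prod _ hm2]
  calc _ ≤ ∫⁻ t : ℝ, (Set.Icc a₁ b₁).indicator (fun _ => ENNReal.ofReal M) t := by
        refine lintegral_mono fun t => ?_
        by_cases ht : t ∈ Set.Icc a₁ b₁ ∧ τ < t
        · have h0 : 0 ≤ t := hτ.le.trans ht.2.le
          have e : ∀ p : E d × E d, (slab d a₁ b₁).indicator
              (fun z => ‖S.indicator (fun z => |f z|) z‖ₑ) (t, p) = ENNReal.ofReal |f (t, p)| := by
            intro p
            rw [Set.indicator_of_mem (by exact ht.1), Set.indicator_of_mem (by exact ht.2),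
              ← ofReal_norm, Real.norm_of_nonneg (abs_nonneg _)]
          simp only [e]
          rw [Set.indicator_of_mem ht.1, ← ofReal_integral_eq_lintegral_ofReal
            (hf.integrable t h0).abs (Eventually.of_forall fun p => abs_nonneg _)]
          exact ENNReal.ofReal_le_ofReal (hM t h0 ht.1.2)
        · have e : ∀ p : E d × E d, (slab d a₁ b₁).indicator
              (fun z => ‖S.indicator (fun z => |f z|) z‖ₑ) (t, p) = 0 := by
            intro p
            by_cases h1 : t ∈ Set.Icc a₁ b₁
            · rw [Set.indicator_of_mem (by exact h1),
                Set.indicator_of_notMem (by exact fun h2 => ht ⟨h1, h2⟩), enorm_zero]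
            · exact Set.indicator_of_notMem (by exact h1) _
          simp [e]
    _ = _ := by
        rw [lintegral_indicator measurableSet_Icc, setLIntegral_const, Real.volume_Icc]

/-- The equation and the square integrability hold only at positive times, so monotonicity is first
obtained on (0, t]; continuity in L¹ then carries it to the initial datum. -/
theorem IsSolution.mass_le {lam Lam : ℝ} (hlam : 0 < lam) (hLam : 0 < Lam)
    {a : Z d → Matrix (Fin d) (Fin d) ℝ} (ha : IsElliptic lam Lam a) {fin : E d × E d → ℝ}
    {f : Z d → ℝ} (hf : IsSolution a fin f)
    (hpos : ∀ t : ℝ, 0 ≤ t → ∀ᵐ p : E d × E d, 0 ≤ f (t, p)) {t : ℝ} (ht : 0 ≤ t) :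
    mass f t ≤ ∫ q, fin q := by
  have hm := hf.continuousOn_mass
  have h0 : mass f 0 = ∫ q, fin q := by
    refine integral_congr_ae ?_
    filter_upwards [hf.initial, hpos 0 le_rfl] with p h1 h2
    rw [← h1, abs_of_nonneg h2]
  rw [← h0]
  rcases ht.eq_or_lt with rfl | ht
  · exact le_rfl
  have hmono : ∀ t₁, 0 < t₁ → t₁ ≤ t → mass f t ≤ mass f t₁ := by
    intro t₁ h1 h1t
    have hτ : 0 < t₁ / 4 := by positivity
    obtain ⟨g, h, hu⟩ := hf.exists_isSub hlam hLam ha hpos hτ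
    -- This bound, from continuity on a compact interval, serves only to make the integral over the
    -- slab finite.
    obtain ⟨M, hM⟩ := (isCompact_Icc (a := (0 : ℝ)) (b := t + 1 + t₁)).exists_bound_of_continuousOn
      (hm.mono fun s hs => hs.1)
    have hfin := lintegral_slab_le (a₁ := t₁ / 2) (b₁ := t + 1 + t₁) hf hτ
      fun s h0 hs => (le_abs_self _).trans (hM s ⟨h0, hs⟩)
    have hfin' := ne_top_of_le_ne_top (ENNReal.mul_ne_top ENNReal.ofReal_ne_top
      ENNReal.ofReal_ne_top) hfin
    refine le_of_integral_mul_deriv_nonneg (T := t₁) (T₂ := t + 1) (hm.mono fun s hs =>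
      h1.le.trans hs.1) (fun ψ hψ hψ0 hψs => ?_) le_rfl h1t (by linarith)
    have key := hu.integral_mul_deriv_nonneg hlam hLam h1 (by linarith) hfin' hψ hψ0 hψs
    set u : Z d → ℝ := {z : Z d | t₁ / 4 < z.1}.indicator fun z => |f z| with hudef
    have hψc : HasCompactSupport ψ := isCompact_Icc.of_isClosed_subset (isClosed_tsupport _) hψs
    have hψ' : Continuous (deriv ψ) := hψ.continuous_deriv (by simp)
    obtain ⟨B, hB⟩ := hψc.deriv.exists_bound_of_continuous hψ'
    have hout : ∀ s, s ∉ Set.Icc t₁ (t + 1) → deriv ψ s = 0 := fun s hs => by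
      by_contra h
      exact hs (hψs (support_deriv_subset h))
    have hint : Integrable fun z : Z d => u z * deriv ψ z.1 := by
      have h2 : IntegrableOn u (slab d (t₁ / 2) (t + 1 + t₁)) :=
        ⟨hu.locL2_fst.aestronglyMeasurable.restrict, lt_top_iff_ne_top.2 hfin'⟩
      have h3 : IntegrableOn (fun z : Z d => u z * deriv ψ z.1) (slab d (t₁ / 2) (t + 1 + t₁)) :=
        Integrable.mul_bdd (c := B) h2 (hψ'.comp continuous_fst).aestronglyMeasurable
          (Eventually.of_forall fun z => hB _)
      refine h3.integrable_of_forall_notMem_eq_zero fun z hz => ?_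
      rw [hout z.1 fun h => hz ⟨by linarith [h.1], by linarith [h.2]⟩, mul_zero]
    rw [Measure.volume_eq_prod] at hint key
    rw [integral_prod _ hint] at key
    refine key.trans (le_of_eq (integral_congr_ae (Eventually.of_forall fun s => ?_)))
    by_cases hs : s ∈ Set.Icc t₁ (t + 1)
    · simp only
      rw [integral_mul_const, mass]
      congr 1
      refine integral_congr_ae (Eventually.of_forall fun p => ?_)
      exact Set.indicator_of_mem (show ((s, p) : Z d) ∈ {z : Z d | t₁ / 4 < z.1} from
        (by linarith [hs.1] : t₁ / 4 < s)) fun z => |f z|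
    · simp [hout s hs]
  have hlim : Tendsto (mass f) (𝓝[>] 0) (𝓝 (mass f 0)) :=
    (hm 0 Set.self_mem_Ici).mono_left (nhdsWithin_mono _ Set.Ioi_subset_Ici_self)
  refine ge_of_tendsto hlim ?_
  filter_upwards [Ioc_mem_nhdsGT ht] with s hs
  exact hmono s hs.1 hs.2

/-- The cylinders with velocity radius √T + n and position radius (√T + n) T exhaust the slab, with
a constant independent of n. The mass bound controls the integral over times from T/2 to 3T, of
length (5/2) T. As (√T)^{4d+2} = T^{2d} T, the quotient is of order T^{-2d}. -/
theorem exists_ae_bound (d : ℕ) {lam Lam : ℝ} (hlam : 0 < lam) (hLam : 0 < Lam) :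
    ∃ C : ℝ, 0 < C ∧ ∀ a : Z d → Matrix (Fin d) (Fin d) ℝ, IsElliptic lam Lam a →
      ∀ (fin : E d × E d → ℝ) (f : Z d → ℝ), IsSolution a fin f →
      (∀ t : ℝ, 0 ≤ t → ∀ᵐ p : E d × E d, 0 ≤ f (t, p)) →
      ∀ T : ℝ, 0 < T → ∀ᵐ z : Z d, z ∈ slab d T (2 * T) →
        f z ≤ C / T ^ (2 * d) * ∫ q, fin q := by
  obtain ⟨A0, hA0, hscale⟩ := exists_isScale_cyl d
  obtain ⟨C, hC, hbd⟩ := exists_local_bound d hlam hLam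
  refine ⟨C * A0 ^ (4 * d + 2) * (5 / 2), by positivity,
    fun a ha fin f hf hpos T hT => ?_⟩
  have hτ : 0 < T / 4 := by positivity
  obtain ⟨g, h, hu⟩ := hf.exists_isSub hlam hLam ha hpos hτ
  set u : Z d → ℝ := {z : Z d | T / 4 < z.1}.indicator fun z => |f z| with hudef
  set m0 := ∫ q, fin q with hm0
  have hm00 : 0 ≤ m0 := (integral_nonneg fun _ => abs_nonneg _).trans
    (hf.mass_le hlam hLam ha hpos le_rfl)
  have hfin := lintegral_slab_le (a₁ := T / 2) (b₁ := 3 * T) hf hτ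
    fun s h0 _ => hf.mass_le hlam hLam ha hpos h0
  have hloc : ∀ n : ℕ, ∀ᵐ z, z ∈ cyl T (2 * T) (√T + n) ((√T + n) * T) (0 : E d) 0 0 →
      u z ≤ C * (A0 / √T) ^ (4 * d + 2) * (5 / 2 * T * m0) := by
    intro n
    have hsT : 0 < √T := Real.sqrt_pos.2 hT
    have hn : (0 : ℝ) ≤ n := n.cast_nonneg
    have hs := hscale (T / 4) T (2 * T) (√T + n) ((√T + n) * T) 0 0 hT (by linarith) (by positivity)
      (by nlinarith [Real.sq_sqrt hT.le, mul_nonneg hsT.le hn]) le_rfl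
    have h1 := hbd (T / 4) u g h hu (A0 / √T) _ (by positivity) hs
    filter_upwards [h1] with z hz hzD
    refine (hz hzD).trans (mul_le_mul_of_nonneg_left ?_ (by positivity))
    rw [integral_eq_lintegral_of_nonneg_ae (Eventually.of_forall fun z => hu.nonneg z)
      hu.locL2_fst.aestronglyMeasurable.restrict]
    refine ENNReal.toReal_le_of_le_ofReal (by positivity) ?_
    have e : 5 / 2 * T * m0 = m0 * (3 * T - T / 2) := by ring
    rw [e, ENNReal.ofReal_mul hm00]
    refine le_trans ?_ hfin
    calc ∫⁻ z in cyl T (2 * T) (√T + n) ((√T + n) * T) (0 : E d) 0 1, ENNReal.ofReal (u z)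
        ≤ ∫⁻ z in slab d (T / 2) (3 * T), ENNReal.ofReal (u z) := by
          refine lintegral_mono_set fun z hz => ?_
          obtain ⟨h2, h3, -, -⟩ := hz
          exact ⟨by linarith, by linarith⟩
      _ = _ := by
          refine lintegral_congr fun z => ?_
          rw [← ofReal_norm, Real.norm_of_nonneg (hu.nonneg z)]
  filter_upwards [ae_all_iff.2 hloc] with z hz hzT
  obtain ⟨n, hn⟩ := exists_nat_ge (‖z.2.2‖ + ‖z.2.1‖ / T)
  have hsT : 0 ≤ √T := Real.sqrt_nonneg _
  have hv : ‖z.2.2‖ ≤ √T + n := by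
    have : 0 ≤ ‖z.2.1‖ / T := by positivity
    linarith
  have hx : ‖z.2.1‖ ≤ (√T + n) * T := by
    rw [← div_le_iff₀ hT]
    linarith [norm_nonneg z.2.2]
  have hmem : z ∈ cyl T (2 * T) (√T + n) ((√T + n) * T) (0 : E d) 0 0 := by
    refine ⟨by linarith [hzT.1], by linarith [hzT.2], ?_, ?_⟩
    · have := pow_le_pow_left₀ (norm_nonneg _) hv 2
      simp only [sub_zero]
      linarith
    · have := pow_le_pow_left₀ (norm_nonneg _) hx 2
      simp only [sub_zero, smul_zero]
      linarith
  have h1 := hz n hmem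
  have hzu : u z = |f z| := Set.indicator_of_mem (show z ∈ {z : Z d | T / 4 < z.1} from
    (by linarith [hzT.1] : T / 4 < z.1)) _
  rw [hzu] at h1
  refine (le_abs_self _).trans (h1.trans (le_of_eq ?_))
  have e : (√T) ^ (4 * d + 2) = T ^ (2 * d) * T := by
    rw [show 4 * d + 2 = 2 * (2 * d + 1) by ring, pow_mul, Real.sq_sqrt hT.le, pow_succ]
  rw [div_pow, e]
  field_simp

/-- Almost every time s satisfies the bound, in particular times arbitrarily close to t. For those,
∫ (f(t) − K)₊ ≤ ∫ |f(s) − f(t)|, which tends to zero by continuity in L¹. -/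
theorem IsSolution.slice_bound {a : Z d → Matrix (Fin d) (Fin d) ℝ} {fin : E d × E d → ℝ}
    {f : Z d → ℝ} (hf : IsSolution a fin f) {t₁ t₂ K : ℝ} (h1 : 0 ≤ t₁)
    (hK : ∀ᵐ z : Z d, z ∈ slab d t₁ t₂ → f z ≤ K) {t : ℝ} (ht1 : t₁ < t) (ht2 : t < t₂)
    (hK0 : 0 ≤ K) : ∀ᵐ p : E d × E d, f (t, p) ≤ K := by
  have h0 : 0 ≤ t := h1.trans ht1.le
  rw [Measure.volume_eq_prod] at hK
  have hs : ∀ᵐ s : ℝ, ∀ᵐ p : E d × E d, (s, p) ∈ slab d t₁ t₂ → f (s, p) ≤ K :=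
    Measure.ae_ae_of_ae_prod hK
  have it := hf.integrable t h0
  have hi : Integrable fun p : E d × E d => max (f (t, p) - K) 0 := by
    refine it.abs.mono' (((it.aestronglyMeasurable.sub aestronglyMeasurable_const)).sup
      aestronglyMeasurable_const) (Eventually.of_forall fun p => ?_)
    rw [Real.norm_of_nonneg (le_max_right _ _)]
    exact max_le (by linarith [le_abs_self (f (t, p))]) (abs_nonneg _)
  have hle : ∫ p : E d × E d, max (f (t, p) - K) 0 ≤ 0 := by
    by_contra hc
    push Not at hc
    have hnear := (hf.continuous t h0).eventually (gt_mem_nhds hc)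
    have hnear' : ∀ᶠ s in 𝓝 t, s ∈ Set.Ioo t₁ t₂ ∧
        ∫ p : E d × E d, |f (s, p) - f (t, p)| < ∫ p : E d × E d, max (f (t, p) - K) 0 := by
      rw [eventually_nhdsWithin_iff] at hnear
      filter_upwards [hnear, Ioo_mem_nhds ht1 ht2] with s hs1 hs2
      exact ⟨hs2, hs1 (h1.trans hs2.1.le)⟩
    obtain ⟨s, hs3, hs1, hs2⟩ := (Measure.dense_of_ae hs).inter_nhds_nonempty hnear'
    have is := hf.integrable s (h1.trans hs1.1.le)
    refine absurd hs2 (not_lt.2 (integral_mono_ae hi (is.sub it).abs ?_))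
    filter_upwards [hs3] with p hp
    have h2 := hp ⟨hs1.1.le, hs1.2.le⟩
    refine max_le ?_ (abs_nonneg _)
    linarith [neg_abs_le (f (s, p) - f (t, p))]
  have hae := (integral_eq_zero_iff_of_nonneg (fun p => le_max_right (f (t, p) - K) 0) hi).1
    (le_antisymm hle (integral_nonneg fun p => le_max_right _ _))
  filter_upwards [hae] with p hp
  have h2 := le_max_left (f (t, p) - K) 0
  simp only [Pi.zero_apply] at hp
  linarith

end Solution

end KineticFP

theorem corollary1p3 (d : ℕ) (hd : 1 ≤ d) (lam Lam : ℝ) (hlam : 0 < lam) (hLam : lam ≤ Lam) :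
    ∃ C : ℝ, 0 < C ∧
      ∀ a : KineticFP.Z d → Matrix (Fin d) (Fin d) ℝ, KineticFP.IsElliptic lam Lam a →
      ∀ (fin : KineticFP.E d × KineticFP.E d → ℝ) (f : KineticFP.Z d → ℝ),
        KineticFP.IsSolution a fin f →
        (∀ t : ℝ, 0 ≤ t → ∀ᵐ p : KineticFP.E d × KineticFP.E d, 0 ≤ f (t, p)) →
        ∀ t : ℝ, 0 < t → ∀ᵐ p : KineticFP.E d × KineticFP.E d,
          f (t, p) ≤ C / t ^ (2 * d) * ∫ q : KineticFP.E d × KineticFP.E d, fin q := by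
  have hLam0 : 0 < Lam := hlam.trans_le hLam
  obtain ⟨C, hC, hbd⟩ := KineticFP.exists_ae_bound d hlam hLam0
  refine ⟨C * (3 / 2) ^ (2 * d), by positivity, fun a ha fin f hf hpos t ht => ?_⟩
  have hm0 : 0 ≤ ∫ q, fin q := (integral_nonneg fun _ => abs_nonneg _).trans
    (hf.mass_le hlam hLam0 ha hpos le_rfl)
  -- With T = 2t/3 the time t = 3T/2 is interior to [T, 2T], as the passage to slices requires; the
  -- factor (3/2)^{2d} in the constant pays for it.
  have h1 := hbd a ha fin f hf hpos (2 / 3 * t) (by positivity)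
  have e : C * (3 / 2) ^ (2 * d) / t ^ (2 * d) = C / (2 / 3 * t) ^ (2 * d) := by
    rw [mul_pow, show (3 / 2 : ℝ) = (2 / 3)⁻¹ by norm_num, inv_pow]
    field_simp
  rw [e]
  exact hf.slice_bound (by positivity) h1 (by linarith) (by linarith) (by positivity)
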